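/- **Setting.** An instance of Optimal House Allocation of Agent Network consists of a set of $n$ agents, a set $\mathcal H$ of $m$ houses, a graph $G$ on the agents, and for every agent $a$ a set $P_a\subseteq\mathcal H$ of preferred houses. An allocation is an injective map $\phi$ from agents to houses; agent $a$ is envious if $\phi(a)\notin P_a$ and some neighbour $b$ of $a$ has $\phi(b)\in P_a$; the task is to compute an allocation with the least number of envious agents. In the annotated version the input also contains sets $F_a\subseteq\mathcal H$ of feasible houses and a set $B$ of angry agents; one has to compute an allocation with $\phi(a)\in F_a$ for all $a$ (or report that there is none) minimizing $$\bigl|\{a\notin B:\ \phi(a)\notin P_a,\ \exists b\ \text{adjacent to } a,\ \phi(b)\in P_a\}\bigr|+\bigl|\{a\in B:\ \phi(a)\notin P_a\}\bigr| .$$ The plain problem is the case $B=\emptyset$, $F_a=\mathcal H$. A graph class $\mathfrak G$ is $f(n)$-balanced-separable if for every $G\in\mathfrak G$ with $n$ vertices, all induced subgraphs of $G$ are in $\mathfrak G$ and the vertex set of $G$ has a partition $(S,V_1,V_2)$ (parts may be empty) with $|S|\le f(n)$, $|V_1|,|V_2|\le 2n/3$ and no edge between $V_1$ and $V_2$. **The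 separator algorithm.** First guess the set of $n$ houses that are used. Then run the following recursive procedure, on agents $A$ and houses $H$ with $|H|=|A|$. If $A=\emptyset$, return $0$. Otherwise find by brute force a partition $(S,A_1,A_2)$ of $A$ as above, with $|S|$ as small as possible. For all injective choices of feasible houses $\phi(a)$, $a\in S$: let $C$ be the set of agents in $S$ with a preferred house, $D$ the set of non-angry agents in $S\setminus C$ that envy a neighbour in $S$, $Q$ the set of angry agents in $S\setminus C$, and $R=S\setminus(C\cup D\cup Q)$; make every agent in $A\setminus S$ angry that has a neighbour in $S$ whose house it prefers. For all sets $H_1\subseteq H\setminus\phi(S)$ with $|H_1|=|A_1|$, with $H_2=H\setminus(\phi(S)\cup H_1)$, and for all $K\subseteq R$ (agents guessed to be non-envious): delete $P_a$ from $F_{a'}$ for all $a\in K$ and all neighbours $a'\in A\setminus S$ of $a$, solve the subinstances on $(A_1,H_1)$ and $(A_2,H_2)$ recursively, and add $|D|+|Q|+|R\setminus K|$ to the sum of their values. Return the least value found and an allocation that attains it. **Statement.** Consider inputs with $n\ge 1$ and $m=O(n)$. Then the separator algorithm solves the annotated problem, and hence Optimal House Allocation of Agent Network, with the following worst-case running times,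 counted in elementary steps (variable accesses, additions and comparisons of numbers, list operations, loop iterations, procedure calls): 1. $2^{O(\mathrm{tw}\cdot\log^2 n+n)}$ if the agent graph has treewidth at most $\mathrm{tw}$. That is, for every $c$ there is a constant $C$ such that for all $\mathrm{tw}\ge 0$, $n\ge 1$, $m\le cn$, at most $2^{C(\mathrm{tw}\log^2 n+n)}$ steps are made on every instance with $n$ agents, $m$ houses and an agent graph of treewidth at most $\mathrm{tw}$. 2. $2^{O(n)}$ if the agent graph comes from an $O(n/\log n)$-balanced-separable class. That is, for every $f$ with $f(n)=O(n/\log n)$ and every $c$ there is a constant $C$ such that for every $f(n)$-balanced-separable class $\mathfrak G$ and all $n\ge 1$, $m\le cn$, at most $2^{Cn}$ steps are made on every instance with $n$ agents, $m$ houses and an agent graph in $\mathfrak G$. -/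

import Mathlib

open Filter Asymptotics

namespace HouseAllocation

/-! ### The allocation problems -/

/-- An instance of Optimal House Allocation of Agent Network with `n` agents and `m` houses:
an agent graph and, for every agent, the set of preferred houses. -/
structure Network (n m : ℕ) where
  graph : SimpleGraph (Fin n)
  pref : Fin n → Finset (Fin m)

/-- The set of neighbours whom agent `a` envies under the allocation `φ`. -/
def Network.enviedBy {n m : ℕ} (I : Network n m) (φ : Fin n → Fin m) (a : Fin n) : Set (Fin n) :=
  {b | I.graph.Adj a b ∧ φ a ∉ I.pref a ∧ φ b ∈ I.pref a}

/-- The envy of an allocation: its number of envious agents. -/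
noncomputable def Network.envy {n m : ℕ} (I : Network n m) (φ : Fin n → Fin m) : ℕ :=
  {a | (I.enviedBy φ a).Nonempty}.ncard

/-- An instance of the annotated problem: in addition, feasible houses for every agent and a set of
angry agents, who are envious as soon as they do not get a preferred house. -/
structure AnnotatedNetwork (n m : ℕ) extends Network n m where
  feas : Fin n → Finset (Fin m)
  angry : Finset (Fin n)

/-- Allocations are injective and respect the feasible sets. -/
def AnnotatedNetwork.IsFeasible {n m : ℕ} (I : AnnotatedNetwork n m) (φ : Fin n → Fin m) : Prop :=
  Function.Injective φ ∧ ∀ a, φ a ∈ I.feas a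

/-- The annotated envy of an allocation. -/
noncomputable def AnnotatedNetwork.cost {n m : ℕ} (I : AnnotatedNetwork n m)
    (φ : Fin n → Fin m) : ℕ :=
  {a | a ∉ I.angry ∧ φ a ∉ I.pref a ∧ ∃ b, I.graph.Adj a b ∧ φ b ∈ I.pref a}.ncard +
    {a | a ∈ I.angry ∧ φ a ∉ I.pref a}.ncard

/-- A plain instance as an annotated one: all houses are feasible and nobody is angry. -/
def Network.annotate {n m : ℕ} (I : Network n m) : AnnotatedNetwork n m where
  toNetwork := I
  feas := fun _ => Finset.univ
  angry := ∅

/-- The list `L` of pairs (agent, house) is the graph of `φ`. -/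
def ListsAllocation {n m : ℕ} (L : List (ℕ × ℕ)) (φ : Fin n → Fin m) : Prop :=
  ∀ p : ℕ × ℕ, p ∈ L ↔ ∃ a : Fin n, p = ((a : ℕ), (φ a : ℕ))

/-- What it means to answer a minimization problem over allocations: the answer is `none` when
there is no admissible allocation, and otherwise the minimum together with an admissible
allocation that attains it. -/
def IsOptimalAnswer {n m : ℕ} (admissible : (Fin n → Fin m) → Prop) (cost : (Fin n → Fin m) → ℕ) :
    Option (ℕ × List (ℕ × ℕ)) → Prop
  | none => ∀ φ, ¬ admissible φ
  | some (ξ, L) => ∃ φ, admissible φ ∧ (∀ ψ, admissible ψ → cost φ ≤ cost ψ) ∧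
      ξ = cost φ ∧ ListsAllocation L φ

/-- `r` is a correct answer to the annotated problem. -/
def AnnotatedNetwork.IsSolution {n m : ℕ} (I : AnnotatedNetwork n m)
    (r : Option (ℕ × List (ℕ × ℕ))) : Prop :=
  IsOptimalAnswer I.IsFeasible I.cost r

/-- `r` is a correct answer to Optimal House Allocation of Agent Network. -/
def Network.IsSolution {n m : ℕ} (I : Network n m) (r : Option (ℕ × List (ℕ × ℕ))) : Prop :=
  IsOptimalAnswer (fun φ : Fin n → Fin m => Function.Injective φ) I.envy r

/-! ### Graph classes with small balanced separators, and treewidth -/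

/-- A class of graphs. -/
abbrev GraphClass := ∀ V : Type, SimpleGraph V → Prop

/-- `f(n)`-balanced-separable graph classes (of finite graphs). -/
def IsBalancedSeparable (𝒢 : GraphClass) (f : ℕ → ℝ) : Prop :=
  ∀ (V : Type) [Fintype V] (G : SimpleGraph V), 𝒢 V G →
    (∀ s : Set V, 𝒢 s (G.induce s)) ∧
    ∃ S V₁ V₂ : Finset V,
      Disjoint S V₁ ∧ Disjoint S V₂ ∧ Disjoint V₁ V₂ ∧ (∀ v, v ∈ S ∨ v ∈ V₁ ∨ v ∈ V₂) ∧
      (S.card : ℝ) ≤ f (Fintype.card V) ∧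
      (V₁.card : ℝ) ≤ 2 * (Fintype.card V : ℝ) / 3 ∧
      (V₂.card : ℝ) ≤ 2 * (Fintype.card V : ℝ) / 3 ∧
      ∀ u ∈ V₁, ∀ v ∈ V₂, ¬ G.Adj u v

/-- The graph `G` has treewidth at most `k`: it has a tree decomposition all of whose bags have
at most `k + 1` vertices. -/
def HasTreewidthAtMost {V : Type} (G : SimpleGraph V) (k : ℕ) : Prop :=
  ∃ (ι : Type) (_ : Fintype ι) (T : SimpleGraph ι) (bag : ι → Finset V),
    T.IsTree ∧
    (∀ v, ∃ i, v ∈ bag i) ∧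
    (∀ u v, G.Adj u v → ∃ i, u ∈ bag i ∧ v ∈ bag i) ∧
    (∀ v, (T.induce {i | v ∈ bag i}).Connected) ∧
    ∀ i, (bag i).card ≤ k + 1

/-! ### The machine model

A small typed first-order language with one recursive procedure. Every elementary operation, every
access to a variable, every iteration of a loop and every procedure call costs one step. The only
operations on numbers are literals, addition and comparison. Data are immutable, so that a binding
copies a pointer. -/

/-- Data types. -/
inductive Ty where
  | bool
  | nat
  | prod (a b : Ty)
  | list (a : Ty)
  | opt (a : Ty)

/-- The values of a data type. -/
@[reducible] def Ty.Val : Ty → Type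
  | .bool => Bool
  | .nat => ℕ
  | .prod a b => a.Val × b.Val
  | .list a => List a.Val
  | .opt a => Option a.Val

/-- Expressions of type `a` over variables `V`, where the recursive procedure takes an argument of
type `σ` and returns a value of type `τ`. Binders are functions of a variable. -/
inductive Expr (σ τ : Ty) (V : Ty → Type) : Ty → Type where
  | var {a : Ty} (x : V a) : Expr σ τ V a
  | tt : Expr σ τ V .bool
  | ff : Expr σ τ V .bool
  | ite {a : Ty} (c : Expr σ τ V .bool) (t e : Expr σ τ V a) : Expr σ τ V a
  | lit (k : ℕ) : Expr σ τ V .nat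
  | add (x y : Expr σ τ V .nat) : Expr σ τ V .nat
  | eq (x y : Expr σ τ V .nat) : Expr σ τ V .bool
  | le (x y : Expr σ τ V .nat) : Expr σ τ V .bool
  | pair {a b : Ty} (x : Expr σ τ V a) (y : Expr σ τ V b) : Expr σ τ V (.prod a b)
  | fst {a b : Ty} (p : Expr σ τ V (.prod a b)) : Expr σ τ V a
  | snd {a b : Ty} (p : Expr σ τ V (.prod a b)) : Expr σ τ V b
  | nil {a : Ty} : Expr σ τ V (.list a)
  | cons {a : Ty} (x : Expr σ τ V a) (l : Expr σ τ V (.list a)) : Expr σ τ V (.list a)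
  | foldr {a b : Ty} (f : V a → V b → Expr σ τ V b) (init : Expr σ τ V b)
      (l : Expr σ τ V (.list a)) : Expr σ τ V b
  | none {a : Ty} : Expr σ τ V (.opt a)
  | some {a : Ty} (x : Expr σ τ V a) : Expr σ τ V (.opt a)
  | optCase {a b : Ty} (o : Expr σ τ V (.opt a)) (onNone : Expr σ τ V b)
      (onSome : V a → Expr σ τ V b) : Expr σ τ V b
  | letE {a b : Ty} (x : Expr σ τ V a) (f : V a → Expr σ τ V b) : Expr σ τ V b
  | call (x : Expr σ τ V σ) : Expr σ τ V τ

/-- The value of an expression and the number of steps of its evaluation, where `self` gives the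
value and the number of steps of calls of the recursive procedure (`none` if undefined). -/
def Expr.eval {σ τ : Ty} (self : σ.Val → Option (τ.Val × ℕ)) :
    {a : Ty} → Expr σ τ Ty.Val a → Option (a.Val × ℕ)
  | _, .var x => Option.some (x, 1)
  | _, .tt => Option.some (true, 1)
  | _, .ff => Option.some (false, 1)
  | _, .ite c t e => do
      let (b, k) ← c.eval self
      match b with
      | true => do
          let (v, l) ← t.eval self
          return (v, k + l + 1)
      | false => do
          let (v, l) ← e.eval self
          return (v, k + l + 1)
  | _, .lit k => Option.some (k, 1)
  | _, .add x y => do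
      let (u, k) ← x.eval self
      let (v, l) ← y.eval self
      return (u + v, k + l + 1)
  | _, .eq x y => do
      let (u, k) ← x.eval self
      let (v, l) ← y.eval self
      return (decide (u = v), k + l + 1)
  | _, .le x y => do
      let (u, k) ← x.eval self
      let (v, l) ← y.eval self
      return (decide (u ≤ v), k + l + 1)
  | _, .pair x y => do
      let (u, k) ← x.eval self
      let (v, l) ← y.eval self
      return ((u, v), k + l + 1)
  | _, .fst p => do
      let (u, k) ← p.eval self
      return (u.1, k + 1)
  | _, .snd p => do
      let (u, k) ← p.eval self
      return (u.2, k + 1)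
  | _, .nil => Option.some ([], 1)
  | _, .cons x l => do
      let (u, j) ← x.eval self
      let (v, k) ← l.eval self
      return (u :: v, j + k + 1)
  | _, .foldr f init l => do
      let (v, j) ← l.eval self
      let (z, k) ← init.eval self
      v.foldr
        (fun x acc => do
          let (y, s) ← acc
          let (y', t) ← (f x y).eval self
          return (y', s + t + 1))
        (Option.some (z, j + k + 1))
  | _, .none => Option.some (Option.none, 1)
  | _, .some x => do
      let (u, k) ← x.eval self
      return (Option.some u, k + 1)
  | _, .optCase o onNone onSome => do
      let (u, k) ← o.eval self
      match u with
      | Option.none => do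
          let (v, l) ← onNone.eval self
          return (v, k + l + 1)
      | Option.some x => do
          let (v, l) ← (onSome x).eval self
          return (v, k + l + 1)
  | _, .letE x f => do
      let (u, k) ← x.eval self
      let (v, l) ← (f u).eval self
      return (v, k + l + 1)
  | _, .call x => do
      let (u, k) ← x.eval self
      let (v, l) ← self u
      return (v, k + l + 1)

/-- A program: a recursive procedure and a main routine, each written for an arbitrary type of
variables, so that values are accessed only through the operations of the language. -/
structure Program (σ τ : Ty) where
  proc : ∀ V : Ty → Type, V σ → Expr σ τ V τ
  main : ∀ V : Ty → Type, V σ → Expr σ τ V τ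

/-- The recursive procedure, with recursion depth cut off at `d`. -/
def Program.procEval {σ τ : Ty} (P : Program σ τ) : ℕ → σ.Val → Option (τ.Val × ℕ)
  | 0, _ => none
  | d + 1, x => (P.proc Ty.Val x).eval (P.procEval d)

/-- On input `x`, the program halts with output `y` after exactly `t` steps. -/
def Program.HaltsWith {σ τ : Ty} (P : Program σ τ) (x : σ.Val) (y : τ.Val) (t : ℕ) : Prop :=
  ∀ᶠ d in atTop, (P.main Ty.Val x).eval (P.procEval d) = some (y, t)

/-! ### The separator algorithm -/

/-- A list of pairs of numbers. -/
abbrev Ty.pairs : Ty := .list (.prod .nat .nat)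

/-- Inputs: agents, houses, edges (in both orientations), preferred (agent, house) pairs, feasible
(agent, house) pairs, angry agents. -/
abbrev Ty.input : Ty :=
  .prod (.list .nat) (.prod (.list .nat) (.prod .pairs (.prod .pairs (.prod .pairs (.list .nat)))))

/-- Outputs: nothing, or the minimum envy and a list of (agent, house) pairs. -/
abbrev Ty.output : Ty := .opt (.prod .nat .pairs)

/-- Expressions of the separator algorithm. -/
abbrev Code (V : Ty → Type) (a : Ty) : Type := Expr .input .output V a

namespace Code

scoped prefix:max "♯" => Expr.var

variable {V : Ty → Type} {a b : Ty}

def neg (x : Code V .bool) : Code V .bool := .ite x .ff .tt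

def and (x y : Code V .bool) : Code V .bool := .ite x y .ff

def or (x y : Code V .bool) : Code V .bool := .ite x .tt y

def any (p : V a → Code V .bool) (l : Code V (.list a)) : Code V .bool :=
  .foldr (fun x r => or (p x) ♯r) .ff l

def isEmpty (l : Code V (.list a)) : Code V .bool :=
  .foldr (fun _ _ => .ff) .tt l

def mem (x : Code V .nat) (l : Code V (.list .nat)) : Code V .bool :=
  any (fun y => .eq x ♯y) l

def memPair (x y : Code V .nat) (l : Code V .pairs) : Code V .bool :=
  any (fun p => and (.eq (.fst ♯p) x) (.eq (.snd ♯p) y)) l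

def filter (p : V a → Code V .bool) (l : Code V (.list a)) : Code V (.list a) :=
  .foldr (fun x r => .ite (p x) (.cons ♯x ♯r) ♯r) .nil l

def length (l : Code V (.list a)) : Code V .nat :=
  .foldr (fun _ r => .add (.lit 1) ♯r) (.lit 0) l

def append (l l' : Code V (.list a)) : Code V (.list a) :=
  .foldr (fun x r => .cons ♯x ♯r) l' l

/-- All subsets of a set. -/
def subsets (l : Code V (.list a)) : Code V (.list (.list a)) :=
  .foldr (fun x acc =>
      .foldr (fun s r => .cons ♯s (.cons (.cons ♯x ♯s) ♯r)) .nil ♯acc)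
    (.cons .nil .nil) l

/-- All ordered partitions of a set into three sets (which may be empty). -/
def partitions (l : Code V (.list a)) :
    Code V (.list (.prod (.list a) (.prod (.list a) (.list a)))) :=
  .foldr (fun x acc =>
      .foldr (fun s r =>
          .letE (.fst ♯s) fun X =>
          .letE (.fst (.snd ♯s)) fun Y =>
          .letE (.snd (.snd ♯s)) fun Z =>
          .cons (.pair (.cons ♯x ♯X) (.pair ♯Y ♯Z))
          (.cons (.pair ♯X (.pair (.cons ♯x ♯Y) ♯Z))
          (.cons (.pair ♯X (.pair ♯Y (.cons ♯x ♯Z))) ♯r)))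
        .nil ♯acc)
    (.cons (.pair .nil (.pair .nil .nil)) .nil) l

/-- The triple `s = (S, A₁, A₂)` is a balanced separation of the graph `(A, E)`: both sides have
size at most `2|A|/3`, and no edge joins them. -/
def isBalanced (A : V (.list .nat)) (E : V .pairs)
    (s : V (.prod (.list .nat) (.prod (.list .nat) (.list .nat)))) : Code V .bool :=
  .letE (.fst (.snd ♯s)) fun A₁ =>
  .letE (.snd (.snd ♯s)) fun A₂ =>
  .letE (length ♯A) fun k =>
  .letE (length ♯A₁) fun k₁ =>
  .letE (length ♯A₂) fun k₂ =>
  and (.le (.add ♯k₁ (.add ♯k₁ ♯k₁)) (.add ♯k ♯k)) <|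
  and (.le (.add ♯k₂ (.add ♯k₂ ♯k₂)) (.add ♯k ♯k)) <|
  neg (any (fun u => any (fun v => memPair ♯u ♯v ♯E) ♯A₂) ♯A₁)

/-- A balanced separation `(S, A₁, A₂)` with `S` as small as possible, by brute force. -/
def separation (A : V (.list .nat)) (E : V .pairs) :
    Code V (.opt (.prod (.list .nat) (.prod (.list .nat) (.list .nat)))) :=
  .foldr (fun s best =>
      .ite (isBalanced A E s)
        (.optCase ♯best (.some ♯s) fun t =>
          .ite (.le (length (.fst ♯s)) (length (.fst ♯t))) (.some ♯s) ♯best)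
        ♯best)
    .none (partitions ♯A)

/-- All injective choices of a feasible house for every agent in `S`, as lists of pairs. -/
def choices (S : V (.list .nat)) (F : V .pairs) : Code V (.list .pairs) :=
  .foldr (fun x acc =>
      .foldr (fun φ r =>
          .foldr (fun p r' =>
              .ite (and (.eq (.fst ♯p) ♯x) (neg (any (fun q => .eq (.snd ♯q) (.snd ♯p)) ♯φ)))
                (.cons (.cons ♯p ♯φ) ♯r') ♯r')
            ♯r ♯F)
        .nil ♯acc)
    (.cons .nil .nil) ♯S

/-- The better of two outputs. -/
def better (x y : V .output) : Code V .output :=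
  .optCase ♯x ♯y fun u => .optCase ♯y ♯x fun v => .ite (.le (.fst ♯u) (.fst ♯v)) ♯x ♯y

/-- The loop that returns the best of the outputs `e x`, over all `x` in `l`. -/
def bestOver (l : Code V (.list a)) (e : V a → Code V .output) : Code V .output :=
  .foldr (fun x best => .letE (e x) fun y => better y best) .none l

/-- The pairs in `l` with first component in `X` and second component in `Y`. -/
def within (l : V .pairs) (X Y : V (.list .nat)) : Code V .pairs :=
  filter (fun p => and (mem (.fst ♯p) ♯X) (mem (.snd ♯p) ♯Y)) ♯l

/-- The instance induced by the agents `A` and the houses `H`. -/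
def restrict (A H : V (.list .nat)) (E P F : V .pairs) (B : V (.list .nat)) : Code V .input :=
  .pair ♯A (.pair ♯H (.pair (within E A A) (.pair (within P A H) (.pair (within F A H)
    (filter (fun x => mem ♯x ♯B) ♯A)))))

/-- Under the partial allocation `φ`, agent `y` gets a house that agent `x` prefers. -/
def likes (P φ : V .pairs) (x y : V .nat) : Code V .bool :=
  any (fun p => and (.eq (.fst ♯p) ♯y) (memPair ♯x (.snd ♯p) ♯P)) ♯φ

/-- The recursive procedure for the annotated problem, on inputs with as many houses as agents. -/
def ohaanr (I : V .input) : Code V .output :=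
  .letE (.fst ♯I) fun A =>
  .letE (.fst (.snd ♯I)) fun H =>
  .letE (.fst (.snd (.snd ♯I))) fun E =>
  .letE (.fst (.snd (.snd (.snd ♯I)))) fun P =>
  .letE (.fst (.snd (.snd (.snd (.snd ♯I))))) fun F =>
  .letE (.snd (.snd (.snd (.snd (.snd ♯I))))) fun B =>
  .ite (isEmpty ♯A) (.some (.pair (.lit 0) .nil)) <|
  .optCase (separation A E) .none fun sep =>
  .letE (.fst ♯sep) fun S =>
  .letE (.fst (.snd ♯sep)) fun A₁ =>
  .letE (.snd (.snd ♯sep)) fun A₂ =>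
  bestOver (choices S F) fun φ =>
  .letE (filter (fun x => likes P φ x x) ♯S) fun C =>
  .letE (filter (fun x => and (neg (mem ♯x ♯B)) (and (neg (likes P φ x x))
    (any (fun y => and (memPair ♯x ♯y ♯E) (likes P φ x y)) ♯S))) ♯S) fun D =>
  .letE (filter (fun x => and (mem ♯x ♯B) (neg (likes P φ x x))) ♯S) fun Q =>
  .letE (filter (fun x => neg (or (mem ♯x ♯C) (or (mem ♯x ♯D) (mem ♯x ♯Q)))) ♯S) fun R =>
  .letE (append ♯B (filter (fun y => and (neg (mem ♯y ♯S))
    (any (fun x => and (memPair ♯x ♯y ♯E) (likes P φ y x)) ♯S)) ♯A)) fun B' =>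
  .letE (filter (fun h => neg (any (fun p => .eq (.snd ♯p) ♯h) ♯φ)) ♯H) fun H₀ =>
  bestOver (filter (fun X => .eq (length ♯X) (length ♯A₁)) (subsets ♯H₀)) fun H₁ =>
  .letE (filter (fun h => neg (mem ♯h ♯H₁)) ♯H₀) fun H₂ =>
  bestOver (subsets ♯R) fun K =>
  .letE (filter (fun p => neg (any (fun x =>
    and (memPair ♯x (.fst ♯p) ♯E) (memPair ♯x (.snd ♯p) ♯P)) ♯K)) ♯F) fun F' =>
  .letE (.call (restrict A₁ H₁ E P F' B')) fun r₁ =>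
  .letE (.call (restrict A₂ H₂ E P F' B')) fun r₂ =>
  .optCase ♯r₁ .none fun u₁ =>
  .optCase ♯r₂ .none fun u₂ =>
  .some (.pair
    (.add (length ♯D) (.add (length ♯Q) (.add (length (filter (fun x => neg (mem ♯x ♯K)) ♯R))
      (.add (.fst ♯u₁) (.fst ♯u₂)))))
    (append ♯φ (append (.snd ♯u₁) (.snd ♯u₂))))

/-- The main routine: guess the set of houses that are allocated, and call the procedure. -/
def guessHouses (I : V .input) : Code V .output :=
  .letE (.fst ♯I) fun A =>
  .letE (.fst (.snd ♯I)) fun H =>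
  .letE (.fst (.snd (.snd ♯I))) fun E =>
  .letE (.fst (.snd (.snd (.snd ♯I)))) fun P =>
  .letE (.fst (.snd (.snd (.snd (.snd ♯I))))) fun F =>
  .letE (.snd (.snd (.snd (.snd (.snd ♯I))))) fun B =>
  bestOver (filter (fun X => .eq (length ♯X) (length ♯A)) (subsets ♯H)) fun H' =>
  .call (restrict A H' E P F B)

end Code

/-- The separator algorithm. -/
def separatorAlgorithm : Program .input .output where
  proc := fun _ I => Code.ohaanr I
  main := fun _ I => Code.guessHouses I

open Classical in
/-- The input of the algorithm that describes an instance; agents and houses are numbered from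
zero. -/
noncomputable def AnnotatedNetwork.encode {n m : ℕ} (I : AnnotatedNetwork n m) : Ty.input.Val :=
  (List.range n, List.range m,
    (((List.finRange n).product (List.finRange n)).filter fun p => I.graph.Adj p.1 p.2).map
      (fun p => ((p.1 : ℕ), (p.2 : ℕ))),
    (((List.finRange n).product (List.finRange m)).filter fun p => p.2 ∈ I.pref p.1).map
      (fun p => ((p.1 : ℕ), (p.2 : ℕ))),
    (((List.finRange n).product (List.finRange m)).filter fun p => p.2 ∈ I.feas p.1).map
      (fun p => ((p.1 : ℕ), (p.2 : ℕ))),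
    ((List.finRange n).filter fun x => x ∈ I.angry).map (fun x => (x : ℕ)))

/-- The separator algorithm solves the annotated problem on `I` in at most `T` steps. -/
def AnnotatedNetwork.SolvedWithin {n m : ℕ} (I : AnnotatedNetwork n m) (T : ℝ) : Prop :=
  ∃ (r : Option (ℕ × List (ℕ × ℕ))) (t : ℕ),
    separatorAlgorithm.HaltsWith I.encode r t ∧ I.IsSolution r ∧ (t : ℝ) ≤ T

/-- The separator algorithm, applied to `I` with no restriction on the allocation and no angry
agents, solves Optimal House Allocation of Agent Network on `I` in at most `T` steps. -/
def Network.SolvedWithin {n m : ℕ} (I : Network n m) (T : ℝ) : Prop :=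
  ∃ (r : Option (ℕ × List (ℕ × ℕ))) (t : ℕ),
    separatorAlgorithm.HaltsWith I.annotate.encode r t ∧ I.IsSolution r ∧ (t : ℝ) ≤ T

end HouseAllocation

/-! Correctness. The procedure guesses the houses `g` of a separator `S`, the set `H₁` of houses
used on the first side, and the set `K` of undecided agents of `S` that will not envy anybody. An
agent outside `S` has all its neighbours in `S` or on its own side, so, once it is made angry for
coveting a house of `S`, its unhappiness can be read off in its own subinstance
(`Separates.unhappy_iff`). Hence the cost of an allocation is a sum of two subinstance costs and a
contribution of `S` (`Separates.listCost_eq`). Two inequalities then suffice. Any two answers of the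
subinstances glue to an allocation that costs at most the returned number (`Separates.witnesses`):
pruning the feasible pairs keeps the agents in `K` from envying, and the other undecided agents are
charged in any case. Conversely, for every allocation `ψ` one combination of guesses agrees with it,
where `K` consists of the undecided agents that do not covet a house under `ψ`; there the charge is
exact and `ψ` restricts to both subinstances (`Separates.admissible_restrict`). The predicate
`Answers` records the two inequalities separately. It is stable under taking the better of two
outputs, so that each of the nested loops answers for the union of the allocations covered by its
iterations (`Code.runs_bestOver`).

Running time. `Runs` bounds the number of steps compositionally along the syntax of the program. One
call on `k` agents makes at most `k ^ s` choices of houses for a separator of size `s`, `2 ^ k`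
choices of `H₁` and `2 ^ k` of `K`, and two calls on at most `2 k / 3` agents for each combination;
everything else is polynomial in a bound `M` on the lengths of the input lists. If `s * log k ≤ c *
k + L` for every set of `k` agents, the logarithm of the running time satisfies a recursion whose
linear terms form a geometric series and whose constant terms `L` occur at logarithmically many
levels, with solution `3 (c + 5) k + L log k / log (3/2)` (`exists_exponent_step`, `procEval_spec`).
The initial guess of the houses costs a further factor `2 ^ m`.

Separators. In a tree decomposition, some bag leaves components with at most half of the vertices
each (`exists_centroid`), and these can be grouped into two sides of at most two thirds
(`exists_subset_two_thirds`). This gives `c = 0` and `L = (tw + 1) log n`. A balanced-separable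
class is hereditary, so its bound applies to every subset of the agents and gives `L = 0` with a
constant `c`. Brute force finds a separator no larger than these. -/

namespace HouseAllocation

/-! ### Evaluation within a number of steps -/

/-- The expression `e` evaluates to `v` in at most `T` steps. -/
def Runs {σ τ a : Ty} (self : σ.Val → Option (τ.Val × ℕ)) (e : Expr σ τ Ty.Val a) (v : a.Val)
    (T : ℕ) : Prop :=
  ∃ t, e.eval self = some (v, t) ∧ t ≤ T

namespace Runs

variable {σ τ a b : Ty} {self : σ.Val → Option (τ.Val × ℕ)}

theorem mono {e : Expr σ τ Ty.Val a} {v : a.Val} {T T' : ℕ} (h : Runs self e v T) (hT : T ≤ T') :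
    Runs self e v T' := by
  obtain ⟨t, h1, h2⟩ := h
  exact ⟨t, h1, h2.trans hT⟩

theorem congr {e : Expr σ τ Ty.Val a} {v v' : a.Val} {T T' : ℕ} (h : Runs self e v T)
    (hv : v = v') (hT : T ≤ T') : Runs self e v' T' := hv ▸ h.mono hT

theorem var (x : a.Val) : Runs self (.var x) x 1 := ⟨1, rfl, le_rfl⟩
-- These special cases of `var` fix the type of the programming language to which the value belongs.
theorem varNats (l : List ℕ) : Runs self (a := .list .nat) (.var l) l 1 := var _
theorem varPairs (l : List (ℕ × ℕ)) : Runs self (a := .list (.prod .nat .nat)) (.var l) l 1 := var _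
theorem varTriple (s : List ℕ × List ℕ × List ℕ) :
    Runs self (a := .prod (.list .nat) (.prod (.list .nat) (.list .nat))) (.var s) s 1 := var _
theorem varOutput (r : Option (ℕ × List (ℕ × ℕ))) : Runs self (a := .output) (.var r) r 1 := var _
theorem tt : Runs self .tt true 1 := ⟨1, rfl, le_rfl⟩
theorem ff : Runs self .ff false 1 := ⟨1, rfl, le_rfl⟩
theorem lit (k : ℕ) : Runs self (.lit k) k 1 := ⟨1, rfl, le_rfl⟩
theorem nil : Runs self (.nil : Expr σ τ Ty.Val (.list a)) [] 1 := ⟨1, rfl, le_rfl⟩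
theorem none : Runs self (.none : Expr σ τ Ty.Val (.opt a)) Option.none 1 := ⟨1, rfl, le_rfl⟩

/-- Only the branch that is taken has to run, so each branch may use the outcome of the test; the
value of the other branch is arbitrary. -/
theorem ite {c : Expr σ τ Ty.Val .bool} {t e : Expr σ τ Ty.Val a} {p : Bool} {v w : a.Val}
    {T T' : ℕ} (hc : Runs self c p T) (ht : p = true → Runs self t v T')
    (he : p = false → Runs self e w T') : Runs self (.ite c t e) (if p then v else w) (T + T' + 1) := by
  obtain ⟨k, h1, h2⟩ := hc
  cases p with
  | true =>
    obtain ⟨l, h3, h4⟩ := ht rfl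
    exact ⟨k + l + 1, by simp [Expr.eval, h1, h3], by omega⟩
  | false =>
    obtain ⟨l, h3, h4⟩ := he rfl
    exact ⟨k + l + 1, by simp [Expr.eval, h1, h3], by omega⟩

theorem add {x y : Expr σ τ Ty.Val .nat} {u v : ℕ} {T T' : ℕ} (hx : Runs self x u T)
    (hy : Runs self y v T') : Runs self (.add x y) (u + v : ℕ) (T + T' + 1) := by
  obtain ⟨k, h1, h2⟩ := hx
  obtain ⟨l, h3, h4⟩ := hy
  exact ⟨k + l + 1, by simp [Expr.eval, h1, h3], by omega⟩

theorem eq {x y : Expr σ τ Ty.Val .nat} {u v : ℕ} {T T' : ℕ} (hx : Runs self x u T)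
    (hy : Runs self y v T') : Runs self (.eq x y) (decide (u = v)) (T + T' + 1) := by
  obtain ⟨k, h1, h2⟩ := hx
  obtain ⟨l, h3, h4⟩ := hy
  exact ⟨k + l + 1, by simp [Expr.eval, h1, h3], by omega⟩

theorem le {x y : Expr σ τ Ty.Val .nat} {u v : ℕ} {T T' : ℕ} (hx : Runs self x u T)
    (hy : Runs self y v T') : Runs self (.le x y) (decide (u ≤ v)) (T + T' + 1) := by
  obtain ⟨k, h1, h2⟩ := hx
  obtain ⟨l, h3, h4⟩ := hy
  exact ⟨k + l + 1, by simp [Expr.eval, h1, h3], by omega⟩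

theorem pair {x : Expr σ τ Ty.Val a} {y : Expr σ τ Ty.Val b} {u : a.Val} {v : b.Val} {T T' : ℕ}
    (hx : Runs self x u T) (hy : Runs self y v T') :
    Runs self (.pair x y) (u, v) (T + T' + 1) := by
  obtain ⟨k, h1, h2⟩ := hx
  obtain ⟨l, h3, h4⟩ := hy
  exact ⟨k + l + 1, by simp [Expr.eval, h1, h3], by omega⟩

theorem fst {x : Expr σ τ Ty.Val (.prod a b)} {u : a.Val × b.Val} {T : ℕ}
    (hx : Runs self x u T) : Runs self (.fst x) u.1 (T + 1) := by
  obtain ⟨k, h1, h2⟩ := hx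
  exact ⟨k + 1, by simp [Expr.eval, h1], by omega⟩

theorem snd {x : Expr σ τ Ty.Val (.prod a b)} {u : a.Val × b.Val} {T : ℕ}
    (hx : Runs self x u T) : Runs self (.snd x) u.2 (T + 1) := by
  obtain ⟨k, h1, h2⟩ := hx
  exact ⟨k + 1, by simp [Expr.eval, h1], by omega⟩

theorem cons {x : Expr σ τ Ty.Val a} {y : Expr σ τ Ty.Val (.list a)} {u : a.Val} {v : List a.Val}
    {T T' : ℕ} (hx : Runs self x u T) (hy : Runs self y v T') :
    Runs self (.cons x y) (u :: v) (T + T' + 1) := by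
  obtain ⟨k, h1, h2⟩ := hx
  obtain ⟨l, h3, h4⟩ := hy
  exact ⟨k + l + 1, by simp [Expr.eval, h1, h3], by omega⟩

theorem some {x : Expr σ τ Ty.Val a} {u : a.Val} {T : ℕ}
    (hx : Runs self x u T) : Runs self (.some x) (Option.some u) (T + 1) := by
  obtain ⟨k, h1, h2⟩ := hx
  exact ⟨k + 1, by simp [Expr.eval, h1], by omega⟩

theorem optCase {o : Expr σ τ Ty.Val (.opt a)} {e : Expr σ τ Ty.Val b}
    {f : a.Val → Expr σ τ Ty.Val b} {u : Option a.Val} {v : b.Val} {g : a.Val → b.Val} {T T' : ℕ}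
    (ho : Runs self o u T) (he : u = Option.none → Runs self e v T')
    (hf : ∀ x, u = Option.some x → Runs self (f x) (g x) T') :
    Runs self (.optCase o e f) (u.elim v g) (T + T' + 1) := by
  obtain ⟨k, h1, h2⟩ := ho
  cases u with
  | none =>
    obtain ⟨l, h3, h4⟩ := he rfl
    exact ⟨k + l + 1, by simp [Expr.eval, h1, h3], by omega⟩
  | some x =>
    obtain ⟨l, h3, h4⟩ := hf x rfl
    exact ⟨k + l + 1, by simp [Expr.eval, h1, h3], by omega⟩

theorem letE {x : Expr σ τ Ty.Val a} {f : a.Val → Expr σ τ Ty.Val b} {u : a.Val} {v : b.Val}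
    {T T' : ℕ} (hx : Runs self x u T) (hf : Runs self (f u) v T') :
    Runs self (.letE x f) v (T + T' + 1) := by
  obtain ⟨k, h1, h2⟩ := hx
  obtain ⟨l, h3, h4⟩ := hf
  exact ⟨k + l + 1, by simp [Expr.eval, h1, h3], by omega⟩

theorem call {x : Expr σ τ Ty.Val σ} {u : σ.Val} {v : τ.Val} {T T' : ℕ}
    (hx : Runs self x u T) (hf : ∃ t, self u = Option.some (v, t) ∧ t ≤ T') :
    Runs self (.call x) v (T + T' + 1) := by
  obtain ⟨k, h1, h2⟩ := hx
  obtain ⟨l, h3, h4⟩ := hf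
  exact ⟨k + l + 1, by simp [Expr.eval, h1, h3], by omega⟩

/-- A loop whose body takes at most `c` steps in every iteration that occurs. -/
theorem foldr_suffix {f : a.Val → b.Val → Expr σ τ Ty.Val b} {e : Expr σ τ Ty.Val b}
    {l : Expr σ τ Ty.Val (.list a)} {v : List a.Val} {z : b.Val} {g : a.Val → b.Val → b.Val}
    {T T' : ℕ} (c : ℕ) (hl : Runs self l v T) (he : Runs self e z T')
    (hf : ∀ x w, (x :: w) <:+ v → Runs self (f x (w.foldr g z)) (g x (w.foldr g z)) c) :
    Runs self (.foldr f e l) (v.foldr g z) (T + T' + 1 + v.length * (c + 1)) := by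
  obtain ⟨k, h1, h2⟩ := hl
  obtain ⟨j, h3, h4⟩ := he
  suffices H : ∀ w, w <:+ v → ∃ t, w.foldr (fun x acc => do
      let (y, s) ← acc
      let (y', t) ← (f x y).eval self
      return (y', s + t + 1)) (Option.some (z, k + j + 1)) = Option.some (w.foldr g z, t) ∧
      t ≤ k + j + 1 + w.length * (c + 1) by
    obtain ⟨t, h5, h6⟩ := H v (List.suffix_refl v)
    refine ⟨t, ?_, by omega⟩
    simp only [Expr.eval, h1, h3]
    exact h5
  intro w
  induction w with
  | nil => intro _; exact ⟨_, rfl, by simp⟩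
  | cons x w ih =>
    intro hw
    obtain ⟨t, h5, h6⟩ := ih ((List.suffix_cons x w).trans hw)
    obtain ⟨s, h7, h8⟩ := hf x w hw
    refine ⟨t + s + 1, ?_, ?_⟩
    · rw [List.foldr_cons, h5]
      simp [h7]
    · simp only [List.length_cons, Nat.add_mul]
      omega

theorem foldr {f : a.Val → b.Val → Expr σ τ Ty.Val b} {e : Expr σ τ Ty.Val b}
    {l : Expr σ τ Ty.Val (.list a)} {v : List a.Val} {z : b.Val} {g : a.Val → b.Val → b.Val}
    {T T' : ℕ} {c : ℕ} (hl : Runs self l v T) (he : Runs self e z T')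
    (hf : ∀ x ∈ v, ∀ y, Runs self (f x y) (g x y) c) :
    Runs self (.foldr f e l) (v.foldr g z) (T + T' + 1 + v.length * (c + 1)) :=
  foldr_suffix c hl he fun x w hw => hf x (hw.subset (by simp)) _

end Runs

/-! ### Running times of the basic list routines -/

namespace Code

variable {a b : Ty} {self : Ty.Val .input → Option (Ty.Val .output × ℕ)}

theorem runs_neg {x : Code Ty.Val .bool} {p : Bool} {T : ℕ} (hx : Runs self x p T) :
    Runs self (neg x) (!p) (T + 2) :=
  (Runs.ite hx (fun _ => Runs.ff) (fun _ => Runs.tt)).congr (by cases p <;> rfl) (by omega)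

theorem runs_and {x y : Code Ty.Val .bool} {p q : Bool} {T T' : ℕ} (hx : Runs self x p T)
    (hy : Runs self y q T') : Runs self (and x y) (p && q) (T + T' + 2) :=
  (Runs.ite (T' := T' + 1) hx (fun _ => hy.mono (by omega)) (fun _ => Runs.ff.mono (by omega))).congr
    (by cases p <;> rfl) (by omega)

theorem runs_or {x y : Code Ty.Val .bool} {p q : Bool} {T T' : ℕ} (hx : Runs self x p T)
    (hy : Runs self y q T') : Runs self (or x y) (p || q) (T + T' + 2) :=
  (Runs.ite (T' := T' + 1) hx (fun _ => Runs.tt.mono (by omega)) (fun _ => hy.mono (by omega))).congr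
    (by cases p <;> rfl) (by omega)

theorem runs_any {p : a.Val → Code Ty.Val .bool} {l : Code Ty.Val (.list a)} {v : List a.Val}
    {q : a.Val → Bool} {T c : ℕ} (hl : Runs self l v T) (hp : ∀ x ∈ v, Runs self (p x) (q x) c) :
    Runs self (any p l) (v.any q) (T + 2 + v.length * (c + 4)) := by
  refine (Runs.foldr (g := fun x r => (q x || r)) (c := c + 3) hl Runs.ff
    fun x hx y => (runs_or (hp x hx) (Runs.var y)).mono (by omega)).congr ?_ (by ring_nf; rfl)
  clear hl hp
  induction v with
  | nil => rfl
  | cons x v ih => rw [List.foldr_cons, ih, List.any_cons]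

theorem runs_isEmpty {l : Code Ty.Val (.list a)} {v : List a.Val} {T : ℕ} (hl : Runs self l v T) :
    Runs self (isEmpty l) v.isEmpty (T + 2 + v.length * 2) := by
  refine (Runs.foldr (g := fun _ _ => false) (c := 1) hl Runs.tt fun _ _ _ => Runs.ff).congr ?_
    (by omega)
  cases v <;> rfl

theorem runs_filter {p : a.Val → Code Ty.Val .bool} {l : Code Ty.Val (.list a)} {v : List a.Val}
    {q : a.Val → Bool} {T c : ℕ} (hl : Runs self l v T) (hp : ∀ x ∈ v, Runs self (p x) (q x) c) :
    Runs self (filter p l) (v.filter q) (T + 2 + v.length * (c + 5)) := by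
  refine (Runs.foldr (g := fun x r => if q x then x :: r else r) (c := c + 4) hl Runs.nil
    fun x hx y => (Runs.ite (T' := 3) (hp x hx) (fun _ => Runs.cons (Runs.var x) (Runs.var y))
      (fun _ => (Runs.var y).mono (by omega))).mono (by omega)).congr ?_ (by ring_nf; rfl)
  clear hl hp
  induction v with
  | nil => rfl
  | cons x v ih => rw [List.foldr_cons, ih, List.filter_cons]

theorem runs_length {l : Code Ty.Val (.list a)} {v : List a.Val} {T : ℕ} (hl : Runs self l v T) :
    Runs self (length l) v.length (T + 2 + v.length * 4) := by
  refine (Runs.foldr (g := fun _ r => (1 + r : ℕ)) (c := 3) hl (Runs.lit 0) fun _ _ y =>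
    Runs.add (Runs.lit 1) (Runs.var y)).congr ?_ (by omega)
  clear hl
  induction v with
  | nil => rfl
  | cons x v ih => rw [List.foldr_cons, ih, List.length_cons, add_comm]

theorem runs_append {l l' : Code Ty.Val (.list a)} {v w : List a.Val} {T T' : ℕ}
    (hl : Runs self l v T) (hl' : Runs self l' w T') :
    Runs self (append l l') (v ++ w) (T + T' + 1 + v.length * 4) := by
  refine (Runs.foldr (g := fun x r => x :: r) (c := 3) hl hl' fun x _ y =>
    Runs.cons (Runs.var x) (Runs.var y)).congr ?_ (by omega)
  simp

theorem runs_mem {x : Code Ty.Val .nat} {l : Code Ty.Val (.list .nat)} {u : ℕ} {v : List ℕ}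
    {T T' : ℕ} (hx : Runs self x u T) (hl : Runs self l v T') :
    Runs self (mem x l) (decide (u ∈ v)) (T' + 2 + v.length * (T + 6)) := by
  refine (runs_any hl fun y _ => Runs.eq hx (Runs.var y)).congr ?_ (by ring_nf; omega)
  rw [Bool.eq_iff_iff]
  simp

theorem runs_memPair {x y : Code Ty.Val .nat} {l : Code Ty.Val .pairs} {u w : ℕ}
    {v : List (ℕ × ℕ)} {T : ℕ} (hx : Runs self x u T) (hy : Runs self y w T)
    (hl : Runs self l v 1) :
    Runs self (memPair x y l) (decide ((u, w) ∈ v)) (3 + v.length * (2 * T + 12)) := by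
  refine (runs_any (T := 1) (c := 2 * T + 8) (q := fun p : ℕ × ℕ => decide (p.1 = u) && decide (p.2 = w))
    hl fun p _ => (runs_and
    (Runs.eq (Runs.fst (Runs.var p)) hx) (Runs.eq (Runs.snd (Runs.var p)) hy)).mono (by omega)).congr
    ?_ (by ring_nf; rfl)
  rw [Bool.eq_iff_iff]
  simp only [List.any_eq_true, Bool.and_eq_true, decide_eq_true_eq, Prod.exists]
  constructor
  · rintro ⟨_, _, h, rfl, rfl⟩; exact h
  · exact fun h => ⟨u, w, h, rfl, rfl⟩

end Code

/-! ### The brute-force lists -/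

/-- The list of subsets that the algorithm builds. -/
def subsetsOf {α : Type*} (l : List α) : List (List α) :=
  l.foldr (fun x acc => acc.foldr (fun s r => s :: (x :: s) :: r) []) [[]]

theorem subsetsOf_cons {α : Type*} (x : α) (l : List α) :
    subsetsOf (x :: l) = (subsetsOf l).flatMap fun s => [s, x :: s] := by
  rw [subsetsOf, List.foldr_cons, ← subsetsOf]
  induction subsetsOf l with
  | nil => rfl
  | cons s r ih => rw [List.foldr_cons, ih, List.flatMap_cons]; rfl

theorem length_subsetsOf {α : Type*} (l : List α) : (subsetsOf l).length = 2 ^ l.length := by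
  induction l with
  | nil => rfl
  | cons x l ih => simp [subsetsOf_cons, List.length_flatMap, ih, pow_succ]

/-- Subsets appear as sublists in the order of `l`. This is why the guesses that match a given
allocation are always written as filters of the ground list. -/
theorem mem_subsetsOf {α : Type*} {s l : List α} : s ∈ subsetsOf l ↔ s.Sublist l := by
  induction l generalizing s with
  | nil => simp [subsetsOf]
  | cons x l ih =>
    simp only [subsetsOf_cons, List.mem_flatMap, ih, List.mem_cons, List.not_mem_nil, or_false,
      List.sublist_cons_iff]
    constructor
    · rintro ⟨t, ht, rfl | rfl⟩
      · exact Or.inl ht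
      · exact Or.inr ⟨t, rfl, ht⟩
    · rintro (h | ⟨t, rfl, ht⟩)
      · exact ⟨s, h, Or.inl rfl⟩
      · exact ⟨t, ht, Or.inr rfl⟩

/-- The list of ordered partitions into three sets that the algorithm builds. -/
def partitionsOf {α : Type*} (l : List α) : List (List α × List α × List α) :=
  l.foldr (fun x acc => acc.foldr (fun s r =>
    (x :: s.1, s.2.1, s.2.2) :: (s.1, x :: s.2.1, s.2.2) :: (s.1, s.2.1, x :: s.2.2) :: r) [])
    [([], [], [])]

theorem partitionsOf_cons {α : Type*} (x : α) (l : List α) :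
    partitionsOf (x :: l) = (partitionsOf l).flatMap fun s =>
      [(x :: s.1, s.2.1, s.2.2), (s.1, x :: s.2.1, s.2.2), (s.1, s.2.1, x :: s.2.2)] := by
  rw [partitionsOf, List.foldr_cons, ← partitionsOf]
  induction partitionsOf l with
  | nil => rfl
  | cons s r ih => rw [List.foldr_cons, ih, List.flatMap_cons]; rfl

theorem length_partitionsOf {α : Type*} (l : List α) :
    (partitionsOf l).length = 3 ^ l.length := by
  induction l with
  | nil => rfl
  | cons x l ih => simp [partitionsOf_cons, List.length_flatMap, ih, pow_succ]

theorem perm_of_mem_partitionsOf {α : Type*} {l : List α} {s : List α × List α × List α}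
    (h : s ∈ partitionsOf l) : (s.1 ++ (s.2.1 ++ s.2.2)).Perm l := by
  induction l generalizing s with
  | nil => simp only [partitionsOf, List.foldr_nil, List.mem_singleton] at h; subst h; rfl
  | cons x l ih =>
    simp only [partitionsOf_cons, List.mem_flatMap, List.mem_cons, List.not_mem_nil,
      or_false] at h
    obtain ⟨t, ht, rfl | rfl | rfl⟩ := h
    · exact (ih ht).cons x
    · exact List.perm_middle.trans ((ih ht).cons x)
    · rw [← List.append_assoc]
      refine List.perm_middle.trans (List.Perm.cons x ?_)
      rw [List.append_assoc]
      exact ih ht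

/-- Completeness of the enumeration. It is phrased with colourings because separators are supplied
in this form by `HasSeparators`. -/
theorem filter_mem_partitionsOf {α : Type*} (c : α → Fin 3) (l : List α) :
    (l.filter (c · = 0), l.filter (c · = 1), l.filter (c · = 2)) ∈ partitionsOf l := by
  induction l with
  | nil => simp [partitionsOf]
  | cons x l ih =>
    rw [partitionsOf_cons, List.mem_flatMap]
    refine ⟨_, ih, ?_⟩
    rcases h : c x with ⟨i, hi⟩
    interval_cases i <;> simp [h]

/-- The triple `s = (S, A₁, A₂)` is a balanced separation of the graph with vertices `A` and edges
`E`. -/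
abbrev Balanced (A : List ℕ) (E : List (ℕ × ℕ)) (s : List ℕ × List ℕ × List ℕ) : Prop :=
  3 * s.2.1.length ≤ 2 * A.length ∧ 3 * s.2.2.length ≤ 2 * A.length ∧
    ∀ u ∈ s.2.1, ∀ v ∈ s.2.2, (u, v) ∉ E

/-- One step of the search for a best balanced separation. -/
def betterSeparation (A : List ℕ) (E : List (ℕ × ℕ)) (s : List ℕ × List ℕ × List ℕ)
    (best : Option (List ℕ × List ℕ × List ℕ)) : Option (List ℕ × List ℕ × List ℕ) :=
  if Balanced A E s then
    best.elim (some s) fun t => if s.1.length ≤ t.1.length then some s else best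
  else best

theorem foldr_betterSeparation (A : List ℕ) (E : List (ℕ × ℕ))
    (l : List (List ℕ × List ℕ × List ℕ)) (h : ∃ s ∈ l, Balanced A E s) :
    ∃ t ∈ l, l.foldr (betterSeparation A E) none = some t ∧ Balanced A E t ∧
      ∀ s ∈ l, Balanced A E s → t.1.length ≤ s.1.length := by
  induction l with
  | nil => simp at h
  | cons x l ih =>
    rw [List.foldr_cons]
    by_cases hl : ∃ s ∈ l, Balanced A E s
    · obtain ⟨t, h1, h2, h3, h4⟩ := ih hl
      rw [h2]
      by_cases hx : Balanced A E x
      · by_cases hle : x.1.length ≤ t.1.length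
        · refine ⟨x, by simp, by rw [betterSeparation, if_pos hx]; simp [hle], hx, ?_⟩
          intro s hs hb
          rcases List.mem_cons.1 hs with rfl | hs
          · exact le_rfl
          · exact hle.trans (h4 s hs hb)
        · refine ⟨t, by simp [h1], by rw [betterSeparation, if_pos hx]; simp [hle], h3, ?_⟩
          intro s hs hb
          rcases List.mem_cons.1 hs with rfl | hs
          · omega
          · exact h4 s hs hb
      · refine ⟨t, by simp [h1], by rw [betterSeparation, if_neg hx], h3, ?_⟩
        intro s hs hb
        rcases List.mem_cons.1 hs with rfl | hs
        · exact absurd hb hx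
        · exact h4 s hs hb
    -- Without a balanced triple in the tail the search has found nothing so far, and the head must
    -- be the first hit.
    · have hn : l.foldr (betterSeparation A E) none = none := by
        clear ih h
        induction l with
        | nil => rfl
        | cons y l ih =>
          rw [List.foldr_cons, ih fun ⟨s, hs, hb⟩ => hl ⟨s, by simp [hs], hb⟩, betterSeparation,
            if_neg fun hb => hl ⟨y, by simp, hb⟩]
      obtain ⟨s, hs, hb⟩ := h
      rcases List.mem_cons.1 hs with rfl | hs
      · refine ⟨s, by simp, by rw [hn, betterSeparation, if_pos hb]; rfl, hb, ?_⟩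
        intro s' hs' hb'
        rcases List.mem_cons.1 hs' with rfl | hs'
        · exact le_rfl
        · exact absurd ⟨s', hs', hb'⟩ hl
      · exact absurd ⟨s, hs, hb⟩ hl

/-- The list of injective choices of feasible houses that the algorithm builds. -/
def choicesOf (S : List ℕ) (F : List (ℕ × ℕ)) : List (List (ℕ × ℕ)) :=
  S.foldr (fun x acc => acc.foldr (fun φ r => F.foldr (fun p r' =>
    if (decide (p.1 = x) && !(φ.any fun q => decide (q.2 = p.2))) then (p :: φ) :: r' else r') r)
    []) [[]]

theorem choicesOf_cons (x : ℕ) (S : List ℕ) (F : List (ℕ × ℕ)) :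
    choicesOf (x :: S) F = (choicesOf S F).flatMap fun φ =>
      (F.filter fun p => decide (p.1 = x) && !(φ.any fun q => decide (q.2 = p.2))).map (· :: φ) := by
  rw [choicesOf, List.foldr_cons, ← choicesOf]
  induction choicesOf S F with
  | nil => rfl
  | cons φ r ih =>
    rw [List.foldr_cons, ih, List.flatMap_cons]
    generalize List.flatMap _ r = r'
    clear ih
    induction F with
    | nil => rfl
    | cons p F ihF =>
      rw [List.foldr_cons, ihF, List.filter_cons]
      split <;> rfl

/-- Replaces a list of pairs by a function, which is easier to reason about; its values outside `S`
carry no meaning. As `S` has no repetitions, updating at the new agent leaves the earlier values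
alone. -/
theorem exists_of_mem_choicesOf {S : List ℕ} {F φ : List (ℕ × ℕ)} (hS : S.Nodup)
    (h : φ ∈ choicesOf S F) : ∃ g : ℕ → ℕ, φ = S.map (fun a => (a, g a)) ∧
      (∀ a ∈ S, (a, g a) ∈ F) ∧ ∀ a ∈ S, ∀ b ∈ S, g a = g b → a = b := by
  induction S generalizing φ with
  | nil =>
    refine ⟨id, ?_, by simp, by simp⟩
    simpa [choicesOf] using h
  | cons x S ih =>
    simp only [choicesOf_cons, List.mem_flatMap, List.mem_map, List.mem_filter, Bool.and_eq_true,
      decide_eq_true_eq, Bool.not_eq_true', List.any_eq_false] at h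
    obtain ⟨φ', hφ', p, ⟨hpF, hpx, hp⟩, rfl⟩ := h
    obtain ⟨hx, hS⟩ := List.nodup_cons.1 hS
    obtain ⟨g, rfl, h1, h2⟩ := ih hS hφ'
    have hg : ∀ a ∈ S, Function.update g x p.2 a = g a := fun a ha =>
      Function.update_of_ne (by rintro rfl; exact hx ha) _ _
    have hne : ∀ a ∈ S, g a ≠ p.2 := fun a ha =>
      hp (a, g a) (List.mem_map.2 ⟨a, ha, rfl⟩)
    refine ⟨Function.update g x p.2, ?_, ?_, ?_⟩
    · rw [List.map_cons, Function.update_self]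
      congr 1
      · rw [← hpx]
      · exact List.map_congr_left fun a ha => by rw [hg a ha]
    · intro a ha
      rcases List.mem_cons.1 ha with rfl | ha
      · rw [Function.update_self, ← hpx]; exact hpF
      · rw [hg a ha]; exact h1 a ha
    · intro a ha b hb hab
      rcases List.mem_cons.1 ha with rfl | ha <;> rcases List.mem_cons.1 hb with rfl | hb
      · rfl
      · rw [Function.update_self, hg b hb] at hab
        exact absurd hab.symm (hne b hb)
      · rw [Function.update_self, hg a ‹_›] at hab
        exact absurd hab (hne a ‹_›)
      · rw [hg a ‹_›, hg b hb] at hab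
        exact h2 a ‹_› b hb hab

theorem map_mem_choicesOf {S : List ℕ} {F : List (ℕ × ℕ)} (hS : S.Nodup) {g : ℕ → ℕ}
    (h1 : ∀ a ∈ S, (a, g a) ∈ F) (h2 : ∀ a ∈ S, ∀ b ∈ S, g a = g b → a = b) :
    S.map (fun a => (a, g a)) ∈ choicesOf S F := by
  induction S with
  | nil => simp [choicesOf]
  | cons x S ih =>
    obtain ⟨hx, hS⟩ := List.nodup_cons.1 hS
    rw [choicesOf_cons, List.mem_flatMap]
    refine ⟨_, ih hS (fun a ha => h1 a (by simp [ha]))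
      (fun a ha b hb => h2 a (by simp [ha]) b (by simp [hb])), ?_⟩
    rw [List.mem_map]
    refine ⟨(x, g x), ?_, rfl⟩
    simp only [List.mem_filter, Bool.and_eq_true, decide_eq_true_eq, Bool.not_eq_true',
      List.any_eq_false, List.mem_map, true_and]
    refine ⟨h1 x (by simp), ?_⟩
    rintro _ ⟨a, ha, rfl⟩ hax
    exact hx (h2 a (by simp [ha]) x (by simp) hax ▸ ha)

/-- Pairs with the same first component are told apart by their second one, which lies in `H`. This
gives each agent at most `|H|` choices, whence `|H| ^ |S|` in `length_choicesOf_le`. -/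
theorem length_filter_le_of_nodup {F : List (ℕ × ℕ)} {H : List ℕ} (hF : F.Nodup)
    (hH : ∀ p ∈ F, p.2 ∈ H) (x : ℕ) {q : ℕ × ℕ → Bool} (hq : ∀ p, q p = true → p.1 = x) :
    (F.filter q).length ≤ H.length := by
  have h1 : ((F.filter q).map Prod.snd).Nodup := by
    refine List.Nodup.map_on ?_ (hF.filter q)
    intro p hp p' hp' h
    exact Prod.ext ((hq p (List.mem_filter.1 hp).2).trans (hq p' (List.mem_filter.1 hp').2).symm) h
  rw [← List.length_map Prod.snd, ← List.toFinset_card_of_nodup h1]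
  refine le_trans (Finset.card_le_card ?_) (List.toFinset_card_le H)
  intro h hh
  simp only [List.mem_toFinset, List.mem_map] at hh ⊢
  obtain ⟨p, hp, rfl⟩ := hh
  exact hH p (List.mem_filter.1 hp).1

theorem length_choicesOf_le {S H : List ℕ} {F : List (ℕ × ℕ)} (hF : F.Nodup)
    (hH : ∀ p ∈ F, p.2 ∈ H) : (choicesOf S F).length ≤ H.length ^ S.length := by
  induction S with
  | nil => simp [choicesOf]
  | cons x S ih =>
    rw [choicesOf_cons, List.length_flatMap, List.length_cons, pow_succ]
    refine le_trans (List.sum_le_card_nsmul _ H.length ?_) ?_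
    · simp only [List.mem_map]
      rintro _ ⟨φ, -, rfl⟩
      rw [List.length_map]
      exact length_filter_le_of_nodup hF hH x (by simp +contextual)
    · rw [List.length_map, smul_eq_mul]
      exact Nat.mul_le_mul_right _ ih

theorem length_of_mem_choicesOf {S : List ℕ} {F φ : List (ℕ × ℕ)} (h : φ ∈ choicesOf S F) :
    φ.length = S.length := by
  induction S generalizing φ with
  | nil => simp [choicesOf] at h; simp [h]
  | cons x S ih =>
    simp only [choicesOf_cons, List.mem_flatMap, List.mem_map] at h
    obtain ⟨φ', hφ', p, -, rfl⟩ := h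
    simp [ih hφ']

/-- The pairs in `l` with components in `X` and `Y`. -/
def pairsWithin (l : List (ℕ × ℕ)) (X Y : List ℕ) : List (ℕ × ℕ) :=
  l.filter fun p => decide (p.1 ∈ X) && decide (p.2 ∈ Y)

theorem mem_pairsWithin {l : List (ℕ × ℕ)} {X Y : List ℕ} {p : ℕ × ℕ} :
    p ∈ pairsWithin l X Y ↔ p ∈ l ∧ p.1 ∈ X ∧ p.2 ∈ Y := by
  simp [pairsWithin]

/-- The input induced by the agents `A` and the houses `H`. -/
def restrictInput (A H : List ℕ) (E P F : List (ℕ × ℕ)) (B : List ℕ) : Ty.input.Val :=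
  (A, H, pairsWithin E A A, pairsWithin P A H, pairsWithin F A H, A.filter fun x => decide (x ∈ B))

/-- The output `r` is admissible in the sense of `sound`, and at most every number in `costs`. -/
def Answers (sound : ℕ × List (ℕ × ℕ) → Prop) (costs : ℕ → Prop)
    (r : Option (ℕ × List (ℕ × ℕ))) : Prop :=
  (∀ u, r = some u → sound u) ∧ ∀ w, costs w → ∃ u, r = some u ∧ u.1 ≤ w

/-- The better of two outputs. -/
def betterOutput (x y : Option (ℕ × List (ℕ × ℕ))) : Option (ℕ × List (ℕ × ℕ)) :=
  x.elim y fun u => y.elim x fun v => if u.1 ≤ v.1 then x else y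

/-- The better output inherits soundness from whichever output it equals, and it is at most both
values, so it undercuts the costs in either set. -/
theorem Answers.better {sound : ℕ × List (ℕ × ℕ) → Prop} {D D' : ℕ → Prop}
    {x y : Option (ℕ × List (ℕ × ℕ))} (hx : Answers sound D x) (hy : Answers sound D' y) :
    Answers sound (fun w => D w ∨ D' w) (betterOutput x y) := by
  rcases x with _ | u
  · refine ⟨hy.1, fun w hw => ?_⟩
    rcases hw with hw | hw
    · obtain ⟨u, hu, -⟩ := hx.2 w hw
      cases hu
    · exact hy.2 w hw
  · rcases y with _ | v
    · refine ⟨hx.1, fun w hw => ?_⟩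
      rcases hw with hw | hw
      · exact hx.2 w hw
      · obtain ⟨u, hu, -⟩ := hy.2 w hw
        cases hu
    · have hb : betterOutput (some u) (some v) = if u.1 ≤ v.1 then some u else some v := rfl
      rw [hb]
      refine ⟨fun t ht => ?_, fun w hw => ?_⟩
      · split at ht
        · exact hx.1 t ht
        · exact hy.1 t ht
      · have h : u.1 ≤ w ∨ v.1 ≤ w := by
          rcases hw with hw | hw
          · obtain ⟨t, ht, h⟩ := hx.2 w hw
            cases ht; exact Or.inl h
          · obtain ⟨t, ht, h⟩ := hy.2 w hw
            cases ht; exact Or.inr h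
        split
        · exact ⟨u, rfl, by omega⟩
        · exact ⟨v, rfl, by omega⟩

/-! ### Running times of the brute-force enumerations -/

namespace Code

variable {a b : Ty} {self : Ty.Val .input → Option (Ty.Val .output × ℕ)}

/-- The accumulator doubles in each iteration. Every pass over it is charged at its final length `2
^ |v|`, which requires the loop rule for suffixes. -/
theorem runs_subsets {l : Code Ty.Val (.list a)} {v : List a.Val} {T : ℕ} (hl : Runs self l v T) :
    Runs self (subsets l) (subsetsOf v) (T + 4 + 12 * v.length * 2 ^ v.length) := by
  refine (Runs.foldr_suffix (g := fun (x : a.Val) (acc : List (List a.Val)) =>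
      acc.foldr (fun s r => s :: (x :: s) :: r) []) (3 + 2 ^ v.length * 8) hl
      (Runs.cons Runs.nil Runs.nil) ?_).congr rfl ?_
  · intro x w hw
    refine (Runs.foldr (c := 7) (g := fun (s : List a.Val) r => s :: (x :: s) :: r)
      (Runs.var _) Runs.nil fun s _ r => ?_).congr rfl ?_
    · exact Runs.cons (Runs.var s) (Runs.cons (Runs.cons (Runs.var x) (Runs.var s)) (Runs.var r))
    · have h1 := length_subsetsOf w
      rw [subsetsOf] at h1
      rw [h1]
      have h2 : 2 ^ w.length ≤ 2 ^ v.length :=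
        Nat.pow_le_pow_right (by norm_num) ((List.suffix_cons x w).trans hw).length_le
      omega
  · have h : 1 ≤ 2 ^ v.length := Nat.one_le_two_pow
    nlinarith

theorem runs_partitions {l : Code Ty.Val (.list a)} {v : List a.Val} {T : ℕ}
    (hl : Runs self l v T) :
    Runs self (partitions l) (partitionsOf v) (T + 8 + 41 * v.length * 3 ^ v.length) := by
  refine (Runs.foldr_suffix (g := fun (x : a.Val) (acc : List (List a.Val × List a.Val × List a.Val)) =>
      acc.foldr (fun s r =>
    (x :: s.1, s.2.1, s.2.2) :: (s.1, x :: s.2.1, s.2.2) :: (s.1, s.2.1, x :: s.2.2) :: r) [])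
      (3 + 3 ^ v.length * 37) hl
      (Runs.cons (Runs.pair Runs.nil (Runs.pair Runs.nil Runs.nil)) Runs.nil) ?_).congr rfl ?_
  · intro x w hw
    refine (Runs.foldr (c := 36) (g := fun (s : List a.Val × List a.Val × List a.Val) r =>
      (x :: s.1, s.2.1, s.2.2) :: (s.1, x :: s.2.1, s.2.2) :: (s.1, s.2.1, x :: s.2.2) :: r)
      (Runs.var _) Runs.nil fun s _ r => ?_).congr rfl ?_
    · refine (Runs.letE (Runs.fst (Runs.var s)) (Runs.letE (Runs.fst (Runs.snd (Runs.var s)))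
        (Runs.letE (Runs.snd (Runs.snd (Runs.var s)))
        (Runs.cons (Runs.pair (Runs.cons (Runs.var x) (Runs.var _))
            (Runs.pair (Runs.var _) (Runs.var _)))
          (Runs.cons (Runs.pair (Runs.var _) (Runs.pair (Runs.cons (Runs.var x) (Runs.var _))
            (Runs.var _)))
          (Runs.cons (Runs.pair (Runs.var _) (Runs.pair (Runs.var _)
            (Runs.cons (Runs.var x) (Runs.var _)))) (Runs.var r))))))).congr rfl ?_
      norm_num
    · have h1 := length_partitionsOf w
      rw [partitionsOf] at h1
      rw [h1]
      have h2 : 3 ^ w.length ≤ 3 ^ v.length :=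
        Nat.pow_le_pow_right (by norm_num) ((List.suffix_cons x w).trans hw).length_le
      omega
  · have h : 1 ≤ 3 ^ v.length := Nat.one_le_pow _ _ (by norm_num)
    nlinarith

theorem runs_isBalanced {A : List ℕ} {E : List (ℕ × ℕ)} {M : ℕ} (hM : 1 ≤ M) (hA : A.length ≤ M)
    (hE : E.length ≤ M) {s : List ℕ × List ℕ × List ℕ} (h1 : s.2.1.length ≤ M)
    (h2 : s.2.2.length ≤ M) :
    Runs self (isBalanced A E s) (decide (Balanced A E s)) (150 * M ^ 3) := by
  refine Runs.congr (Runs.letE (Runs.fst (Runs.snd (Runs.varTriple s))) <|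
    Runs.letE (Runs.snd (Runs.snd (Runs.varTriple s))) <|
    Runs.letE (runs_length (Runs.varNats A)) <|
    Runs.letE (runs_length (Runs.var _)) <|
    Runs.letE (runs_length (Runs.var _)) <|
    runs_and (Runs.le (Runs.add (Runs.var _) (Runs.add (Runs.var _) (Runs.var _)))
      (Runs.add (Runs.var _) (Runs.var _))) <|
    runs_and (Runs.le (Runs.add (Runs.var _) (Runs.add (Runs.var _) (Runs.var _)))
      (Runs.add (Runs.var _) (Runs.var _))) <|
    runs_neg (runs_any (Runs.var _) fun u _ => runs_any (Runs.var _) fun v _ =>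
      runs_memPair (Runs.var u) (Runs.var v) (Runs.varPairs E))) ?_ ?_
  · rw [Bool.eq_iff_iff]
    simp only [Bool.and_eq_true, decide_eq_true_eq, Bool.not_eq_true', List.any_eq_false,
      List.any_eq_true, Balanced]
    refine and_congr (by omega) (and_congr (by omega) ?_)
    simp
  · have e1 : s.2.2.length * (3 + E.length * (2 * 1 + 12) + 4) ≤ M * (3 + M * (2 * 1 + 12) + 4) := by
      gcongr
    have e2 : s.2.1.length * (1 + 2 + s.2.2.length * (3 + E.length * (2 * 1 + 12) + 4) + 4) ≤
      M * (1 + 2 + M * (3 + M * (2 * 1 + 12) + 4) + 4) := by gcongr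
    refine le_trans (b := 100 + 12 * M + M * (1 + 2 + M * (3 + M * (2 * 1 + 12) + 4) + 4)) (by omega) ?_
    -- With `M = N + 1` both sides expand to polynomials in `N` that can be compared coefficient by
    -- coefficient, the powers of `N` being atoms for `omega`.
    obtain ⟨N, rfl⟩ := Nat.exists_eq_add_of_le' hM
    ring_nf
    omega

theorem runs_separation {A : List ℕ} {E : List (ℕ × ℕ)} {M : ℕ} (hM : 1 ≤ M) (hA : A.length ≤ M)
    (hE : E.length ≤ M) :
    Runs self (separation A E) ((partitionsOf A).foldr (betterSeparation A E) none)
      (250 * M ^ 3 * 3 ^ A.length) := by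
  refine Runs.congr (Runs.foldr_suffix (g := betterSeparation A E) (180 * M ^ 3)
    (runs_partitions (Runs.varNats A)) Runs.none ?_) rfl ?_
  · intro s w hw
    have hmem := fun t (ht : t ∈ partitionsOf A) => (perm_of_mem_partitionsOf ht).length_eq
    have hs := hmem s (hw.subset (by simp))
    simp only [List.length_append] at hs
    refine Runs.congr (Runs.ite (T' := 22 * M) (v := (w.foldr (betterSeparation A E) none).elim
      (some s) fun t => if s.1.length ≤ t.1.length then some s
        else w.foldr (betterSeparation A E) none)
      (runs_isBalanced hM hA hE (by omega) (by omega)) (fun hb => ?_)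
      (fun _ => Runs.mono (Runs.var _) (by omega))) ?_ ?_
    · refine Runs.mono (Runs.optCase (T' := 12 + 8 * M) (Runs.var _)
        (fun _ => Runs.mono (Runs.some (Runs.varTriple s)) (by omega)) fun t ht => ?_) (by omega)
      -- The cost of measuring the current best triple can be bounded only because that triple is
      -- one of the enumerated partitions of `A`.
      have htl : t.1.length ≤ M := by
        by_cases hex : ∃ r ∈ w, Balanced A E r
        · obtain ⟨t', ht', h1, -⟩ := foldr_betterSeparation A E w hex
          rw [h1] at ht
          obtain rfl : t' = t := Option.some.inj ht
          have := hmem t' (hw.subset (by simp [ht']))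
          simp only [List.length_append] at this
          omega
        · exfalso
          suffices w.foldr (betterSeparation A E) none = none by rw [this] at ht; cases ht
          clear ht hs hw hb
          induction w with
          | nil => rfl
          | cons y w ih =>
            rw [List.foldr_cons, ih fun ⟨r, hr, hb⟩ => hex ⟨r, by simp [hr], hb⟩,
              betterSeparation, if_neg fun hb => hex ⟨y, by simp, hb⟩]
      refine Runs.congr (Runs.ite (T' := 2) (Runs.le (runs_length (Runs.fst (Runs.varTriple s)))
        (runs_length (Runs.fst (Runs.var t)))) (fun _ => Runs.some (Runs.varTriple s))
        (fun _ => (Runs.var _).mono (by omega))) ?_ (by omega)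
      simp
    · rw [betterSeparation]
      simp
    · obtain ⟨N, rfl⟩ := Nat.exists_eq_add_of_le' hM
      ring_nf
      omega
  · rw [length_partitionsOf]
    have h : 1 ≤ 3 ^ A.length := Nat.one_le_pow _ _ (by norm_num)
    have hM3 : M ≤ M ^ 3 := Nat.le_self_pow (by norm_num) M
    calc _ ≤ 10 * 3 ^ A.length + 1 * 3 ^ A.length + 41 * M ^ 3 * 3 ^ A.length +
        3 ^ A.length * (181 * M ^ 3) := by
          have : A.length * 3 ^ A.length ≤ M ^ 3 * 3 ^ A.length := by gcongr; omega
          have h4 : 3 ^ A.length * (180 * M ^ 3 + 1) ≤ 3 ^ A.length * (181 * M ^ 3) := by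
            gcongr; omega
          nlinarith
      _ = (11 + 222 * M ^ 3) * 3 ^ A.length := by ring
      _ ≤ _ := by gcongr; omega

theorem runs_choices {S H : List ℕ} {F : List (ℕ × ℕ)} {M : ℕ} (hM : 1 ≤ M) (hS : S.length ≤ M)
    (hFM : F.length ≤ M) (hF : F.Nodup) (hH : ∀ p ∈ F, p.2 ∈ H) (hpos : 1 ≤ H.length) :
    Runs self (choices S F) (choicesOf S F) (50 * M ^ 3 * H.length ^ S.length) := by
  refine Runs.congr (Runs.foldr_suffix (g := fun (x : ℕ) (acc : List (List (ℕ × ℕ))) => acc.foldr (fun (φ : List (ℕ × ℕ)) r =>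
    F.foldr (fun p r' =>
    if (decide (p.1 = x) && !(φ.any fun q => decide (q.2 = p.2))) then (p :: φ) :: r' else r') r)
    []) (40 * M ^ 2 * H.length ^ S.length) (Runs.varNats S) (Runs.cons Runs.nil Runs.nil)
    ?_) rfl ?_
  · intro x w hw
    have hw' := (List.suffix_cons x w).trans hw
    refine Runs.congr (Runs.foldr (c := 36 * M ^ 2) (g := fun (φ : List (ℕ × ℕ)) r => F.foldr (fun p r' =>
      if (decide (p.1 = x) && !(φ.any fun q => decide (q.2 = p.2))) then (p :: φ) :: r' else r') r)
      (Runs.var _) Runs.nil fun φ hφ r => ?_) rfl ?_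
    · have hφl : φ.length ≤ M := by
        rw [length_of_mem_choicesOf (S := w) hφ]
        exact hw'.length_le.trans hS
      refine Runs.mono (Runs.foldr (c := 32 * M) (Runs.varPairs F) (Runs.var r) fun p _ r' => ?_) ?_
      · refine Runs.mono (Runs.ite (T' := 5) (runs_and (Runs.eq (Runs.fst (Runs.var p)) (Runs.var x))
          (runs_neg (runs_any (Runs.varPairs φ) fun q _ =>
            Runs.eq (Runs.snd (Runs.var q)) (Runs.snd (Runs.var p)))))
          (fun _ => Runs.cons (Runs.cons (Runs.var p) (Runs.varPairs φ)) (Runs.var r'))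
          (fun _ => (Runs.var r').mono (by omega))) ?_
        omega
      · have : F.length * (32 * M + 1) ≤ M * (32 * M + 1) := by gcongr
        nlinarith
    · have h1 := length_choicesOf_le (S := w) hF hH
      rw [choicesOf] at h1
      -- Partial choices are no more numerous than the bound for complete ones; this is where `H`
      -- has to be nonempty.
      have h2 : H.length ^ w.length ≤ H.length ^ S.length :=
        Nat.pow_le_pow_right hpos hw'.length_le
      have h3 : 1 ≤ H.length ^ S.length := Nat.one_le_pow _ _ hpos
      have h4 : 1 ≤ M ^ 2 := Nat.one_le_pow _ _ hM
      have h5 : 1 ≤ M ^ 2 * H.length ^ S.length := Nat.mul_pos h4 h3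
      refine (Nat.add_le_add_left (Nat.mul_le_mul_right _ (h1.trans h2)) _).trans ?_
      nlinarith
  · have h3 : 1 ≤ H.length ^ S.length := Nat.one_le_pow _ _ hpos
    have h4 : 1 ≤ M ^ 3 := Nat.one_le_pow _ _ hM
    have h5 : 1 ≤ M ^ 3 * H.length ^ S.length := Nat.mul_pos h4 h3
    have h6 : M ≤ M ^ 3 := Nat.le_self_pow (by norm_num) M
    have h7 : S.length * (40 * M ^ 2 * H.length ^ S.length + 1) ≤
      M * (40 * M ^ 2 * H.length ^ S.length + 1) := by gcongr
    have h8 : M * (40 * M ^ 2 * H.length ^ S.length + 1) =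
      40 * (M ^ 3 * H.length ^ S.length) + M := by ring
    have h9 : M ^ 3 ≤ M ^ 3 * H.length ^ S.length := Nat.le_mul_of_pos_right _ h3
    rw [mul_assoc 50]
    omega

theorem runs_better {x y : Option (ℕ × List (ℕ × ℕ))} :
    Runs self (better (V := Ty.Val) x y) (betterOutput x y) 15 := by
  refine Runs.mono (T := 1 + 12 + 1) (Runs.optCase (Runs.varOutput x)
    (fun _ => Runs.mono (Runs.varOutput y) (by omega)) fun u _ => ?_) (by omega)
  refine Runs.mono (T := 1 + 8 + 1) (Runs.optCase (Runs.varOutput y)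
    (fun _ => Runs.mono (Runs.varOutput x) (by omega)) fun v _ => ?_) (by omega)
  refine Runs.congr (Runs.ite (Runs.le (Runs.fst (Runs.var u)) (Runs.fst (Runs.var v)))
    (fun _ => Runs.varOutput x) (fun _ => Runs.varOutput y)) ?_ (by omega)
  simp

/-- Time and correctness of a loop are treated together, because the results of its body are known
only through `Answers`. The loop answers for the union of the sets of costs of its iterations. -/
theorem runs_bestOver {sound : ℕ × List (ℕ × ℕ) → Prop} {l : Code Ty.Val (.list a)}
    {v : List a.Val} {e : a.Val → Code Ty.Val .output} {D : a.Val → ℕ → Prop} {T c : ℕ}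
    (hl : Runs self l v T)
    (h : ∀ x ∈ v, ∃ y, Runs self (e x) y c ∧ Answers sound (D x) y) :
    ∃ r, Runs self (bestOver l e) r (T + 2 + v.length * (c + 17)) ∧
      Answers sound (fun w => ∃ x ∈ v, D x w) r := by
  choose! g hg1 hg2 using h
  refine ⟨v.foldr (fun x best => betterOutput (g x) best) none,
    Runs.congr (Runs.foldr (c := c + 16) (g := fun x best => betterOutput (g x) best) hl Runs.none
      fun x hx best => Runs.letE (hg1 x hx) runs_better) rfl (by ring_nf; rfl), ?_⟩
  clear hl hg1
  induction v with
  | nil => exact ⟨fun u hu => (by cases hu), fun w ⟨x, hx, _⟩ => (by cases hx)⟩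
  | cons x v ih =>
    have := (hg2 x (by simp)).better (ih fun y hy => hg2 y (by simp [hy]))
    refine ⟨this.1, ?_⟩
    rintro w ⟨y, hy, hw⟩
    refine this.2 w ?_
    rcases List.mem_cons.1 hy with rfl | hy
    · exact Or.inl hw
    · exact Or.inr ⟨y, hy, hw⟩

theorem runs_within {l : List (ℕ × ℕ)} {X Y : List ℕ} {M : ℕ} (hM : 1 ≤ M) (hl : l.length ≤ M)
    (hX : X.length ≤ M) (hY : Y.length ≤ M) :
    Runs self (within (V := Ty.Val) l X Y) (pairsWithin l X Y) (40 * M ^ 2) := by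
  refine Runs.congr (runs_filter (c := 24 * M) (Runs.varPairs l) fun p _ => (runs_and
    (runs_mem (Runs.fst (Runs.var p)) (Runs.varNats X))
    (runs_mem (Runs.snd (Runs.var p)) (Runs.varNats Y))).mono (by omega)) rfl ?_
  have : l.length * (24 * M + 5) ≤ M * (24 * M + 5) := by gcongr
  nlinarith

/-- The allowance `2 * M` for `B` is meant for `angered`, which appends newly angry agents to the
old list. -/
theorem runs_restrict {A H B : List ℕ} {E P F : List (ℕ × ℕ)} {M : ℕ} (hM : 1 ≤ M)
    (hA : A.length ≤ M) (hH : H.length ≤ M) (hE : E.length ≤ M) (hP : P.length ≤ M)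
    (hF : F.length ≤ M) (hB : B.length ≤ 2 * M) :
    Runs self (restrict (V := Ty.Val) A H E P F B) (restrictInput A H E P F B) (180 * M ^ 2) := by
  refine Runs.congr (Runs.pair (Runs.varNats A) (Runs.pair (Runs.varNats H) (Runs.pair (runs_within hM hE hA hA)
    (Runs.pair (runs_within hM hP hA hH) (Runs.pair (runs_within hM hF hA hH)
    (runs_filter (c := 17 * M) (Runs.varNats A) fun x _ => (runs_mem (Runs.var x) (Runs.varNats B)).mono
      (by omega))))))) rfl ?_
  have : A.length * (17 * M + 5) ≤ M * (17 * M + 5) := by gcongr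
  nlinarith

theorem runs_likes {P φ : List (ℕ × ℕ)} {x y M : ℕ} (hM : 1 ≤ M) (hP : P.length ≤ M)
    (hφ : φ.length ≤ M) :
    Runs self (likes (V := Ty.Val) P φ x y)
      (φ.any fun p => decide (p.1 = y) && decide ((x, p.2) ∈ P)) (33 * M ^ 2) := by
  refine Runs.mono (runs_any (c := 25 * M) (Runs.varPairs φ) fun p _ => (runs_and
    (Runs.eq (Runs.fst (Runs.var p)) (Runs.var y))
    (runs_memPair (T := 2) ((Runs.var x).mono (by omega)) (Runs.snd (Runs.var p))
      (Runs.varPairs P))).mono (by omega)) ?_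
  have : φ.length * (25 * M + 4) ≤ M * (25 * M + 4) := by gcongr
  nlinarith

end Code

/-! ### The annotated problem on lists -/

/-- Agent `a` is unhappy with the allocation `ψ`. -/
abbrev Unhappy (A : List ℕ) (E P : List (ℕ × ℕ)) (B : List ℕ) (ψ : ℕ → ℕ) (a : ℕ) : Prop :=
  (a, ψ a) ∉ P ∧ (a ∈ B ∨ ∃ b ∈ A, (a, b) ∈ E ∧ (a, ψ b) ∈ P)

/-- The number of unhappy agents. -/
def listCost (A : List ℕ) (E P : List (ℕ × ℕ)) (B : List ℕ) (ψ : ℕ → ℕ) : ℕ :=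
  A.countP fun a => decide (Unhappy A E P B ψ a)

/-- `ψ` is injective on `A` and respects the feasible pairs `F`. -/
structure Admissible (A : List ℕ) (F : List (ℕ × ℕ)) (ψ : ℕ → ℕ) : Prop where
  inj : ∀ a ∈ A, ∀ b ∈ A, ψ a = ψ b → a = b
  feas : ∀ a ∈ A, (a, ψ a) ∈ F

/-- The list `u.2` is the graph of an admissible allocation of cost at most `u.1`. -/
def Witnesses (A : List ℕ) (E P F : List (ℕ × ℕ)) (B : List ℕ) (u : ℕ × List (ℕ × ℕ)) : Prop :=
  ∃ ψ, Admissible A F ψ ∧ listCost A E P B ψ ≤ u.1 ∧ (∀ p, p ∈ u.2 ↔ ∃ a ∈ A, p = (a, ψ a)) ∧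
    u.2.length = A.length

/-- The number `w` is the cost of an admissible allocation. -/
def IsCost (A : List ℕ) (E P F : List (ℕ × ℕ)) (B : List ℕ) (w : ℕ) : Prop :=
  ∃ ψ, Admissible A F ψ ∧ listCost A E P B ψ = w

/-- The output `r` answers the annotated problem. -/
def AnswersProblem (I : Ty.input.Val) (r : Ty.output.Val) : Prop :=
  Answers (Witnesses I.1 I.2.2.1 I.2.2.2.1 I.2.2.2.2.1 I.2.2.2.2.2)
    (IsCost I.1 I.2.2.1 I.2.2.2.1 I.2.2.2.2.1 I.2.2.2.2.2) r

/-- Allocations are total functions on `ℕ`, but only their values on `A` matter. -/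
theorem listCost_congr {A : List ℕ} {E P : List (ℕ × ℕ)} {B : List ℕ} {ψ ψ' : ℕ → ℕ}
    (h : ∀ a ∈ A, ψ a = ψ' a) : listCost A E P B ψ = listCost A E P B ψ' := by
  refine List.countP_congr fun a ha => ?_
  simp only [Unhappy, h a ha, decide_eq_true_eq]
  refine and_congr_right fun _ => or_congr_right ?_
  refine exists_congr fun b => and_congr_right fun hb => ?_
  rw [h b hb]

/-! ### The lists computed by the recursive procedure -/

section Lists

variable (A H : List ℕ) (E P F : List (ℕ × ℕ)) (B S : List ℕ) (g : ℕ → ℕ)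

/-- Agents in `S` with a preferred house. -/
def satisfied : List ℕ := S.filter fun x => decide ((x, g x) ∈ P)

/-- Agent `x` prefers the house of a neighbour in `S`. -/
abbrev Covets (x : ℕ) : Prop := ∃ y ∈ S, (x, y) ∈ E ∧ (x, g y) ∈ P

/-- Agents in `S` who are not angry and envy a neighbour in `S`. -/
def enviousIn : List ℕ :=
  S.filter fun x => decide (x ∉ B ∧ (x, g x) ∉ P ∧ Covets E P S g x)

/-- Angry agents in `S` without a preferred house. -/
def angryIn : List ℕ := S.filter fun x => decide (x ∈ B ∧ (x, g x) ∉ P)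

/-- Agents in `S` who are not angry, have no preferred house and envy nobody in `S`. -/
def undecided : List ℕ :=
  S.filter fun x => decide (x ∉ B ∧ (x, g x) ∉ P ∧ ¬ Covets E P S g x)

/-- The angry agents after the houses of `S` have been fixed. -/
def angered : List ℕ :=
  B ++ A.filter fun y => decide (y ∉ S ∧ ∃ x ∈ S, (x, y) ∈ E ∧ (y, g x) ∈ P)

/-- The houses not given to `S`. -/
def remaining : List ℕ := H.filter fun h => decide (∀ a ∈ S, g a ≠ h)

/-- The feasible pairs that do not make an agent in `K` envious. -/
def pruned (K : List ℕ) : List (ℕ × ℕ) :=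
  F.filter fun p => decide (∀ x ∈ K, ¬ ((x, p.1) ∈ E ∧ (x, p.2) ∈ P))

/-- The houses in `H` not in `X`. -/
def without (X : List ℕ) : List ℕ := H.filter fun h => decide (h ∉ X)

end Lists

/-- A separation `(S, A₁, A₂)` of the graph with vertices `A` and edges `E`. -/
structure Separates (A : List ℕ) (E : List (ℕ × ℕ)) (S A₁ A₂ : List ℕ) : Prop where
  nodup : A.Nodup
  perm : (S ++ (A₁ ++ A₂)).Perm A
  symm : ∀ u v, (u, v) ∈ E → (v, u) ∈ E
  noEdge : ∀ u ∈ A₁, ∀ v ∈ A₂, (u, v) ∉ E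

/-! ### Splitting allocations and costs along a separation -/

namespace Separates

variable {A H : List ℕ} {E P F : List (ℕ × ℕ)} {B S A₁ A₂ : List ℕ} {g ψ : ℕ → ℕ}

theorem swap (h : Separates A E S A₁ A₂) : Separates A E S A₂ A₁ where
  nodup := h.nodup
  perm := (List.Perm.append_left S List.perm_append_comm).trans h.perm
  symm := h.symm
  noEdge := fun u hu v hv huv => h.noEdge v hv u hu (h.symm u v huv)

theorem mem_iff (h : Separates A E S A₁ A₂) (a : ℕ) : a ∈ A ↔ a ∈ S ∨ a ∈ A₁ ∨ a ∈ A₂ := by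
  rw [← h.perm.mem_iff, List.mem_append, List.mem_append]

theorem nodup_append (h : Separates A E S A₁ A₂) : (S ++ (A₁ ++ A₂)).Nodup :=
  h.perm.nodup_iff.2 h.nodup

theorem nodup_S (h : Separates A E S A₁ A₂) : S.Nodup := (List.nodup_append'.1 h.nodup_append).1

theorem nodup_left (h : Separates A E S A₁ A₂) : A₁.Nodup :=
  (List.nodup_append'.1 (List.nodup_append'.1 h.nodup_append).2.1).1

theorem nodup_right (h : Separates A E S A₁ A₂) : A₂.Nodup := h.swap.nodup_left

theorem notMem_S (h : Separates A E S A₁ A₂) {a : ℕ} (ha : a ∈ A₁) : a ∉ S := fun hS =>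
  (List.nodup_append'.1 h.nodup_append).2.2 hS (List.mem_append_left _ ha)

theorem notMem_right (h : Separates A E S A₁ A₂) {a : ℕ} (ha : a ∈ A₁) : a ∉ A₂ := fun h2 =>
  (List.nodup_append'.1 (List.nodup_append'.1 h.nodup_append).2.1).2.2 ha h2

/-- Agents outside `S` are unhappy if and only if they are so in their subinstance. -/
theorem unhappy_iff (h : Separates A E S A₁ A₂) {H₁ : List ℕ} (hg : ∀ a ∈ S, ψ a = g a)
    (hH : ∀ a ∈ A₁, ψ a ∈ H₁) {a : ℕ} (ha : a ∈ A₁) :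
    Unhappy A E P B ψ a ↔ Unhappy A₁ (pairsWithin E A₁ A₁) (pairsWithin P A₁ H₁)
      (A₁.filter fun x => decide (x ∈ angered A E P B S g)) ψ a := by
  have haS := h.notMem_S ha
  have haA : a ∈ A := (h.mem_iff a).2 (Or.inr (Or.inl ha))
  simp only [Unhappy, mem_pairsWithin, angered, List.mem_filter, List.mem_append,
    decide_eq_true_eq, ha, true_and, haA, haS, not_false_eq_true, hH a ha, and_true]
  refine and_congr_right fun _ => ?_
  constructor
  · rintro (hB | ⟨b, hb, hab, hP⟩)
    · exact Or.inl (Or.inl hB)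
    -- An envied neighbour in `S` has made `a` angry, one in `A₁` stays visible in the subinstance,
    -- and one in `A₂` cannot exist.
    · rcases (h.mem_iff b).1 hb with hbS | hb1 | hb2
      · exact Or.inl (Or.inr ⟨b, hbS, h.symm _ _ hab, hg b hbS ▸ hP⟩)
      · exact Or.inr ⟨b, hb1, ⟨hab, hb1⟩, hP, hH b hb1⟩
      · exact absurd hab (h.noEdge a ha b hb2)
  · rintro ((hB | ⟨x, hx, hxa, hP⟩) | ⟨b, hb1, ⟨hab, -⟩, hP, -⟩)
    · exact Or.inl hB
    · exact Or.inr ⟨x, (h.mem_iff x).2 (Or.inl hx), h.symm _ _ hxa, (hg x hx).symm ▸ hP⟩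
    · exact Or.inr ⟨b, (h.mem_iff b).2 (Or.inr (Or.inl hb1)), hab, hP⟩

end Separates

/-- Adding the indicators as numbers encodes that the three properties exclude each other. -/
theorem countP_eq_add_add {l : List ℕ} {p q r s : ℕ → Bool}
    (h : ∀ x ∈ l, (p x).toNat = (q x).toNat + (r x).toNat + (s x).toNat) :
    l.countP p = l.countP q + l.countP r + l.countP s := by
  induction l with
  | nil => rfl
  | cons x l ih =>
    have h1 := h x (by simp)
    have h2 := ih fun y hy => h y (by simp [hy])
    simp only [List.countP_cons, h2]
    revert h1
    cases p x <;> cases q x <;> cases r x <;> cases s x <;> simp <;> omega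

namespace Separates

variable {A H : List ℕ} {E P F : List (ℕ × ℕ)} {B S A₁ A₂ : List ℕ} {g ψ : ℕ → ℕ}

/-- Unhappy agents of `S` fall into three disjoint classes: those whose envy is visible inside `S`,
the angry ones, and the undecided ones, whose fate depends on the houses given outside `S`. -/
theorem countP_unhappy (h : Separates A E S A₁ A₂) (hg : ∀ a ∈ S, ψ a = g a) :
    S.countP (fun a => decide (Unhappy A E P B ψ a)) =
      (enviousIn E P B S g).length + (angryIn P B S g).length +
        ((undecided E P B S g).filter fun x => decide (Covets E P A ψ x)).length := by
  simp only [enviousIn, angryIn, undecided, List.filter_filter, ← List.countP_eq_length_filter]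
  refine countP_eq_add_add fun x hx => ?_
  have h1 : Covets E P S g x → Covets E P A ψ x := fun ⟨y, hy, h1, h2⟩ =>
    ⟨y, (h.mem_iff y).2 (Or.inl hy), h1, (hg y hy).symm ▸ h2⟩
  have h2 : Unhappy A E P B ψ x ↔ (x, g x) ∉ P ∧ (x ∈ B ∨ Covets E P A ψ x) := by
    rw [Unhappy, hg x hx]
  simp only [h2]
  by_cases hP : (x, g x) ∈ P <;> by_cases hB : x ∈ B <;> by_cases hc : Covets E P S g x <;>
    by_cases hc' : Covets E P A ψ x <;> simp [-Prod.exists, hP, hB, hc, hc']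
  exact hc' (h1 hc)

/-- The cost splits along a separation. -/
theorem listCost_eq (h : Separates A E S A₁ A₂) {H₁ H₂ : List ℕ} (hg : ∀ a ∈ S, ψ a = g a)
    (h₁ : ∀ a ∈ A₁, ψ a ∈ H₁) (h₂ : ∀ a ∈ A₂, ψ a ∈ H₂) :
    listCost A E P B ψ = (enviousIn E P B S g).length + (angryIn P B S g).length +
      ((undecided E P B S g).filter fun x => decide (Covets E P A ψ x)).length +
      listCost A₁ (pairsWithin E A₁ A₁) (pairsWithin P A₁ H₁)
        (A₁.filter fun x => decide (x ∈ angered A E P B S g)) ψ +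
      listCost A₂ (pairsWithin E A₂ A₂) (pairsWithin P A₂ H₂)
        (A₂.filter fun x => decide (x ∈ angered A E P B S g)) ψ := by
  rw [← h.countP_unhappy hg, listCost, ← h.perm.countP_eq, List.countP_append,
    List.countP_append, add_assoc]
  congr 2
  · refine List.countP_congr fun a ha => ?_
    simpa only [decide_eq_true_eq] using h.unhappy_iff hg h₁ ha
  · refine List.countP_congr fun a ha => ?_
    simpa only [decide_eq_true_eq] using h.swap.unhappy_iff hg h₂ ha

/-- Allocations of the two subinstances combine to an allocation. -/
theorem witnesses (h : Separates A E S A₁ A₂) (hinj : ∀ a ∈ S, ∀ b ∈ S, g a = g b → a = b)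
    (hF : ∀ a ∈ S, (a, g a) ∈ F) {H₁ K : List ℕ} (hH₁ : H₁ ⊆ remaining H S g) {u₁ u₂ : ℕ × List (ℕ × ℕ)}
    (h₁ : Witnesses A₁ (pairsWithin E A₁ A₁) (pairsWithin P A₁ H₁)
      (pairsWithin (pruned E P F K) A₁ H₁)
      (A₁.filter fun x => decide (x ∈ angered A E P B S g)) u₁)
    (h₂ : Witnesses A₂ (pairsWithin E A₂ A₂) (pairsWithin P A₂ (without (remaining H S g) H₁))
      (pairsWithin (pruned E P F K) A₂ (without (remaining H S g) H₁))
      (A₂.filter fun x => decide (x ∈ angered A E P B S g)) u₂) :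
    Witnesses A E P F B
      ((enviousIn E P B S g).length + ((angryIn P B S g).length +
        (((undecided E P B S g).filter fun x => !decide (x ∈ K)).length + (u₁.1 + u₂.1))),
        S.map (fun a => (a, g a)) ++ (u₁.2 ++ u₂.2)) := by
  obtain ⟨ψ₁, ha₁, hc₁, hL₁, hl₁⟩ := h₁
  obtain ⟨ψ₂, ha₂, hc₂, hL₂, hl₂⟩ := h₂
  -- The glued allocation is well defined because `S`, `A₁` and `A₂` are disjoint.
  obtain ⟨ψ, hψS, hψ₁, hψ₂⟩ : ∃ ψ : ℕ → ℕ, (∀ a ∈ S, ψ a = g a) ∧ (∀ a ∈ A₁, ψ a = ψ₁ a) ∧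
      ∀ a ∈ A₂, ψ a = ψ₂ a := by
    refine ⟨fun a => if a ∈ S then g a else if a ∈ A₁ then ψ₁ a else ψ₂ a, fun a ha => by simp [ha],
      fun a ha => by simp [ha, h.notMem_S ha], fun a ha => ?_⟩
    simp [h.swap.notMem_S ha, h.swap.notMem_right ha]
  have hf₁ : ∀ a ∈ A₁, (a, ψ a) ∈ pruned E P F K ∧ ψ a ∈ H₁ := fun a ha => by
    have := mem_pairsWithin.1 (ha₁.feas a ha)
    rw [hψ₁ a ha]
    exact ⟨this.1, this.2.2⟩
  have hf₂ : ∀ a ∈ A₂, (a, ψ a) ∈ pruned E P F K ∧ ψ a ∈ without (remaining H S g) H₁ :=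
    fun a ha => by
      have := mem_pairsWithin.1 (ha₂.feas a ha)
      rw [hψ₂ a ha]
      exact ⟨this.1, this.2.2⟩
  have hr₁ : ∀ a ∈ A₁, ∀ b ∈ S, ψ b ≠ ψ a := fun a ha b hb => by
    have := hH₁ (hf₁ a ha).2
    simp only [remaining, List.mem_filter, decide_eq_true_eq] at this
    rw [hψS b hb]
    exact this.2 b hb
  -- The three parts receive houses from disjoint sets, so injectivity on each part is enough for
  -- the whole.
  have hr₂ : ∀ a ∈ A₂, (∀ b ∈ S, ψ b ≠ ψ a) ∧ ∀ b ∈ A₁, ψ b ≠ ψ a := fun a ha => by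
    have := (hf₂ a ha).2
    simp only [without, remaining, List.mem_filter, decide_eq_true_eq] at this
    refine ⟨fun b hb => ?_, fun b hb => ?_⟩
    · rw [hψS b hb]
      exact this.1.2 b hb
    · intro hab
      exact this.2 (hab ▸ (hf₁ b hb).2)
  refine ⟨ψ, ⟨?_, ?_⟩, ?_, ?_, ?_⟩
  · intro a ha b hb hab
    rcases (h.mem_iff a).1 ha with ha | ha | ha <;> rcases (h.mem_iff b).1 hb with hb | hb | hb
    · exact hinj a ha b hb (by rw [← hψS a ha, ← hψS b hb, hab])
    · exact absurd hab (hr₁ b hb a ha)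
    · exact absurd hab ((hr₂ b hb).1 a ha)
    · exact absurd hab.symm (hr₁ a ha b hb)
    · exact ha₁.inj a ha b hb (by rw [← hψ₁ a ha, ← hψ₁ b hb, hab])
    · exact absurd hab ((hr₂ b hb).2 a ha)
    · exact absurd hab.symm ((hr₂ a ha).1 b hb)
    · exact absurd hab.symm ((hr₂ a ha).2 b hb)
    · exact ha₂.inj a ha b hb (by rw [← hψ₂ a ha, ← hψ₂ b hb, hab])
  · intro a ha
    rcases (h.mem_iff a).1 ha with ha | ha | ha
    · rw [hψS a ha]; exact hF a ha
    · exact (List.mem_filter.1 (hf₁ a ha).1).1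
    · exact (List.mem_filter.1 (hf₂ a ha).1).1
  · rw [h.listCost_eq hψS (fun a ha => (hf₁ a ha).2) (fun a ha => (hf₂ a ha).2),
      listCost_congr hψ₁, listCost_congr hψ₂]
    -- An undecided agent in `K` envies nobody in `S` by definition and nobody outside by pruning.
    -- The charge for the undecided agents outside `K` may be too high, hence an inequality.
    have hK' : ((undecided E P B S g).filter fun x => decide (Covets E P A ψ x)).length ≤
        ((undecided E P B S g).filter fun x => !decide (x ∈ K)).length := by
      rw [← List.countP_eq_length_filter, ← List.countP_eq_length_filter]
      refine List.countP_mono_left fun x hx hcov => ?_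
      simp only [decide_eq_true_eq, Bool.not_eq_true', decide_eq_false_iff_not] at hcov ⊢
      intro hxK
      obtain ⟨y, hy, hxy, hP⟩ := hcov
      have hp : ∀ y, (y, ψ y) ∈ pruned E P F K → (x, y) ∈ E → (x, ψ y) ∉ P := fun y hy h1 h2 => by
        simp only [pruned, List.mem_filter, decide_eq_true_eq] at hy
        exact hy.2 x hxK ⟨h1, h2⟩
      rcases (h.mem_iff y).1 hy with hy | hy | hy
      · simp only [undecided, List.mem_filter, decide_eq_true_eq] at hx
        exact hx.2.2.2 ⟨y, hy, hxy, hψS y hy ▸ hP⟩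
      · exact hp y (hf₁ y hy).1 hxy hP
      · exact hp y (hf₂ y hy).1 hxy hP
    dsimp only
    omega
  · intro p
    simp only [List.mem_append, List.mem_map, hL₁, hL₂, h.mem_iff]
    constructor
    · rintro (⟨a, ha, rfl⟩ | ⟨a, ha, rfl⟩ | ⟨a, ha, rfl⟩)
      · exact ⟨a, Or.inl ha, by rw [hψS a ha]⟩
      · exact ⟨a, Or.inr (Or.inl ha), by rw [hψ₁ a ha]⟩
      · exact ⟨a, Or.inr (Or.inr ha), by rw [hψ₂ a ha]⟩
    · rintro ⟨a, ha | ha | ha, rfl⟩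
      · exact Or.inl ⟨a, ha, by rw [hψS a ha]⟩
      · exact Or.inr (Or.inl ⟨a, ha, by rw [hψ₁ a ha]⟩)
      · exact Or.inr (Or.inr ⟨a, ha, by rw [hψ₂ a ha]⟩)
  · simp only [← h.perm.length_eq, List.length_append, List.length_map, hl₁, hl₂]

/-- An allocation restricts to the two subinstances. -/
theorem admissible_restrict (h : Separates A E S A₁ A₂) (hψ : Admissible A F ψ)
    (hH : ∀ p ∈ F, p.2 ∈ H) (hg : ∀ a ∈ S, ψ a = g a) {H₁ K : List ℕ}
    (hH₁ : H₁ = (remaining H S g).filter fun x => decide (x ∈ A₁.map ψ))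
    (hK : K = (undecided E P B S g).filter fun x => !decide (Covets E P A ψ x)) :
    Admissible A₁ (pairsWithin (pruned E P F K) A₁ H₁) ψ ∧
      Admissible A₂ (pairsWithin (pruned E P F K) A₂ (without (remaining H S g) H₁)) ψ := by
  have hm₁ : ∀ a ∈ A₁, a ∈ A := fun a ha => (h.mem_iff a).2 (Or.inr (Or.inl ha))
  have hm₂ : ∀ a ∈ A₂, a ∈ A := fun a ha => (h.mem_iff a).2 (Or.inr (Or.inr ha))
  -- Agents in `K` covet no house of a neighbour under `ψ`, so pruning removes none of the pairs
  -- that `ψ` uses.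
  have hp : ∀ a ∈ A, (a, ψ a) ∈ pruned E P F K := fun a ha => by
    simp only [pruned, List.mem_filter, decide_eq_true_eq]
    refine ⟨hψ.feas a ha, fun x hx ⟨h1, h2⟩ => ?_⟩
    rw [hK] at hx
    simp only [List.mem_filter, Bool.not_eq_true', decide_eq_false_iff_not] at hx
    exact hx.2 ⟨a, ha, h1, h2⟩
  have hr : ∀ a ∈ A, a ∉ S → ψ a ∈ remaining H S g := fun a ha haS => by
    simp only [remaining, List.mem_filter, decide_eq_true_eq]
    refine ⟨hH _ (hψ.feas a ha), fun b hb hba => ?_⟩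
    rw [← hg b hb] at hba
    exact haS (hψ.inj b ((h.mem_iff b).2 (Or.inl hb)) a ha hba ▸ hb)
  refine ⟨⟨fun a ha b hb => hψ.inj a (hm₁ a ha) b (hm₁ b hb), fun a ha => ?_⟩,
    ⟨fun a ha b hb => hψ.inj a (hm₂ a ha) b (hm₂ b hb), fun a ha => ?_⟩⟩
  · refine mem_pairsWithin.2 ⟨hp a (hm₁ a ha), ha, ?_⟩
    rw [hH₁, List.mem_filter]
    exact ⟨hr a (hm₁ a ha) (h.notMem_S ha), by simpa using ⟨a, ha, rfl⟩⟩
  · refine mem_pairsWithin.2 ⟨hp a (hm₂ a ha), ha, ?_⟩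
    simp only [without, List.mem_filter, decide_eq_true_eq]
    refine ⟨hr a (hm₂ a ha) (h.swap.notMem_S ha), ?_⟩
    rw [hH₁]
    simp only [List.mem_filter, List.mem_map, decide_eq_true_eq]
    rintro ⟨-, b, hb, hba⟩
    exact h.swap.notMem_right ha (hψ.inj b (hm₁ b hb) a (hm₂ a ha) hba ▸ hb)

/-- `ψ` maps `A₁` bijectively onto these houses, since it is injective and avoids the houses of `S`
there. Thus the guess that fits `ψ` passes the length test of the loop. -/
theorem length_filter_remaining (h : Separates A E S A₁ A₂) (hψ : Admissible A F ψ)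
    (hH : ∀ p ∈ F, p.2 ∈ H) (hHn : H.Nodup) (hg : ∀ a ∈ S, ψ a = g a) :
    ((remaining H S g).filter fun x => decide (x ∈ A₁.map ψ)).length = A₁.length := by
  have hm₁ : ∀ a ∈ A₁, a ∈ A := fun a ha => (h.mem_iff a).2 (Or.inr (Or.inl ha))
  rw [← List.length_map (as := A₁) ψ]
  refine List.Perm.length_eq ((List.perm_ext_iff_of_nodup ((show (remaining H S g).Nodup from hHn.filter _).filter _) ?_).2 ?_)
  · exact h.nodup_left.map_on fun a ha b hb => hψ.inj a (hm₁ a ha) b (hm₁ b hb)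
  · intro x
    simp only [List.mem_filter, decide_eq_true_eq, and_iff_right_iff_imp]
    intro hx
    obtain ⟨a, ha, rfl⟩ := List.mem_map.1 hx
    simp only [remaining, List.mem_filter, decide_eq_true_eq]
    refine ⟨hH _ (hψ.feas a (hm₁ a ha)), fun b hb hba => ?_⟩
    rw [← hg b hb] at hba
    exact h.notMem_S ha (hψ.inj b ((h.mem_iff b).2 (Or.inl hb)) a (hm₁ a ha) hba ▸ hb)

end Separates

/-! ### Run statements whose result is known only through a property -/

namespace Runs

variable {σ τ a b : Ty} {self : σ.Val → Option (τ.Val × ℕ)}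

theorem exists_mono {e : Expr σ τ Ty.Val a} {T T' : ℕ} {Q Q' : a.Val → Prop}
    (h : ∃ v, Runs self e v T ∧ Q v) (hT : T ≤ T') (hQ : ∀ v, Q v → Q' v) :
    ∃ v, Runs self e v T' ∧ Q' v := by
  obtain ⟨v, h1, h2⟩ := h
  exact ⟨v, h1.mono hT, hQ v h2⟩

theorem exists_letE {x : Expr σ τ Ty.Val a} {f : a.Val → Expr σ τ Ty.Val b} {u : a.Val}
    {T T' : ℕ} {Q : b.Val → Prop} (hx : Runs self x u T) (h : ∃ v, Runs self (f u) v T' ∧ Q v) :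
    ∃ v, Runs self (.letE x f) v (T + T' + 1) ∧ Q v := by
  obtain ⟨v, h1, h2⟩ := h
  exact ⟨v, hx.letE h1, h2⟩

end Runs

/-! ### Running times of the steps inside the recursive procedure -/

namespace Code

variable {self : Ty.Val .input → Option (Ty.Val .output × ℕ)} {A H : List ℕ}
  {E P F : List (ℕ × ℕ)} {B S : List ℕ} {g : ℕ → ℕ} {M : ℕ}

/-- The list is the graph of `g` on `S`, so searching it for agent `y` amounts to evaluating `g y`.
-/
theorem any_map_eq (P : List (ℕ × ℕ)) (S : List ℕ) (g : ℕ → ℕ) (x y : ℕ) :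
    ((S.map fun a => (a, g a)).any fun p => decide (p.1 = y) && decide ((x, p.2) ∈ P)) =
      decide (y ∈ S ∧ (x, g y) ∈ P) := by
  rw [Bool.eq_iff_iff]
  simp only [List.any_map, List.any_eq_true, Function.comp_apply, Bool.and_eq_true,
    decide_eq_true_eq]
  constructor
  · rintro ⟨a, ha, rfl, h⟩; exact ⟨ha, h⟩
  · rintro ⟨ha, h⟩; exact ⟨y, ha, rfl, h⟩

theorem runs_likes_map (hM : 1 ≤ M) (hP : P.length ≤ M) (hS : S.length ≤ M) (x y : ℕ) :
    Runs self (likes (V := Ty.Val) P (S.map fun a => (a, g a)) x y)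
      (decide (y ∈ S ∧ (x, g y) ∈ P)) (33 * M ^ 2) :=
  Runs.congr (runs_likes hM hP (by simpa using hS)) (any_map_eq P S g x y) le_rfl

theorem runs_satisfied (hM : 1 ≤ M) (hP : P.length ≤ M) (hS : S.length ≤ M) :
    Runs self (filter (V := Ty.Val) (a := .nat) (fun x => likes P (S.map fun a => (a, g a)) x x)
      (.var (a := .list .nat) S)) (satisfied P S g) (41 * M ^ 3) := by
  refine Runs.congr (runs_filter (Runs.varNats S) fun x _ => runs_likes_map hM hP hS x x) ?_ ?_
  · exact List.filter_congr fun x hx => by rw [Bool.eq_iff_iff]; simp [hx]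
  · have : S.length * (33 * M ^ 2 + 5) ≤ M * (33 * M ^ 2 + 5) := by gcongr
    obtain ⟨N, rfl⟩ := Nat.exists_eq_add_of_le' hM
    ring_nf at this ⊢
    omega

theorem runs_enviousIn (hM : 1 ≤ M) (hE : E.length ≤ M) (hP : P.length ≤ M) (hB : B.length ≤ M)
    (hS : S.length ≤ M) :
    Runs self (filter (V := Ty.Val) (a := .nat)
      (fun x => and (neg (mem (.var x) (.var (a := .list .nat) B)))
        (and (neg (likes P (S.map fun a => (a, g a)) x x))
        (any (fun y => and (memPair (.var x) (.var y) (.var (a := .pairs) E))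
          (likes P (S.map fun a => (a, g a)) x y)) (.var (a := .list .nat) S))))
      (.var (a := .list .nat) S)) (enviousIn E P B S g) (150 * M ^ 4) := by
  refine Runs.congr (runs_filter (c := 120 * M ^ 3) (Runs.varNats S) fun x _ => Runs.mono (runs_and
    (runs_neg (runs_mem (Runs.var x) (Runs.varNats B)))
    (runs_and (runs_neg (runs_likes_map hM hP hS x x)) (runs_any (Runs.varNats S) fun y _ => runs_and
      (runs_memPair (Runs.var x) (Runs.var y) (Runs.varPairs E))
      (runs_likes_map hM hP hS x y)))) ?_) ?_ ?_
  · have : S.length * (3 + E.length * (2 * 1 + 12) + 33 * M ^ 2 + 2 + 4) ≤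
      M * (3 + M * (2 * 1 + 12) + 33 * M ^ 2 + 2 + 4) := by gcongr
    have : B.length * (1 + 6) ≤ M * (1 + 6) := by gcongr
    refine le_trans (b := 20 + M * (1 + 6) + 33 * M ^ 2 +
      M * (3 + M * (2 * 1 + 12) + 33 * M ^ 2 + 2 + 4)) (by omega) ?_
    obtain ⟨N, rfl⟩ := Nat.exists_eq_add_of_le' hM
    ring_nf
    omega
  · refine List.filter_congr fun x hx => ?_
    rw [Bool.eq_iff_iff]
    simp only [Covets, Bool.and_eq_true, Bool.not_eq_true', decide_eq_false_iff_not, hx, true_and,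
      List.any_eq_true, decide_eq_true_eq]
    refine and_congr_right fun _ => and_congr_right fun _ => exists_congr fun y => ?_
    tauto
  · have : S.length * (120 * M ^ 3 + 5) ≤ M * (120 * M ^ 3 + 5) := by gcongr
    obtain ⟨N, rfl⟩ := Nat.exists_eq_add_of_le' hM
    ring_nf at this ⊢
    omega

theorem runs_angryIn (hM : 1 ≤ M) (hP : P.length ≤ M) (hB : B.length ≤ M) (hS : S.length ≤ M) :
    Runs self (filter (V := Ty.Val) (a := .nat)
      (fun x => and (mem (.var x) (.var (a := .list .nat) B))
        (neg (likes P (S.map fun a => (a, g a)) x x)))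
      (.var (a := .list .nat) S)) (angryIn P B S g) (60 * M ^ 3) := by
  refine Runs.congr (runs_filter (c := 50 * M ^ 2) (Runs.varNats S) fun x _ => Runs.mono (runs_and
    (runs_mem (Runs.var x) (Runs.varNats B))
    (runs_neg (runs_likes_map hM hP hS x x))) ?_) ?_ ?_
  · nlinarith
  · refine List.filter_congr fun x hx => ?_
    rw [Bool.eq_iff_iff]
    simp [hx]
  · have : S.length * (50 * M ^ 2 + 5) ≤ M * (50 * M ^ 2 + 5) := by gcongr
    obtain ⟨N, rfl⟩ := Nat.exists_eq_add_of_le' hM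
    ring_nf at this ⊢
    omega

/-- The program removes three lists from `S`, whereas `undecided` is given by a condition; a case
distinction on preference and anger shows that they agree. -/
theorem runs_undecided (hM : 1 ≤ M) (hS : S.length ≤ M) :
    Runs self (filter (V := Ty.Val) (a := .nat)
      (fun x => neg (or (mem (.var x) (.var (a := .list .nat) (satisfied P S g)))
        (or (mem (.var x) (.var (a := .list .nat) (enviousIn E P B S g)))
          (mem (.var x) (.var (a := .list .nat) (angryIn P B S g))))))
      (.var (a := .list .nat) S)) (undecided E P B S g) (50 * M ^ 2) := by
  have h1 : (satisfied P S g).length ≤ M := (List.length_filter_le _ _).trans hS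
  have h2 : (enviousIn E P B S g).length ≤ M := (List.length_filter_le _ _).trans hS
  have h3 : (angryIn P B S g).length ≤ M := (List.length_filter_le _ _).trans hS
  refine Runs.congr (runs_filter (c := 36 * M) (Runs.varNats S) fun x _ => Runs.mono (runs_neg
    (runs_or (runs_mem (Runs.var x) (Runs.varNats _)) (runs_or
    (runs_mem (Runs.var x) (Runs.varNats _)) (runs_mem (Runs.var x) (Runs.varNats _))))) ?_) ?_ ?_
  · omega
  · refine List.filter_congr fun x hx => ?_
    rw [Bool.eq_iff_iff]
    simp only [satisfied, enviousIn, angryIn, Bool.not_eq_true', Bool.or_eq_false_iff,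
      decide_eq_false_iff_not, List.mem_filter, hx, true_and, decide_eq_true_eq]
    by_cases hP : (x, g x) ∈ P <;> by_cases hB : x ∈ B <;> simp [hP, hB]
  · have : S.length * (36 * M + 5) ≤ M * (36 * M + 5) := by gcongr
    nlinarith

theorem runs_angered (hM : 1 ≤ M) (hA : A.length ≤ M) (hE : E.length ≤ M) (hP : P.length ≤ M)
    (hB : B.length ≤ M) (hS : S.length ≤ M) :
    Runs self (append (V := Ty.Val) (a := .nat) (.var (a := .list .nat) B) (filter
      (fun y => and (neg (mem (.var y) (.var (a := .list .nat) S)))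
        (any (fun x => and (memPair (.var x) (.var y) (.var (a := .pairs) E))
          (likes P (S.map fun a => (a, g a)) y x)) (.var (a := .list .nat) S)))
      (.var (a := .list .nat) A))) (angered A E P B S g) (120 * M ^ 4) := by
  refine Runs.congr (runs_append (Runs.varNats B) (runs_filter (c := 80 * M ^ 3)
    (q := fun y : ℕ => decide (y ∉ S ∧ ∃ x ∈ S, (x, y) ∈ E ∧ (y, g x) ∈ P)) (Runs.varNats A)
    fun y _ => Runs.congr (runs_and (runs_neg (runs_mem (Runs.var y) (Runs.varNats S)))
    (runs_any (Runs.varNats S) fun x _ => runs_and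
      (runs_memPair (Runs.var x) (Runs.var y) (Runs.varPairs E))
      (runs_likes_map hM hP hS y x))) ?_ ?_)) rfl ?_
  · rw [Bool.eq_iff_iff]
    simp only [Bool.and_eq_true, Bool.not_eq_true', decide_eq_false_iff_not,
      List.any_eq_true, decide_eq_true_eq]
    refine and_congr_right fun _ => exists_congr fun x => ?_
    tauto
  · have : S.length * (3 + E.length * (2 * 1 + 12) + 33 * M ^ 2 + 2 + 4) ≤
      M * (3 + M * (2 * 1 + 12) + 33 * M ^ 2 + 2 + 4) := by gcongr
    refine le_trans (b := 10 + M * (1 + 6) +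
      M * (3 + M * (2 * 1 + 12) + 33 * M ^ 2 + 2 + 4)) (by omega) ?_
    obtain ⟨N, rfl⟩ := Nat.exists_eq_add_of_le' hM
    ring_nf
    omega
  · have : A.length * (80 * M ^ 3 + 5) ≤ M * (80 * M ^ 3 + 5) := by gcongr
    obtain ⟨N, rfl⟩ := Nat.exists_eq_add_of_le' hM
    ring_nf at this ⊢
    omega

theorem runs_remaining (hM : 1 ≤ M) (hH : H.length ≤ M) (hS : S.length ≤ M) :
    Runs self (filter (V := Ty.Val) (a := .nat)
      (fun h => neg (any (a := .prod .nat .nat) (fun p => .eq (.snd (.var p)) (.var h))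
        (.var (a := .pairs) (S.map fun a => (a, g a))))) (.var (a := .list .nat) H))
      (remaining H S g) (30 * M ^ 2) := by
  refine Runs.congr (runs_filter (c := 20 * M) (Runs.varNats H) fun h _ => Runs.mono (runs_neg
    (runs_any (a := .prod .nat .nat) (Runs.varPairs _) fun p _ =>
      Runs.eq (Runs.snd (Runs.var p)) (Runs.var h))) ?_) ?_ ?_
  · rw [List.length_map]
    omega
  · refine List.filter_congr fun x hx => ?_
    rw [Bool.eq_iff_iff]
    simp
  · have : H.length * (20 * M + 5) ≤ M * (20 * M + 5) := by gcongr
    nlinarith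

theorem runs_filter_notMem {X : List ℕ} (hM : 1 ≤ M) (hH : H.length ≤ M) (hX : X.length ≤ M) :
    Runs self (filter (V := Ty.Val) (a := .nat)
      (fun h => neg (mem (.var h) (.var (a := .list .nat) X))) (.var (a := .list .nat) H))
      (H.filter fun h => !decide (h ∈ X)) (20 * M ^ 2) := by
  refine Runs.mono (runs_filter (c := 12 * M) (Runs.varNats H) fun h _ => Runs.mono (runs_neg
    (runs_mem (Runs.var h) (Runs.varNats X))) ?_) ?_
  · omega
  · have : H.length * (12 * M + 5) ≤ M * (12 * M + 5) := by gcongr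
    nlinarith

theorem runs_without {X : List ℕ} (hM : 1 ≤ M) (hH : H.length ≤ M) (hX : X.length ≤ M) :
    Runs self (filter (V := Ty.Val) (a := .nat)
      (fun h => neg (mem (.var h) (.var (a := .list .nat) X))) (.var (a := .list .nat) H))
      (without H X) (20 * M ^ 2) :=
  Runs.congr (runs_filter_notMem hM hH hX) (List.filter_congr fun x _ => by simp) le_rfl

theorem runs_pruned {K : List ℕ} (hM : 1 ≤ M) (hE : E.length ≤ M) (hP : P.length ≤ M)
    (hF : F.length ≤ M) (hK : K.length ≤ M) :
    Runs self (filter (V := Ty.Val) (a := .prod .nat .nat) (fun p => neg (any (a := .nat) (fun x =>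
      and (memPair (.var x) (.fst (.var p)) (.var (a := .pairs) E))
        (memPair (.var x) (.snd (.var p)) (.var (a := .pairs) P))) (.var (a := .list .nat) K)))
      (.var (a := .pairs) F)) (pruned E P F K) (70 * M ^ 3) := by
  refine Runs.congr (runs_filter (a := .prod .nat .nat) (c := 54 * M ^ 2) (Runs.varPairs F)
    fun p _ => Runs.mono (runs_neg (runs_any (Runs.varNats K) fun x _ => runs_and
    (runs_memPair (T := 2) (Runs.mono (Runs.var x) (by omega)) (Runs.fst (Runs.var p))
      (Runs.varPairs E))
    (runs_memPair (T := 2) (Runs.mono (Runs.var x) (by omega)) (Runs.snd (Runs.var p))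
      (Runs.varPairs P)))) ?_) ?_ ?_
  · have : K.length * (3 + E.length * (2 * 2 + 12) + (3 + P.length * (2 * 2 + 12)) + 2 + 4) ≤
      M * (3 + M * (2 * 2 + 12) + (3 + M * (2 * 2 + 12)) + 2 + 4) := by gcongr
    refine le_trans (b := 5 + M * (3 + M * (2 * 2 + 12) + (3 + M * (2 * 2 + 12)) + 2 + 4))
      (by omega) ?_
    obtain ⟨N, rfl⟩ := Nat.exists_eq_add_of_le' hM
    ring_nf
    omega
  · refine List.filter_congr fun p hp => ?_
    rw [Bool.eq_iff_iff]
    simp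
  · have : F.length * (54 * M ^ 2 + 5) ≤ M * (54 * M ^ 2 + 5) := by gcongr
    obtain ⟨N, rfl⟩ := Nat.exists_eq_add_of_le' hM
    ring_nf at this ⊢
    omega

end Code

namespace Runs

variable {σ τ a b : Ty} {self : σ.Val → Option (τ.Val × ℕ)}

theorem exists_ite_false {c : Expr σ τ Ty.Val .bool} {t e : Expr σ τ Ty.Val a} {T T' : ℕ}
    {Q : a.Val → Prop} (hc : Runs self c false T) (h : ∃ v, Runs self e v T' ∧ Q v) :
    ∃ v, Runs self (.ite c t e) v (T + T' + 1) ∧ Q v := by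
  obtain ⟨v, h1, h2⟩ := h
  exact ⟨v, Runs.ite (v := v) hc (fun h => by cases h) (fun _ => h1), h2⟩

theorem exists_optCase_some {o : Expr σ τ Ty.Val (.opt a)} {e : Expr σ τ Ty.Val b}
    {f : a.Val → Expr σ τ Ty.Val b} {x : a.Val} {T T' : ℕ} {Q : b.Val → Prop}
    (ho : Runs self o (Option.some x) T) (h : ∃ v, Runs self (f x) v T' ∧ Q v) :
    ∃ v, Runs self (.optCase o e f) v (T + T' + 1) ∧ Q v := by
  obtain ⟨v, h1, h2⟩ := h
  exact ⟨v, Runs.optCase (v := v) (g := fun _ => v) ho (fun h => by cases h)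
    (fun y hy => by cases hy; exact h1), h2⟩

theorem exists_optCase_none {o : Expr σ τ Ty.Val (.opt a)} {e : Expr σ τ Ty.Val b}
    {f : a.Val → Expr σ τ Ty.Val b} {T T' : ℕ} {Q : b.Val → Prop}
    (ho : Runs self o Option.none T) (h : ∃ v, Runs self e v T' ∧ Q v) :
    ∃ v, Runs self (.optCase o e f) v (T + T' + 1) ∧ Q v := by
  obtain ⟨v, h1, h2⟩ := h
  exact ⟨v, Runs.optCase (v := v) (g := fun _ => v) ho (fun _ => h1) (fun y hy => by cases hy), h2⟩

end Runs

/-! ### Counting houses, and the invariant of the recursion -/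

theorem length_without {l X : List ℕ} (hl : l.Nodup) (hX : X.Nodup) (h : X ⊆ l) :
    (without l X).length + X.length = l.length := by
  have h1 : (l.filter fun x => decide (x ∈ X)).length = X.length := by
    refine List.Perm.length_eq ((List.perm_ext_iff_of_nodup (hl.filter _) hX).2 fun x => ?_)
    simp only [List.mem_filter, decide_eq_true_eq, and_iff_right_iff_imp]
    exact fun hx => h hx
  have h2 := List.length_eq_length_filter_add (l := l) fun x => decide (x ∈ X)
  have h3 : without l X = l.filter fun x => !decide (x ∈ X) :=
    List.filter_congr fun x _ => by simp
  rw [h3]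
  omega

/-- Allows `length_without` to count the houses that are left after serving `S`. -/
theorem remaining_eq_without (H S : List ℕ) (g : ℕ → ℕ) :
    remaining H S g = without H (S.map g) :=
  List.filter_congr fun x _ => by simp

/-- Inputs of the recursive procedure: there are as many houses as agents, agents are less than
`n`, edges belong to `G`, and all lists have length at most `M`. -/
structure WellFormed (n M : ℕ) (G : ℕ → ℕ → Prop) (A H : List ℕ) (E P F : List (ℕ × ℕ))
    (B : List ℕ) : Prop where
  nodup_agents : A.Nodup
  nodup_houses : H.Nodup
  nodup_feas : F.Nodup
  length_houses : H.length = A.length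
  feas_houses : ∀ p ∈ F, p.2 ∈ H
  symm : ∀ u v, (u, v) ∈ E → (v, u) ∈ E
  agents_lt : ∀ a ∈ A, a < n
  edges : ∀ u v, (u, v) ∈ E → G u v
  length_A : A.length ≤ M
  length_E : E.length ≤ M
  length_P : P.length ≤ M
  length_F : F.length ≤ M
  length_B : B.length ≤ M

namespace WellFormed

variable {n M : ℕ} {G : ℕ → ℕ → Prop} {A H : List ℕ} {E P F : List (ℕ × ℕ)} {B : List ℕ}

/-- Restriction only filters lists, so one bound `M` serves at all depths. The angry list cannot
pile up either, as it is cut down to a sublist of `A'`. -/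
theorem restrict {A' H' : List ℕ} {F' : List (ℕ × ℕ)} {B' : List ℕ}
    (symm : ∀ u v, (u, v) ∈ E → (v, u) ∈ E) (agents_lt : ∀ a ∈ A', a < n)
    (edges : ∀ u v, (u, v) ∈ E → G u v) (hE : E.length ≤ M) (hP : P.length ≤ M)
    (hF : F'.length ≤ M) (hA' : A'.Nodup) (hlA : A'.length ≤ M) (hH' : H'.Nodup)
    (hl : H'.length = A'.length) (hF' : F'.Nodup) :
    WellFormed n M G A' H' (pairsWithin E A' A') (pairsWithin P A' H') (pairsWithin F' A' H')
      (A'.filter fun x => decide (x ∈ B')) where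
  nodup_agents := hA'
  nodup_houses := hH'
  nodup_feas := hF'.filter _
  length_houses := hl
  feas_houses := fun p hp => (mem_pairsWithin.1 hp).2.2
  symm := fun u v huv => by
    rw [mem_pairsWithin] at huv ⊢
    exact ⟨symm _ _ huv.1, huv.2.2, huv.2.1⟩
  agents_lt := agents_lt
  edges := fun u v huv => edges u v (mem_pairsWithin.1 huv).1
  length_A := hlA
  length_E := (List.length_filter_le _ _).trans hE
  length_P := (List.length_filter_le _ _).trans hP
  length_F := (List.length_filter_le _ _).trans hF
  length_B := (List.length_filter_le _ _).trans hlA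

end WellFormed

theorem Answers.imp {sound : ℕ × List (ℕ × ℕ) → Prop} {D D' : ℕ → Prop}
    {r : Option (ℕ × List (ℕ × ℕ))} (h : Answers sound D r) (hD : ∀ w, D' w → D w) :
    Answers sound D' r := ⟨h.1, fun w hw => h.2 w (hD w hw)⟩

/-! ### One call of the recursive procedure -/

namespace Code

variable {self : Ty.Val .input → Option (Ty.Val .output × ℕ)} {A H : List ℕ}
  {E P F : List (ℕ × ℕ)} {B S A₁ A₂ : List ℕ} {g : ℕ → ℕ} {n M X : ℕ} {G : ℕ → ℕ → Prop}

/-- The recursive calls return answers after at most `X` steps. -/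
def CallsAnswered (self : Ty.Val .input → Option (Ty.Val .output × ℕ)) (n M : ℕ)
    (G : ℕ → ℕ → Prop) (A : List ℕ) (X : ℕ) : Prop :=
  ∀ A' H' E' P' F' B', WellFormed n M G A' H' E' P' F' B' → 3 * A'.length ≤ 2 * A.length →
    ∃ r t, self (A', H', E', P', F', B') = some (r, t) ∧ t ≤ X ∧
      AnswersProblem (A', H', E', P', F', B') r

/-- The body of the innermost loop of the recursive procedure. -/
theorem runs_innermost (hM : 1 ≤ M) (hw : WellFormed n M G A H E P F B)
    (hs : Separates A E S A₁ A₂) (hself : CallsAnswered self n M G A X)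
    (hA₁ : 3 * A₁.length ≤ 2 * A.length) (hA₂ : 3 * A₂.length ≤ 2 * A.length)
    (hinj : ∀ a ∈ S, ∀ b ∈ S, g a = g b → a = b) (hF : ∀ a ∈ S, (a, g a) ∈ F)
    {H₁ K : List ℕ} (hH₁ : H₁.Sublist (remaining H S g)) (hl : H₁.length = A₁.length)
    (hK : K.Sublist (undecided E P B S g)) :
    ∃ y, Runs self (
      .letE (filter (V := Ty.Val) (a := .prod .nat .nat) (fun p => neg (any (a := .nat) (fun x =>
        and (memPair (.var x) (.fst (.var p)) (.var (a := .pairs) E))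
          (memPair (.var x) (.snd (.var p)) (.var (a := .pairs) P))) (.var (a := .list .nat) K)))
        (.var (a := .pairs) F)) fun F' =>
      .letE (.call (restrict (V := Ty.Val) A₁ H₁ E P F' (angered A E P B S g))) fun r₁ =>
      .letE (.call (restrict (V := Ty.Val) A₂ (without (remaining H S g) H₁) E P F'
        (angered A E P B S g))) fun r₂ =>
      .optCase (.var r₁) .none fun u₁ =>
      .optCase (.var r₂) .none fun u₂ =>
      .some (.pair
        (.add (length (.var (a := .list .nat) (enviousIn E P B S g)))
          (.add (length (.var (a := .list .nat) (angryIn P B S g)))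
          (.add (length (filter (a := .nat) (fun x => neg (mem (.var x) (.var (a := .list .nat) K)))
              (.var (a := .list .nat) (undecided E P B S g))))
          (.add (.fst (.var u₁)) (.fst (.var u₂))))))
        (append (.var (a := .pairs) (S.map fun a => (a, g a)))
          (append (.snd (.var u₁)) (.snd (.var u₂)))))) y (600 * M ^ 3 + 2 * X) ∧
      Answers (Witnesses A E P F B) (fun w => ∃ ψ, Admissible A F ψ ∧ listCost A E P B ψ = w ∧
        (∀ a ∈ S, ψ a = g a) ∧
        H₁ = ((remaining H S g).filter fun x => decide (x ∈ A₁.map ψ)) ∧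
        K = ((undecided E P B S g).filter fun x => !decide (Covets E P A ψ x))) y := by
  have hperm := hs.perm.length_eq
  have hlA := hw.length_A
  simp only [List.length_append] at hperm
  have hSM : S.length ≤ M := by omega
  have hRM : (undecided E P B S g).length ≤ M := (List.length_filter_le _ _).trans hSM
  have hDM : (enviousIn E P B S g).length ≤ M := (List.length_filter_le _ _).trans hSM
  have hQM : (angryIn P B S g).length ≤ M := (List.length_filter_le _ _).trans hSM
  have hKM : K.length ≤ M := hK.length_le.trans hRM
  have hBM : (angered A E P B S g).length ≤ 2 * M := by
    rw [angered, List.length_append]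
    have := List.length_filter_le
      (fun y => decide (y ∉ S ∧ ∃ x ∈ S, (x, y) ∈ E ∧ (y, g x) ∈ P)) A
    have := hw.length_B
    omega
  have hF'M : (pruned E P F K).length ≤ M := (List.length_filter_le _ _).trans hw.length_F
  have hF'n : (pruned E P F K).Nodup := hw.nodup_feas.filter _
  have hSn := hs.nodup_S.map_on fun a ha b hb => hinj a ha b hb
  have hH₀ : (remaining H S g).Nodup := hw.nodup_houses.filter _
  -- `g` uses exactly `|S|` houses of `H`. Together with `|H₁| = |A₁|` this leaves `|A₂|` houses for
  -- the other side, so that the second subinstance is well formed too.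
  have hl₀ : (remaining H S g).length + S.length = A.length := by
    rw [← hw.length_houses, ← length_without hw.nodup_houses hSn, remaining_eq_without,
      List.length_map]
    intro x hx
    obtain ⟨a, ha, rfl⟩ := List.mem_map.1 hx
    exact hw.feas_houses _ (hF a ha)
  have hH₁n : H₁.Nodup := hH₁.nodup hH₀
  have hH₂n : (without (remaining H S g) H₁).Nodup := hH₀.filter _
  have hl₂ : (without (remaining H S g) H₁).length = A₂.length := by
    have := length_without hH₀ hH₁n hH₁.subset
    omega
  obtain ⟨r₁, t₁, hr₁, ht₁, ha₁⟩ := hself _ _ _ _ _ _ (WellFormed.restrict (n := n) (G := G)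
    (B' := angered A E P B S g) hw.symm
    (fun a ha => hw.agents_lt a ((hs.mem_iff a).2 (Or.inr (Or.inl ha)))) hw.edges hw.length_E
    hw.length_P hF'M hs.nodup_left (by omega) hH₁n hl hF'n) hA₁
  obtain ⟨r₂, t₂, hr₂, ht₂, ha₂⟩ := hself _ _ _ _ _ _ (WellFormed.restrict (n := n) (G := G)
    (B' := angered A E P B S g) hw.symm
    (fun a ha => hw.agents_lt a ((hs.mem_iff a).2 (Or.inr (Or.inr ha)))) hw.edges hw.length_E
    hw.length_P hF'M hs.nodup_right (by omega) hH₂n hl₂ hF'n) hA₂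
  -- For an allocation that agrees with all guesses, the undecided agents outside `K` are precisely
  -- those that become envious. Nothing is overcharged, and the recursive values are at most the
  -- costs of the restrictions of `ψ`.
  have hcost : ∀ ψ, Admissible A F ψ → (∀ a ∈ S, ψ a = g a) →
      H₁ = ((remaining H S g).filter fun x => decide (x ∈ A₁.map ψ)) →
      K = ((undecided E P B S g).filter fun x => !decide (Covets E P A ψ x)) →
      ∃ u₁ u₂, r₁ = some u₁ ∧ r₂ = some u₂ ∧
        (enviousIn E P B S g).length + ((angryIn P B S g).length +
        (((undecided E P B S g).filter fun x => !decide (x ∈ K)).length + (u₁.1 + u₂.1))) ≤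
        listCost A E P B ψ := by
    intro ψ hψ hg h₁ hK'
    obtain ⟨hψ₁, hψ₂⟩ := hs.admissible_restrict hψ hw.feas_houses hg h₁ hK'
    obtain ⟨u₁, hu₁, hc₁⟩ := ha₁.2 _ ⟨ψ, hψ₁, rfl⟩
    obtain ⟨u₂, hu₂, hc₂⟩ := ha₂.2 _ ⟨ψ, hψ₂, rfl⟩
    refine ⟨u₁, u₂, hu₁, hu₂, ?_⟩
    rw [hs.listCost_eq (H₁ := H₁) (H₂ := without (remaining H S g) H₁) hg (fun a ha => (mem_pairsWithin.1 (hψ₁.feas a ha)).2.2)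
      (fun a ha => (mem_pairsWithin.1 (hψ₂.feas a ha)).2.2)]
    have : ((undecided E P B S g).filter fun x => !decide (x ∈ K)) =
        (undecided E P B S g).filter fun x => decide (Covets E P A ψ x) := by
      refine List.filter_congr fun x hx => ?_
      rw [Bool.eq_iff_iff, hK']
      simp only [Bool.not_eq_true', decide_eq_false_iff_not, List.mem_filter, hx, true_and,
        not_not, decide_eq_true_eq]
    rw [this]
    dsimp only at hc₁ hc₂
    omega
  refine Runs.exists_mono (T := 70 * M ^ 3 + (180 * M ^ 2 + X + 1 + (180 * M ^ 2 + X + 1 +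
    (1 + (1 + 90 * M ^ 2 + 1) + 1) + 1) + 1) + 1) (Runs.exists_letE
    (runs_pruned hM hw.length_E hw.length_P hw.length_F hKM)
    (Runs.exists_letE (Runs.call (runs_restrict hM (by omega) (by omega) hw.length_E hw.length_P
      hF'M hBM) ⟨t₁, hr₁, ht₁⟩)
    (Runs.exists_letE (Runs.call (runs_restrict hM (by omega) (by omega) hw.length_E hw.length_P
      hF'M hBM) ⟨t₂, hr₂, ht₂⟩) ?_))) ?_ fun _ h => h
  · rcases r₁ with _ | u₁
    · refine Runs.exists_optCase_none (Runs.varOutput _) ⟨_, Runs.mono Runs.none (by omega), ?_⟩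
      -- If a recursive call finds nothing, `hcost` shows that no admissible allocation agrees with
      -- the guesses.
      refine ⟨fun u hu => (by cases hu), fun w ⟨ψ, hψ, _, hg, h₁, hK'⟩ => ?_⟩
      obtain ⟨_, _, h, -⟩ := hcost ψ hψ hg h₁ hK'
      cases h
    refine Runs.exists_optCase_some (Runs.varOutput _) ?_
    rcases r₂ with _ | u₂
    · refine Runs.exists_optCase_none (Runs.varOutput _) ⟨_, Runs.mono Runs.none ?_, ?_⟩
      · nlinarith
      refine ⟨fun u hu => (by cases hu), fun w ⟨ψ, hψ, _, hg, h₁, hK'⟩ => ?_⟩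
      obtain ⟨_, _, -, h, -⟩ := hcost ψ hψ hg h₁ hK'
      cases h
    refine Runs.exists_optCase_some (Runs.varOutput _) ?_
    have hwit := hs.witnesses hinj hF hH₁.subset (ha₁.1 u₁ rfl) (ha₂.1 u₂ rfl)
    refine ⟨_, Runs.mono (Runs.some (Runs.pair (Runs.add (runs_length (Runs.varNats _))
      (Runs.add (runs_length (Runs.varNats _)) (Runs.add (runs_length (runs_filter_notMem hM hRM hKM))
      (Runs.add (Runs.fst (Runs.var _)) (Runs.fst (Runs.var _))))))
      (runs_append (Runs.varPairs _) (runs_append (Runs.snd (Runs.var _))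
        (Runs.snd (Runs.var _)))))) ?_, ?_⟩
    · obtain ⟨_, -, -, -, hl₁⟩ := ha₁.1 u₁ rfl
      dsimp only at hl₁
      have := List.length_filter_le (fun x => !decide (x ∈ K)) (undecided E P B S g)
      rw [hl₁, List.length_map]
      nlinarith
    · refine ⟨fun u hu => ?_, fun w ⟨ψ, hψ, hc, hg, h₁, hK'⟩ => ?_⟩
      · cases hu
        exact hwit
      · obtain ⟨u₁', u₂', h1, h2, h3⟩ := hcost ψ hψ hg h₁ hK'
        cases h1; cases h2
        exact ⟨_, rfl, hc ▸ h3⟩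
  · obtain ⟨N, rfl⟩ := Nat.exists_eq_add_of_le' hM
    ring_nf
    omega

end Code
namespace Code

variable {self : Ty.Val .input → Option (Ty.Val .output × ℕ)} {A H : List ℕ}
  {E P F : List (ℕ × ℕ)} {B S A₁ A₂ : List ℕ} {g : ℕ → ℕ} {n M X : ℕ} {G : ℕ → ℕ → Prop}

/-- One call of the recursive procedure. -/
theorem runs_ohaanr (hM : 1 ≤ M) (hw : WellFormed n M G A H E P F B) (hA : A ≠ []) {s : ℕ}
    (hsep : ∃ t ∈ partitionsOf A, Balanced A E t ∧ t.1.length ≤ s)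
    (hself : CallsAnswered self n M G A X) :
    ∃ r, Runs self (ohaanr (V := Ty.Val) (A, H, E, P, F, B)) r
      (A.length ^ s * 4 ^ A.length * (3000 * M ^ 4 + 2 * X)) ∧
      AnswersProblem (A, H, E, P, F, B) r := by
  obtain ⟨t₀, ht₀, hb₀, hs₀⟩ := hsep
  obtain ⟨⟨S, A₁, A₂⟩, hmem, hval, hbal, hmin⟩ :=
    foldr_betterSeparation A E (partitionsOf A) ⟨t₀, ht₀, hb₀⟩
  -- The separator found by brute force is at most as large as the one whose existence is assumed.
  have hSs : S.length ≤ s := (hmin t₀ ht₀ hb₀).trans hs₀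
  have hs : Separates A E S A₁ A₂ :=
    ⟨hw.nodup_agents, perm_of_mem_partitionsOf hmem, hw.symm, hbal.2.2⟩
  have hperm := hs.perm.length_eq
  simp only [List.length_append] at hperm
  have hlA := hw.length_A
  have hpos : 1 ≤ A.length := List.length_pos_iff.2 hA
  have hlH := hw.length_houses
  have hHM : H.length ≤ M := by omega
  have hSM : S.length ≤ M := by omega
  have h2k : 1 ≤ 2 ^ A.length := Nat.one_le_two_pow
  -- One factor is for the subsets `H₁` of the houses, the other for the subsets `K` of the
  -- undecided agents.
  have h4k : 2 ^ A.length * 2 ^ A.length = 4 ^ A.length := by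
    rw [← mul_pow]; norm_num
  -- The loops are treated from the inside out, and each of them removes one condition of agreement
  -- with the guesses: first on `K`, then on `H₁`, finally on `g`.
  have hloopK : ∀ (g : ℕ → ℕ) (H₁ : List ℕ), (∀ a ∈ S, ∀ b ∈ S, g a = g b → a = b) →
      (∀ a ∈ S, (a, g a) ∈ F) → H₁.Sublist (remaining H S g) → H₁.length = A₁.length →
      ∃ y, Runs self (bestOver (subsets (.var (a := .list .nat) (undecided E P B S g))) fun K =>
          .letE (filter (V := Ty.Val) (a := .prod .nat .nat) (fun p => neg (any (a := .nat) (fun x =>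
            and (memPair (.var x) (.fst (.var p)) (.var (a := .pairs) E))
              (memPair (.var x) (.snd (.var p)) (.var (a := .pairs) P)))
              (.var (a := .list .nat) K))) (.var (a := .pairs) F)) fun F' =>
          .letE (.call (restrict (V := Ty.Val) A₁ H₁ E P F' (angered A E P B S g))) fun r₁ =>
          .letE (.call (restrict (V := Ty.Val) A₂ (without (remaining H S g) H₁) E P F'
            (angered A E P B S g))) fun r₂ =>
          .optCase (.var r₁) .none fun u₁ =>
          .optCase (.var r₂) .none fun u₂ =>
          .some (.pair
            (.add (length (.var (a := .list .nat) (enviousIn E P B S g)))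
              (.add (length (.var (a := .list .nat) (angryIn P B S g)))
              (.add (length (filter (a := .nat)
                (fun x => neg (mem (.var x) (.var (a := .list .nat) K)))
                (.var (a := .list .nat) (undecided E P B S g))))
              (.add (.fst (.var u₁)) (.fst (.var u₂))))))
            (append (.var (a := .pairs) (S.map fun a => (a, g a)))
              (append (.snd (.var u₁)) (.snd (.var u₂)))))) y
          (2 ^ A.length * (650 * M ^ 3 + 2 * X)) ∧
        Answers (Witnesses A E P F B) (fun w => ∃ ψ, Admissible A F ψ ∧ listCost A E P B ψ = w ∧
          (∀ a ∈ S, ψ a = g a) ∧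
          H₁ = ((remaining H S g).filter fun x => decide (x ∈ A₁.map ψ))) y := by
    intro g H₁ hinj hF hH₁ hl
    have hRl : (undecided E P B S g).length ≤ A.length :=
      (List.length_filter_le _ _).trans (by omega)
    refine Runs.exists_mono (runs_bestOver (runs_subsets (Runs.varNats _)) fun K hK =>
      runs_innermost hM hw hs hself hbal.1 hbal.2.1 hinj hF hH₁ hl (mem_subsetsOf.1 hK)) ?_ ?_
    · rw [length_subsetsOf]
      have h1 : 2 ^ (undecided E P B S g).length ≤ 2 ^ A.length :=
        Nat.pow_le_pow_right (by norm_num) hRl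
      have h2 : 12 * (undecided E P B S g).length * 2 ^ (undecided E P B S g).length ≤
        12 * M * 2 ^ A.length := by gcongr; exact hRl.trans hlA
      have h3 : 2 ^ (undecided E P B S g).length * (600 * M ^ 3 + 2 * X + 17) ≤
        2 ^ A.length * (600 * M ^ 3 + 2 * X + 17) := by gcongr
      have h4 : M ≤ M ^ 3 := Nat.le_self_pow (by norm_num) M
      calc _ ≤ 2 ^ A.length * 7 + 12 * M ^ 3 * 2 ^ A.length +
            2 ^ A.length * (600 * M ^ 3 + 2 * X + 17) := by nlinarith
        _ = 2 ^ A.length * (612 * M ^ 3 + 24 + 2 * X) := by ring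
        _ ≤ _ := by gcongr; omega
    · refine fun y hy => hy.imp ?_
      rintro w ⟨ψ, hψ, hc, hg, h₁⟩
      exact ⟨_, mem_subsetsOf.2 List.filter_sublist, ψ, hψ, hc, hg, h₁, rfl⟩
  -- The nested sum mirrors the nesting of the program; the term with `H.length ^ S.length` is the
  -- loop over the choices of houses.
  refine Runs.exists_mono (T := 1 + 1 + (1 + 1 + 1 + (1 + 1 + 1 + 1 + (1 + 1 + 1 + 1 + 1 +
    (1 + 1 + 1 + 1 + 1 + 1 + (1 + 1 + 1 + 1 + 1 + 1 + (1 + 2 + A.length * 2 +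
    (250 * M ^ 3 * 3 ^ A.length + (1 + 1 + (1 + 1 + 1 + (1 + 1 + 1 +
    (50 * M ^ 3 * H.length ^ S.length + 2 +
      H.length ^ S.length * (4 ^ A.length * (2000 * M ^ 4 + 2 * X) + 17)) + 1) + 1) + 1) + 1) + 1)
    + 1) + 1) + 1) + 1) + 1) + 1) (Q := AnswersProblem (A, H, E, P, F, B))
    (Runs.exists_letE (u := A) (Runs.fst (Runs.var _)) <|
    Runs.exists_letE (u := H) (Runs.fst (Runs.snd (Runs.var _))) <|
    Runs.exists_letE (u := E) (Runs.fst (Runs.snd (Runs.snd (Runs.var _)))) <|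
    Runs.exists_letE (u := P) (Runs.fst (Runs.snd (Runs.snd (Runs.snd (Runs.var _))))) <|
    Runs.exists_letE (u := F) (Runs.fst (Runs.snd (Runs.snd (Runs.snd (Runs.snd (Runs.var _)))))) <|
    Runs.exists_letE (u := B) (Runs.snd (Runs.snd (Runs.snd (Runs.snd (Runs.snd (Runs.var _)))))) <|
    Runs.exists_ite_false (Runs.congr (runs_isEmpty (Runs.varNats A))
      (by simpa using hA) le_rfl) <|
    Runs.exists_optCase_some (x := (S, A₁, A₂)) (hval ▸ runs_separation hM hlA hw.length_E) <|
    Runs.exists_letE (u := S) (Runs.fst (Runs.varTriple _)) <|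
    Runs.exists_letE (u := A₁) (Runs.fst (Runs.snd (Runs.varTriple _))) <|
    Runs.exists_letE (u := A₂) (Runs.snd (Runs.snd (Runs.varTriple _))) ?_) ?_ fun _ h => h
  · refine Runs.exists_mono (runs_bestOver (sound := Witnesses A E P F B)
      (D := fun φ w => ∃ ψ, Admissible A F ψ ∧ listCost A E P B ψ = w ∧
        φ = S.map (fun a => (a, ψ a))) (c := 4 ^ A.length * (2000 * M ^ 4 + 2 * X))
      (runs_choices hM hSM hw.length_F hw.nodup_feas hw.feas_houses (by omega)) ?_) ?_ ?_
    · intro φ hφ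
      obtain ⟨g, rfl, hF, hinj⟩ := exists_of_mem_choicesOf hs.nodup_S hφ
      have hH₀M : (remaining H S g).length ≤ M := (List.length_filter_le _ _).trans hHM
      have hH₀A : (remaining H S g).length ≤ A.length := (List.length_filter_le _ _).trans hlH.le
      refine Runs.exists_mono (T := 41 * M ^ 3 + (150 * M ^ 4 + (60 * M ^ 3 + (50 * M ^ 2 +
        (120 * M ^ 4 + (30 * M ^ 2 + 4 ^ A.length * (800 * M ^ 3 + 2 * X) + 1) + 1) + 1) + 1) + 1)
        + 1)
        (Runs.exists_letE (runs_satisfied hM hw.length_P hSM) <|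
        Runs.exists_letE (runs_enviousIn hM hw.length_E hw.length_P hw.length_B hSM) <|
        Runs.exists_letE (runs_angryIn hM hw.length_P hw.length_B hSM) <|
        Runs.exists_letE (runs_undecided hM hSM) <|
        Runs.exists_letE (runs_angered hM hlA hw.length_E hw.length_P hw.length_B hSM) <|
        Runs.exists_letE (runs_remaining hM hHM hSM) ?_) ?_ fun _ h => h
      · refine Runs.exists_mono (runs_bestOver (sound := Witnesses A E P F B)
          (D := fun H₁ w => ∃ ψ, Admissible A F ψ ∧ listCost A E P B ψ = w ∧
            (∀ a ∈ S, ψ a = g a) ∧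
            H₁ = ((remaining H S g).filter fun x => decide (x ∈ A₁.map ψ)))
          (c := 20 * M ^ 2 + 2 ^ A.length * (650 * M ^ 3 + 2 * X) + 1)
          (v := (subsetsOf (remaining H S g)).filter fun X : List ℕ => decide (X.length = A₁.length))
          (runs_filter (c := 10 + 8 * M) (runs_subsets (Runs.varNats _)) fun Y hY => Runs.mono
            (Runs.eq (runs_length (Runs.varNats _)) (runs_length (Runs.varNats _))) ?_) ?_) ?_ ?_
        · have := (mem_subsetsOf.1 hY).length_le
          omega
        · intro H₁ hH₁
          rw [List.mem_filter, mem_subsetsOf, decide_eq_true_eq] at hH₁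
          exact Runs.exists_letE (runs_without hM hH₀M (hH₁.1.length_le.trans hH₀M))
            (hloopK g H₁ hinj hF hH₁.1 hH₁.2)
        · have h1 : ((subsetsOf (remaining H S g)).filter
              fun X : List ℕ => decide (X.length = A₁.length)).length ≤ 2 ^ A.length := by
            refine (List.length_filter_le _ _).trans ?_
            rw [length_subsetsOf]
            exact Nat.pow_le_pow_right (by norm_num) hH₀A
          have h2 : 12 * (remaining H S g).length * 2 ^ (remaining H S g).length ≤
              12 * M * 2 ^ A.length := by gcongr; norm_num
          have h3 : (subsetsOf (remaining H S g)).length * (10 + 8 * M + 5) ≤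
              2 ^ A.length * (10 + 8 * M + 5) := by
            rw [length_subsetsOf]; gcongr; norm_num
          refine (Nat.add_le_add (Nat.add_le_add_right (Nat.add_le_add (Nat.add_le_add_right
            (Nat.add_le_add_left h2 _) _) h3) _) (Nat.mul_le_mul_right _ h1)).trans ?_
          have h5 : 1 ≤ M ^ 3 := Nat.one_le_pow _ _ hM
          have h6 : M ≤ M ^ 3 := Nat.le_self_pow (by norm_num) M
          have h7 : M ^ 2 ≤ M ^ 3 := Nat.pow_le_pow_right hM (by norm_num)
          rw [← h4k]
          generalize 2 ^ A.length = k at *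
          calc _ ≤ k * 9 + 12 * M ^ 3 * k + k * (15 + 8 * M ^ 3) +
                k * (20 * M ^ 3 + k * (650 * M ^ 3 + 2 * X) + 18) := by nlinarith
            _ = k * (40 * M ^ 3 + 42) + k * k * (650 * M ^ 3 + 2 * X) := by ring
            _ ≤ k * (k * (82 * M ^ 3)) + k * k * (650 * M ^ 3 + 2 * X) := by
              gcongr
              nlinarith
            _ = k * k * (732 * M ^ 3 + 2 * X) := by ring
            _ ≤ _ := by gcongr; omega
        · refine fun y hy => hy.imp ?_
          rintro w ⟨ψ, hψ, hc, hg⟩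
          rw [List.map_inj_left] at hg
          have hg : ∀ a ∈ S, ψ a = g a := fun a ha => ((Prod.ext_iff.1 (hg a ha)).2).symm
          refine ⟨_, ?_, ψ, hψ, hc, hg, rfl⟩
          rw [List.mem_filter, mem_subsetsOf, decide_eq_true_eq]
          exact ⟨List.filter_sublist,
            hs.length_filter_remaining hψ hw.feas_houses hw.nodup_houses hg⟩
      · have h4 : 1 ≤ 4 ^ A.length := Nat.one_le_pow _ _ (by norm_num)
        have h5 : 1 ≤ M ^ 4 := Nat.one_le_pow _ _ hM
        have h6 : M ^ 3 ≤ M ^ 4 := Nat.pow_le_pow_right hM (by norm_num)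
        have h7 : M ^ 2 ≤ M ^ 4 := Nat.pow_le_pow_right hM (by norm_num)
        generalize 4 ^ A.length = k at *
        calc _ ≤ 457 * M ^ 4 + k * (800 * M ^ 4 + 2 * X) := by nlinarith
          _ ≤ k * (457 * M ^ 4) + k * (800 * M ^ 4 + 2 * X) 
              := Nat.add_le_add_right (Nat.le_mul_of_pos_left _ h4) _
          _ = k * (1257 * M ^ 4 + 2 * X) := by ring
          _ ≤ _ := by gcongr; omega
    · gcongr
      exact length_choicesOf_le hw.nodup_feas hw.feas_houses
    · refine fun y hy => hy.imp ?_
      rintro w ⟨ψ, hψ, hc⟩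
      -- The choice that covers `ψ` is its own restriction to `S`.
      have hSA : ∀ a ∈ S, a ∈ A := fun a ha => (hs.mem_iff a).2 (Or.inl ha)
      exact ⟨_, map_mem_choicesOf hs.nodup_S (fun a ha => hψ.feas a (hSA a ha))
        fun a ha b hb => hψ.inj a (hSA a ha) b (hSA b hb), ψ, hψ, hc, rfl⟩
  · rw [hlH]
    have h1 : A.length ^ S.length ≤ A.length ^ s := Nat.pow_le_pow_right hpos hSs
    have h2 : 1 ≤ A.length ^ s := Nat.one_le_pow _ _ hpos
    have h3 : 3 ^ A.length ≤ 4 ^ A.length := Nat.pow_le_pow_left (by norm_num) _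
    have h4 : 1 ≤ 4 ^ A.length := Nat.one_le_pow _ _ (by norm_num)
    have h5 : 1 ≤ M ^ 4 := Nat.one_le_pow _ _ hM
    have h6 : M ^ 3 ≤ M ^ 4 := Nat.pow_le_pow_right hM (by norm_num)
    have h7 : A.length ≤ M ^ 4 := hlA.trans (Nat.le_self_pow (by norm_num) M)
    generalize A.length ^ S.length = p at *
    generalize A.length ^ s = p' at *
    generalize 4 ^ A.length = k at *
    generalize 3 ^ A.length = k' at *
    calc _ ≤ 52 * M ^ 4 + 250 * M ^ 4 * k + (50 * M ^ 4 * p' +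
          p' * (k * (2000 * M ^ 4 + 2 * X) + 17)) := by
            have e1 : 250 * M ^ 3 * k' ≤ 250 * M ^ 4 * k := by gcongr
            have e2 : 50 * M ^ 3 * p ≤ 50 * M ^ 4 * p' := by gcongr
            have e3 : p * (k * (2000 * M ^ 4 + 2 * X) + 17) ≤
              p' * (k * (2000 * M ^ 4 + 2 * X) + 17) := by gcongr
            omega
      _ ≤ 52 * (M ^ 4 * p' * k) + 250 * (M ^ 4 * p' * k) + (50 * (M ^ 4 * p' * k) +
          (p' * k * (2000 * M ^ 4 + 2 * X) + 17 * (M ^ 4 * p' * k))) := by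
            have e1 : M ^ 4 ≤ M ^ 4 * p' := Nat.le_mul_of_pos_right _ h2
            have e2 : M ^ 4 * p' ≤ M ^ 4 * p' * k := Nat.le_mul_of_pos_right _ h4
            have e3 : M ^ 4 * k ≤ M ^ 4 * p' * k := by gcongr
            have e4 : p' ≤ M ^ 4 * p' := Nat.le_mul_of_pos_left _ h5
            have e5 : p' * (k * (2000 * M ^ 4 + 2 * X) + 17) =
              p' * k * (2000 * M ^ 4 + 2 * X) + 17 * p' := by ring
            rw [e5, mul_assoc 250, mul_assoc 50]
            omega
      _ = p' * k * (2369 * M ^ 4 + 2 * X) := by ring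
      _ ≤ _ := by gcongr; omega

end Code

/-! ### The recursion -/

/-- Every set of agents has a balanced separation whose separator has size `s`, where `k ^ s` is at
most `exp (c * k + L)` for sets of size `k`. -/
def HasSeparators (n : ℕ) (G : ℕ → ℕ → Prop) (c L : ℝ) : Prop :=
  ∀ A : List ℕ, A.Nodup → (∀ a ∈ A, a < n) → ∃ χ : ℕ → Fin 3,
    3 * (A.filter (χ · = 1)).length ≤ 2 * A.length ∧
    3 * (A.filter (χ · = 2)).length ≤ 2 * A.length ∧
    (∀ u ∈ A, ∀ v ∈ A, χ u = 1 → χ v = 2 → ¬ G u v) ∧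
    ((A.filter (χ · = 0)).length : ℝ) * Real.log A.length ≤ c * A.length + L

/-- The exponent in the bound on the number of steps for `x` agents. -/
noncomputable def exponent (c L x : ℝ) : ℝ :=
  3 * (c + 5) * x + L / Real.log (3 / 2) * Real.log x

theorem log_three_halves_pos : 0 < Real.log (3 / 2) := Real.log_pos (by norm_num)

theorem exponent_nonneg {c L : ℝ} (hc : 0 ≤ c) (hL : 0 ≤ L) (k : ℕ) : 0 ≤ exponent c L k := by
  have := log_three_halves_pos
  have := Real.log_natCast_nonneg k
  unfold exponent
  positivity

/-- Take for `Y` the exponent at `2 k / 3`. Passing from `k` to `2 k / 3` lowers the linear term by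
`(c + 5) k` and the logarithmic one by `L`, which pays for `s log k + 5 k`. For `k = 1` the
logarithm at `2 / 3` would be negative; but then only `j = 0` remains, and `Y = 0` works. -/
theorem exists_exponent_step {c L : ℝ} (hc : 0 ≤ c) (hL : 0 ≤ L) {k s : ℕ} (hk : 1 ≤ k)
    (hs : (s : ℝ) * Real.log k ≤ c * k + L) :
    ∃ Y, 0 ≤ Y ∧ (∀ j : ℕ, 3 * j ≤ 2 * k → exponent c L j ≤ Y) ∧
      s * Real.log k + 5 * k + Y ≤ exponent c L k := by
  have hl := log_three_halves_pos
  rcases Nat.eq_or_lt_of_le hk with rfl | hk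
  · refine ⟨0, le_rfl, fun j hj => ?_, ?_⟩
    · obtain rfl : j = 0 := by omega
      simp [exponent]
    · simp only [exponent, Nat.cast_one, Real.log_one]
      linarith
  · have hk2 : (2 : ℝ) ≤ k := by exact_mod_cast hk
    have hγ : 0 ≤ L / Real.log (3 / 2) := by positivity
    have h1 : (1 : ℝ) ≤ 2 * k / 3 := by linarith
    have hlog := Real.log_nonneg h1
    refine ⟨exponent c L (2 * k / 3), by unfold exponent; positivity, fun j hj => ?_, ?_⟩
    · have hj' : (j : ℝ) ≤ 2 * k / 3 := by
        have : (3 * j : ℝ) ≤ 2 * k := by exact_mod_cast hj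
        linarith
      have hlj : Real.log j ≤ Real.log (2 * k / 3) := by
        -- For `j = 0` the convention `Real.log 0 = 0` is harmless, because `2 k / 3 ≥ 1`.
        rcases Nat.eq_zero_or_pos j with rfl | hj0
        · simpa using hlog
        · exact Real.log_le_log (by exact_mod_cast hj0) hj'
      unfold exponent
      gcongr
    · have h2 : Real.log (2 * k / 3) = Real.log k - Real.log (3 / 2) := by
        rw [← Real.log_div (by positivity) (by norm_num)]
        congr 1
        ring
      have h3 : L / Real.log (3 / 2) * (Real.log k - Real.log (3 / 2)) =
          L / Real.log (3 / 2) * Real.log k - L := by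
        field_simp
      unfold exponent
      rw [h2, h3]
      linarith

namespace Code

variable {self : Ty.Val .input → Option (Ty.Val .output × ℕ)} {A H : List ℕ}
  {E P F : List (ℕ × ℕ)} {B : List ℕ} {n M : ℕ} {G : ℕ → ℕ → Prop}

theorem runs_ohaanr_nil :
    ∃ r, Runs self (ohaanr (V := Ty.Val) ([], H, E, P, F, B)) r 100 ∧
      AnswersProblem ([], H, E, P, F, B) r := by
  refine ⟨some (0, []), Runs.mono
    (Runs.letE (u := []) (Runs.fst (Runs.var _)) <|
    Runs.letE (u := H) (Runs.fst (Runs.snd (Runs.var _))) <|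
    Runs.letE (u := E) (Runs.fst (Runs.snd (Runs.snd (Runs.var _)))) <|
    Runs.letE (u := P) (Runs.fst (Runs.snd (Runs.snd (Runs.snd (Runs.var _))))) <|
    Runs.letE (u := F) (Runs.fst (Runs.snd (Runs.snd (Runs.snd (Runs.snd (Runs.var _)))))) <|
    Runs.letE (u := B) (Runs.snd (Runs.snd (Runs.snd (Runs.snd (Runs.snd (Runs.var _)))))) <|
    Runs.ite (p := true) (w := Option.none) (runs_isEmpty (Runs.varNats []))
      (fun _ => Runs.some (Runs.pair (Runs.lit 0) Runs.nil)) fun h => by cases h) (by simp), ?_, ?_⟩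
  · intro u hu
    cases hu
    exact ⟨id, ⟨by simp, by simp⟩, by simp [listCost], by simp, rfl⟩
  · exact fun w _ => ⟨_, rfl, Nat.zero_le _⟩

end Code

/-- Edges of a subinstance belong to the fixed relation `G`, so separators of `G` on the set `A`
serve all subinstances with these agents. -/
theorem exists_mem_partitionsOf {A H : List ℕ} {E P F : List (ℕ × ℕ)} {B : List ℕ} {n M : ℕ}
    {G : ℕ → ℕ → Prop} {c L : ℝ} (hsep : HasSeparators n G c L)
    (hw : WellFormed n M G A H E P F B) :
    ∃ t ∈ partitionsOf A, Balanced A E t ∧ (t.1.length : ℝ) * Real.log A.length ≤ c * A.length + L := by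
  obtain ⟨χ, h1, h2, h3, h4⟩ := hsep A hw.nodup_agents hw.agents_lt
  refine ⟨_, filter_mem_partitionsOf χ A, ⟨h1, h2, fun u hu v hv huv => ?_⟩, h4⟩
  simp only [List.mem_filter, decide_eq_true_eq] at hu hv
  exact h3 u hu.1 v hv.1 hu.2 hv.2 (hw.edges u v huv)

/-- The recursive procedure answers the annotated problem, within an exponential number of steps. -/
theorem procEval_spec {n M : ℕ} {G : ℕ → ℕ → Prop} {c L : ℝ} (hc : 0 ≤ c) (hL : 0 ≤ L)
    (hM : 1 ≤ M) (hsep : HasSeparators n G c L) (k : ℕ) :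
    ∀ A H E P F B, WellFormed n M G A H E P F B → A.length = k → ∀ d, k < d →
      ∃ r t, separatorAlgorithm.procEval d (A, H, E, P, F, B) = some (r, t) ∧
        (t : ℝ) ≤ 3000 * (M : ℝ) ^ 4 * Real.exp (exponent c L k) ∧
        AnswersProblem (A, H, E, P, F, B) r := by
  induction k using Nat.strong_induction_on with
  | _ k ih =>
  intro A H E P F B hw hk d hd
  obtain ⟨d, rfl⟩ : ∃ e, d = e + 1 := ⟨d - 1, by omega⟩
  have hM1 : (1 : ℝ) ≤ M := by exact_mod_cast hM
  have hM4 : (1 : ℝ) ≤ (M : ℝ) ^ 4 := one_le_pow₀ hM1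
  rcases eq_or_ne A [] with rfl | hA
  · obtain ⟨r, ⟨t, h1, h2⟩, h3⟩ := Code.runs_ohaanr_nil (self := separatorAlgorithm.procEval d)
      (H := H) (E := E) (P := P) (F := F) (B := B)
    refine ⟨r, t, h1, ?_, h3⟩
    have h4 : (1 : ℝ) ≤ Real.exp (exponent c L k) := Real.one_le_exp (exponent_nonneg hc hL k)
    have h5 : (t : ℝ) ≤ 100 := by exact_mod_cast h2
    nlinarith
  · obtain ⟨t₀, ht₀, hb₀, hs₀⟩ := exists_mem_partitionsOf hsep hw
    have hk1 : 1 ≤ k := hk ▸ List.length_pos_iff.2 hA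
    rw [hk] at hs₀
    obtain ⟨Y, hY0, hY, hstep⟩ := exists_exponent_step hc hL hk1 hs₀
    -- The recursive calls have fewer agents, because `3 * |A'| ≤ 2 * k` and `k ≥ 1`; so depth `d >
    -- k - 1` suffices for them. The floor is needed because step bounds are natural numbers.
    have hself : Code.CallsAnswered (separatorAlgorithm.procEval d) n M G A
        ⌊3000 * (M : ℝ) ^ 4 * Real.exp Y⌋₊ := by
      intro A' H' E' P' F' B' hw' hA'
      rw [hk] at hA'
      obtain ⟨r, t, h1, h2, h3⟩ := ih A'.length (by omega) A' H' E' P' F' B' hw' rfl d (by omega)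
      refine ⟨r, t, h1, Nat.le_floor (h2.trans ?_), h3⟩
      gcongr
      exact hY _ hA'
    obtain ⟨r, ⟨t, h1, h2⟩, h3⟩ := Code.runs_ohaanr hM hw hA ⟨t₀, ht₀, hb₀, le_rfl⟩ hself
    refine ⟨r, t, h1, ?_, h3⟩
    rw [hk] at h2
    have h4 : (⌊3000 * (M : ℝ) ^ 4 * Real.exp Y⌋₊ : ℝ) ≤ 3000 * (M : ℝ) ^ 4 * Real.exp Y :=
      Nat.floor_le (by positivity)
    have h5 : (t : ℝ) ≤ (k : ℝ) ^ t₀.1.length * 4 ^ k * (3000 * (M : ℝ) ^ 4 +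
        2 * (⌊3000 * (M : ℝ) ^ 4 * Real.exp Y⌋₊ : ℝ)) := by exact_mod_cast h2
    have h6 : (k : ℝ) ^ t₀.1.length = Real.exp (t₀.1.length * Real.log k) := by
      rw [mul_comm, Real.exp_mul, Real.exp_log (by exact_mod_cast hk1), Real.rpow_natCast]
    -- The factor `4 ^ k` of the loops and the factor `3` (own work and two calls) are each bounded
    -- by `exp (2 k)`, which fits into the `5 k` of `exists_exponent_step`.
    have he : (4 : ℝ) ≤ Real.exp 2 := by
      have := Real.add_one_le_exp (1 : ℝ)
      have h : Real.exp 2 = Real.exp 1 * Real.exp 1 := by rw [← Real.exp_add]; norm_num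
      nlinarith
    have h7 : (4 : ℝ) ^ k ≤ Real.exp (2 * k) := by
      rw [Real.exp_mul, Real.rpow_natCast]
      gcongr
    have h8 : (3 : ℝ) ≤ Real.exp (2 * k) := by
      refine (by linarith : (3 : ℝ) ≤ Real.exp 2).trans (Real.exp_le_exp.2 ?_)
      have : (1 : ℝ) ≤ k := by exact_mod_cast hk1
      linarith
    have h9 : (1 : ℝ) ≤ Real.exp Y := Real.one_le_exp hY0
    calc (t : ℝ) ≤ _ := h5
      _ ≤ Real.exp (t₀.1.length * Real.log k) * Real.exp (2 * k) *
          (3000 * (M : ℝ) ^ 4 * Real.exp Y + 2 * (3000 * (M : ℝ) ^ 4 * Real.exp Y)) := by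
        rw [h6]
        refine mul_le_mul (mul_le_mul_of_nonneg_left h7 (by positivity)) (add_le_add ?_
          (mul_le_mul_of_nonneg_left h4 (by norm_num))) (by positivity) (by positivity)
        exact le_mul_of_one_le_right (by positivity) h9
      _ = 3000 * (M : ℝ) ^ 4 * (Real.exp (t₀.1.length * Real.log k) * Real.exp (2 * k) *
          3 * Real.exp Y) := by ring
      _ ≤ 3000 * (M : ℝ) ^ 4 * (Real.exp (t₀.1.length * Real.log k) * Real.exp (2 * k) *
          Real.exp (2 * k) * Real.exp Y) := by gcongr
      _ ≤ _ := by
        rw [← Real.exp_add, ← Real.exp_add, ← Real.exp_add]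
        gcongr
        have : (0 : ℝ) ≤ k := by positivity
        linarith

/-! ### The recursion depth -/

/-- An evaluation that succeeds has used only calls that succeeded, so extending the procedure
changes neither its value nor its number of steps. Hence one sufficient recursion depth settles all
larger ones. -/
theorem eval_mono {σ τ : Ty} {self self' : σ.Val → Option (τ.Val × ℕ)}
    (h : ∀ x v, self x = Option.some v → self' x = Option.some v) {a : Ty} (e : Expr σ τ Ty.Val a) :
    ∀ v, e.eval self = Option.some v → e.eval self' = Option.some v := by
  induction e with
  | var | tt | ff | lit | nil | none => exact fun v hv => hv
  | add x y hx hy | eq x y hx hy | le x y hx hy | pair x y hx hy | cons x y hx hy =>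
    intro v hv
    simp only [Expr.eval, Option.bind_eq_bind, Option.bind_eq_some_iff] at hv ⊢
    obtain ⟨u, h1, w, h2, h3⟩ := hv
    exact ⟨u, hx u h1, w, hy w h2, h3⟩
  | fst x hx | snd x hx | some x hx =>
    intro v hv
    simp only [Expr.eval, Option.bind_eq_bind, Option.bind_eq_some_iff] at hv ⊢
    obtain ⟨u, h1, h3⟩ := hv
    exact ⟨u, hx u h1, h3⟩
  | letE x f hx hf =>
    intro v hv
    simp only [Expr.eval, Option.bind_eq_bind, Option.bind_eq_some_iff] at hv ⊢
    obtain ⟨u, h1, w, h2, h3⟩ := hv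
    exact ⟨u, hx u h1, w, hf _ w h2, h3⟩
  | call x hx =>
    intro v hv
    simp only [Expr.eval, Option.bind_eq_bind, Option.bind_eq_some_iff] at hv ⊢
    obtain ⟨u, h1, w, h2, h3⟩ := hv
    exact ⟨u, hx u h1, w, h _ w h2, h3⟩
  | ite c t e hc ht he =>
    intro v hv
    simp only [Expr.eval, Option.bind_eq_bind, Option.bind_eq_some_iff] at hv ⊢
    obtain ⟨⟨b, k⟩, h1, h2⟩ := hv
    refine ⟨⟨b, k⟩, hc _ h1, ?_⟩
    cases b <;> simp only [Option.bind_eq_some_iff] at h2 ⊢ <;> obtain ⟨w, h3, h4⟩ := h2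
    · exact ⟨w, he w h3, h4⟩
    · exact ⟨w, ht w h3, h4⟩
  | optCase o e f ho he hf =>
    intro v hv
    simp only [Expr.eval, Option.bind_eq_bind, Option.bind_eq_some_iff] at hv ⊢
    obtain ⟨⟨b, k⟩, h1, h2⟩ := hv
    refine ⟨⟨b, k⟩, ho _ h1, ?_⟩
    cases b <;> simp only [Option.bind_eq_some_iff] at h2 ⊢ <;> obtain ⟨w, h3, h4⟩ := h2
    · exact ⟨w, he w h3, h4⟩
    · exact ⟨w, hf _ w h3, h4⟩
  | foldr f e l hf he hl =>
    intro v hv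
    simp only [Expr.eval, Option.bind_eq_bind, Option.bind_eq_some_iff] at hv ⊢
    obtain ⟨⟨u, j⟩, h1, ⟨z, k⟩, h2, h3⟩ := hv
    refine ⟨_, hl _ h1, _, he _ h2, ?_⟩
    clear h1
    -- The loop is followed along the list; the accumulated result changes from one iteration to the
    -- next.
    induction u generalizing v with
    | nil => exact h3
    | cons x u ih =>
      rw [List.foldr_cons, Option.bind_eq_some_iff] at h3 ⊢
      obtain ⟨⟨y, s⟩, h4, h5⟩ := h3
      refine ⟨_, ih _ h4, ?_⟩
      simp only [Option.bind_eq_some_iff] at h5 ⊢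
      obtain ⟨w, h6, h7⟩ := h5
      exact ⟨w, hf _ _ _ h6, h7⟩

theorem Program.procEval_mono {σ τ : Ty} (P : Program σ τ) {d e : ℕ} (hde : d ≤ e) :
    ∀ x v, P.procEval d x = Option.some v → P.procEval e x = Option.some v := by
  induction d generalizing e with
  | zero => intro x v hv; cases hv
  | succ d ih =>
    obtain ⟨e, rfl⟩ : ∃ e', e = e' + 1 := ⟨e - 1, by omega⟩
    exact fun x v hv => eval_mono (ih (by omega)) _ v hv

/-! ### The main routine -/

/-- Houses that `ψ` does not use play no role in its cost. -/
theorem listCost_restrict {A H : List ℕ} {E P : List (ℕ × ℕ)} {B : List ℕ} {ψ : ℕ → ℕ}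
    (hψ : ∀ a ∈ A, ψ a ∈ H) :
    listCost A (pairsWithin E A A) (pairsWithin P A H) (A.filter fun x => decide (x ∈ B)) ψ =
      listCost A E P B ψ := by
  refine List.countP_congr fun a ha => ?_
  simp only [decide_eq_true_eq, Unhappy, mem_pairsWithin, ha, true_and, hψ a ha, and_true,
    List.mem_filter]
  refine and_congr_right fun _ => or_congr_right (exists_congr fun b => and_congr_right fun hb => ?_)
  simp only [hb, and_true, hψ b hb]

namespace Code

variable {self : Ty.Val .input → Option (Ty.Val .output × ℕ)} {A H : List ℕ}
  {E P F : List (ℕ × ℕ)} {B : List ℕ} {n M X : ℕ} {G : ℕ → ℕ → Prop}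

/-- An allocation is covered by the iteration in which `H'` is its image. Answers of the restricted
instance are answers of the full one, with the same cost. -/
theorem runs_guessHouses (hM : 1 ≤ M) (hA : A.Nodup) (hH : H.Nodup) (hF : F.Nodup)
    (hFH : ∀ p ∈ F, p.2 ∈ H)
    (symm : ∀ u v, (u, v) ∈ E → (v, u) ∈ E) (agents_lt : ∀ a ∈ A, a < n)
    (edges : ∀ u v, (u, v) ∈ E → G u v) (hAM : A.length ≤ M) (hHM : H.length ≤ M)
    (hEM : E.length ≤ M) (hPM : P.length ≤ M) (hFM : F.length ≤ M) (hBM : B.length ≤ M)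
    (hself : ∀ H' E' P' F' B', WellFormed n M G A H' E' P' F' B' →
      ∃ r t, self (A, H', E', P', F', B') = some (r, t) ∧ t ≤ X ∧
        AnswersProblem (A, H', E', P', F', B') r) :
    ∃ r, Runs self (guessHouses (V := Ty.Val) (A, H, E, P, F, B)) r
      (2 ^ H.length * (400 * M ^ 2 + X)) ∧ AnswersProblem (A, H, E, P, F, B) r := by
  refine Runs.exists_mono (T := 1 + 1 + (1 + 1 + 1 + (1 + 1 + 1 + 1 + (1 + 1 + 1 + 1 + 1 +
    (1 + 1 + 1 + 1 + 1 + 1 + (1 + 1 + 1 + 1 + 1 + 1 +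
    (2 ^ H.length * (32 * M + 23) + 2 + 2 ^ H.length * (180 * M ^ 2 + X + 1 + 17))
    + 1) + 1) + 1) + 1) + 1) + 1) (Q := AnswersProblem (A, H, E, P, F, B))
    (Runs.exists_letE (u := A) (Runs.fst (Runs.var _)) <|
    Runs.exists_letE (u := H) (Runs.fst (Runs.snd (Runs.var _))) <|
    Runs.exists_letE (u := E) (Runs.fst (Runs.snd (Runs.snd (Runs.var _)))) <|
    Runs.exists_letE (u := P) (Runs.fst (Runs.snd (Runs.snd (Runs.snd (Runs.var _))))) <|
    Runs.exists_letE (u := F) (Runs.fst (Runs.snd (Runs.snd (Runs.snd (Runs.snd (Runs.var _)))))) <|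
    Runs.exists_letE (u := B) (Runs.snd (Runs.snd (Runs.snd (Runs.snd (Runs.snd (Runs.var _))))))
    ?_) ?_ fun _ h => h
  · refine Runs.exists_mono (runs_bestOver (sound := Witnesses A E P F B)
      (D := fun H' w => ∃ ψ, Admissible A F ψ ∧ listCost A E P B ψ = w ∧
        H' = H.filter fun x => decide (x ∈ A.map ψ)) (c := 180 * M ^ 2 + X + 1)
      (v := (subsetsOf H).filter fun X : List ℕ => decide (X.length = A.length))
      (T := 2 ^ H.length * (32 * M + 23))
      (Runs.mono (runs_filter (c := 10 + 8 * M) (runs_subsets (Runs.varNats _)) fun Y hY => Runs.mono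
        (Runs.eq (runs_length (Runs.varNats _)) (runs_length (Runs.varNats _))) ?_) ?_) ?_) ?_ ?_
    · have := (mem_subsetsOf.1 hY).length_le
      omega
    · rw [length_subsetsOf]
      have h : 1 ≤ 2 ^ H.length := Nat.one_le_two_pow
      have h2 : 12 * H.length * 2 ^ H.length ≤ 12 * M * 2 ^ H.length := by gcongr
      nlinarith
    · intro H' hH'
      rw [List.mem_filter, mem_subsetsOf, decide_eq_true_eq] at hH'
      have hl := hH'.1.length_le
      obtain ⟨r, t, h1, h2, h3⟩ := hself _ _ _ _ _ (WellFormed.restrict (B' := B) (P := P) symm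
        agents_lt edges hEM hPM hFM hA hAM (hH'.1.nodup hH) hH'.2 hF)
      refine ⟨r, Runs.call (runs_restrict hM hAM (hl.trans hHM) hEM hPM hFM (by omega))
        ⟨t, h1, h2⟩, fun u hu => ?_, fun w => ?_⟩
      · obtain ⟨ψ, h4, h5, h6, h7⟩ := h3.1 u hu
        have hψ : ∀ a ∈ A, ψ a ∈ H' := fun a ha => (mem_pairsWithin.1 (h4.feas a ha)).2.2
        refine ⟨ψ, ⟨h4.inj, fun a ha => (mem_pairsWithin.1 (h4.feas a ha)).1⟩, ?_, h6, h7⟩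
        rw [← listCost_restrict hψ]
        exact h5
      · rintro ⟨ψ, h4, rfl, h5⟩
        have hψ : ∀ a ∈ A, ψ a ∈ H' := fun a ha => by
          rw [h5, List.mem_filter, decide_eq_true_eq]
          exact ⟨hFH _ (h4.feas a ha), List.mem_map_of_mem ha⟩
        refine h3.2 _ ⟨ψ, ⟨h4.inj, fun a ha => mem_pairsWithin.2 ⟨h4.feas a ha, ha, hψ a ha⟩⟩, ?_⟩
        exact listCost_restrict hψ
    · gcongr
      exact (List.length_filter_le _ _).trans (length_subsetsOf H).le
    · refine fun y hy => hy.imp ?_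
      rintro w ⟨ψ, hψ, hc⟩
      refine ⟨_, ?_, ψ, hψ, hc, rfl⟩
      rw [List.mem_filter, mem_subsetsOf, decide_eq_true_eq]
      refine ⟨List.filter_sublist, ?_⟩
      -- The image of `ψ` has `|A|` elements: this is the earlier count for the trivial separation
      -- with empty separator.
      have hs : Separates A E [] A [] := ⟨hA, by simp, symm, by simp⟩
      have hr : remaining H [] ψ = H := by simp [remaining]
      have := hs.length_filter_remaining (g := ψ) hψ hFH hH (by simp)
      rwa [hr] at this
  · have h : 1 ≤ 2 ^ H.length := Nat.one_le_two_pow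
    generalize 2 ^ H.length = p at *
    have h2 : 1 ≤ M ^ 2 := Nat.one_le_pow _ _ hM
    have h3 : M ≤ M ^ 2 := Nat.le_self_pow (by norm_num) M
    calc _ ≤ p * 50 + p * (32 * M ^ 2 + 23) + p * (180 * M ^ 2 + X + 18) := by nlinarith
      _ = p * (212 * M ^ 2 + 91 + X) := by ring
      _ ≤ _ := by gcongr; omega

end Code

/-! ### Instances and their encodings -/

section Encoding

variable {n m : ℕ} (I : AnnotatedNetwork n m)

theorem mem_encode_edges {u v : ℕ} : (u, v) ∈ I.encode.2.2.1 ↔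
    ∃ a b : Fin n, I.graph.Adj a b ∧ (a : ℕ) = u ∧ (b : ℕ) = v := by
  simp [AnnotatedNetwork.encode]

theorem mem_encode_pref {u v : ℕ} : (u, v) ∈ I.encode.2.2.2.1 ↔
    ∃ (a : Fin n) (b : Fin m), b ∈ I.pref a ∧ (a : ℕ) = u ∧ (b : ℕ) = v := by
  simp [AnnotatedNetwork.encode]

theorem mem_encode_feas {u v : ℕ} : (u, v) ∈ I.encode.2.2.2.2.1 ↔
    ∃ (a : Fin n) (b : Fin m), b ∈ I.feas a ∧ (a : ℕ) = u ∧ (b : ℕ) = v := by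
  simp [AnnotatedNetwork.encode]

theorem mem_encode_angry {u : ℕ} : u ∈ I.encode.2.2.2.2.2 ↔
    ∃ a : Fin n, a ∈ I.angry ∧ (a : ℕ) = u := by
  simp [AnnotatedNetwork.encode, eq_comm]

theorem countP_range_eq_ncard (n : ℕ) (p : ℕ → Bool) :
    (List.range n).countP p = {a : Fin n | p a = true}.ncard := by
  rw [← List.map_coe_finRange_eq_range, List.countP_map, List.countP_eq_length_filter,
    Set.ncard_eq_toFinset_card', ← List.toFinset_card_of_nodup ((List.nodup_finRange n).filter _)]
  congr 1
  ext a
  simp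

/-- The two sets counted by `cost` are disjoint, since one consists of angry agents and the other of
agents that are not, and their union is the set of unhappy agents. -/
theorem listCost_encode {ψ : ℕ → ℕ} {φ : Fin n → Fin m} (h : ∀ a : Fin n, ψ a = φ a) :
    listCost I.encode.1 I.encode.2.2.1 I.encode.2.2.2.1 I.encode.2.2.2.2.2 ψ = I.cost φ := by
  have hP : ∀ (a : Fin n) (b : Fin m), ((a : ℕ), (b : ℕ)) ∈ I.encode.2.2.2.1 ↔ b ∈ I.pref a := by
    intro a b
    rw [mem_encode_pref]
    constructor
    · rintro ⟨a', b', h1, h2, h3⟩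
      rwa [← Fin.ext h2, ← Fin.ext h3]
    · exact fun h => ⟨a, b, h, rfl, rfl⟩
  have hB : ∀ a : Fin n, (a : ℕ) ∈ I.encode.2.2.2.2.2 ↔ a ∈ I.angry := by
    intro a
    rw [mem_encode_angry]
    constructor
    · rintro ⟨a', h1, h2⟩
      rwa [← Fin.ext h2]
    · exact fun h => ⟨a, h, rfl⟩
  have hE : ∀ a : Fin n, (∃ b ∈ I.encode.1, ((a : ℕ), b) ∈ I.encode.2.2.1 ∧
      ((a : ℕ), ψ b) ∈ I.encode.2.2.2.1) ↔ ∃ b, I.graph.Adj a b ∧ φ b ∈ I.pref a := by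
    intro a
    constructor
    · rintro ⟨b, -, hab, hb⟩
      obtain ⟨a', b', h1, h2, rfl⟩ := (mem_encode_edges I).1 hab
      rw [Fin.ext h2] at h1
      rw [h, hP] at hb
      exact ⟨b', h1, hb⟩
    · rintro ⟨b, hab, hb⟩
      refine ⟨b, List.mem_range.2 b.2, (mem_encode_edges I).2 ⟨a, b, hab, rfl, rfl⟩, ?_⟩
      rw [h, hP]
      exact hb
  rw [AnnotatedNetwork.cost, ← Set.ncard_union_eq]
  · refine (countP_range_eq_ncard n _).trans ?_
    congr 1
    ext a
    simp only [Unhappy, Set.mem_ofPred_eq, decide_eq_true_eq, h a, hP, hB, hE, Set.mem_union]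
    by_cases h1 : φ a ∈ I.pref a <;> by_cases h2 : a ∈ I.angry <;> simp [h1, h2]
  · exact Set.disjoint_left.2 fun a h1 h2 => h1.1 h2.1

/-- The returned number is at most every cost and at least the cost of the returned allocation. So
it equals that cost, and the allocation is optimal. -/
theorem isSolution_of_answersProblem {r : Option (ℕ × List (ℕ × ℕ))}
    (h : AnswersProblem I.encode r) : I.IsSolution r := by
  have hcost : ∀ φ, I.IsFeasible φ → ∃ u, r = some u ∧ u.1 ≤ I.cost φ := by
    intro φ hφ
    have hψ : ∀ a : Fin n, (fun a => if h : a < n then (φ ⟨a, h⟩ : ℕ) else 0) (a : ℕ) = φ a := by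
      intro a
      simp
    refine h.2 _ ⟨fun a => if h : a < n then (φ ⟨a, h⟩ : ℕ) else 0, ⟨?_, ?_⟩, listCost_encode I hψ⟩
    · intro a ha b hb hab
      have ha := List.mem_range.1 ha
      have hb := List.mem_range.1 hb
      simp only [ha, hb, dif_pos] at hab
      simpa using hφ.1 (Fin.ext hab)
    · intro a ha
      have ha := List.mem_range.1 ha
      rw [mem_encode_feas]
      exact ⟨⟨a, ha⟩, φ ⟨a, ha⟩, hφ.2 _, rfl, by simp [ha]⟩
  rcases r with _ | ⟨ξ, L⟩
  · intro φ hφ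
    obtain ⟨u, hu, -⟩ := hcost φ hφ
    cases hu
  · obtain ⟨ψ, ha, hc, hL, -⟩ := h.1 (ξ, L) rfl
    have hfe : ∀ a : Fin n, ∃ b : Fin m, b ∈ I.feas a ∧ (b : ℕ) = ψ a := by
      intro a
      obtain ⟨a', b, h1, h2, h3⟩ := (mem_encode_feas I).1 (ha.feas a (List.mem_range.2 a.2))
      rw [Fin.ext h2] at h1
      exact ⟨b, h1, h3⟩
    choose φ hφ1 hφ2 using hfe
    have hφ : I.IsFeasible φ := by
      refine ⟨fun a b hab => ?_, hφ1⟩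
      refine Fin.ext (ha.inj a (List.mem_range.2 a.2) b (List.mem_range.2 b.2) ?_)
      rw [← hφ2, ← hφ2, hab]
    rw [listCost_encode I fun a => (hφ2 a).symm] at hc
    have hopt : ∀ φ', I.IsFeasible φ' → ξ ≤ I.cost φ' := by
      intro φ' hφ'
      obtain ⟨u, hu, h⟩ := hcost φ' hφ'
      cases hu
      exact h
    refine ⟨φ, hφ, fun φ' hφ' => hc.trans (hopt φ' hφ'), le_antisymm (hopt φ hφ) hc, fun p => ?_⟩
    rw [hL]
    constructor
    · rintro ⟨a, ha, rfl⟩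
      exact ⟨⟨a, List.mem_range.1 ha⟩, by rw [hφ2]⟩
    · rintro ⟨a, rfl⟩
      exact ⟨a, List.mem_range.2 a.2, by rw [hφ2]⟩

theorem isSolution_of_annotate {I : Network n m} {r : Option (ℕ × List (ℕ × ℕ))}
    (h : I.annotate.IsSolution r) : I.IsSolution r := by
  have h1 : I.annotate.IsFeasible = fun φ : Fin n → Fin m => Function.Injective φ := by
    funext φ
    simp [AnnotatedNetwork.IsFeasible, Network.annotate]
  have h2 : I.annotate.cost = I.envy := by
    funext φ
    have h3 : {a | a ∈ I.annotate.angry ∧ φ a ∉ I.annotate.pref a} = ∅ := by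
      ext a
      simp [Network.annotate]
    rw [AnnotatedNetwork.cost, h3, Set.ncard_empty, add_zero, Network.envy]
    congr 1
    ext a
    simp only [Network.annotate, Finset.notMem_empty, not_false_eq_true, true_and,
      Set.mem_ofPred_eq, Network.enviedBy, Set.Nonempty]
    constructor
    · rintro ⟨h, b, hb, hb'⟩
      exact ⟨b, hb, h, hb'⟩
    · rintro ⟨b, hb, h, hb'⟩
      exact ⟨h, b, hb, hb'⟩
  rw [AnnotatedNetwork.IsSolution, h1, h2] at h
  exact h

theorem length_filter_product_le {α β γ : Type*} (l : List α) (l' : List β) (p : α × β → Bool)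
    (f : α × β → γ) : (((l.product l').filter p).map f).length ≤ l.length * l'.length := by
  rw [List.length_map, ← List.length_product]
  exact List.length_filter_le _ _

/-- The relation on natural numbers that encodes the agent graph. -/
def AnnotatedNetwork.edge (u v : ℕ) : Prop :=
  ∃ a b : Fin n, I.graph.Adj a b ∧ (a : ℕ) = u ∧ (b : ℕ) = v

/-- The separator algorithm solves instances whose agent graph has small balanced separators. -/
theorem exists_haltsWith {c L : ℝ} (hc : 0 ≤ c) (hL : 0 ≤ L) (hsep : HasSeparators n I.edge c L) :
    ∃ (r : Option (ℕ × List (ℕ × ℕ))) (t : ℕ), separatorAlgorithm.HaltsWith I.encode r t ∧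
      I.IsSolution r ∧
      (t : ℝ) ≤ 2 ^ m * (3400 * ((n + m + 1 : ℕ) : ℝ) ^ 8 * Real.exp (exponent c L n)) := by
  -- The square bounds the lengths of the lists of agent pairs and of agent-house pairs.
  obtain ⟨M, hMdef⟩ : ∃ M, M = (n + m + 1) ^ 2 := ⟨_, rfl⟩
  have hM : 1 ≤ M := hMdef ▸ Nat.one_le_pow _ _ (by omega)
  have hn2 : n * n ≤ M := by rw [hMdef, pow_two]; exact Nat.mul_le_mul (by omega) (by omega)
  have hnm : n * m ≤ M := by rw [hMdef, pow_two]; exact Nat.mul_le_mul (by omega) (by omega)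
  have hn : n ≤ M :=
    hMdef ▸ (by omega : n ≤ n + m + 1).trans (Nat.le_self_pow (by norm_num) _)
  have hm : m ≤ M :=
    hMdef ▸ (by omega : m ≤ n + m + 1).trans (Nat.le_self_pow (by norm_num) _)
  have key : ∀ d, n < d → ∃ r, Runs (separatorAlgorithm.procEval d)
      (separatorAlgorithm.main Ty.Val I.encode) r
      (2 ^ m * (400 * M ^ 2 + ⌊3000 * (M : ℝ) ^ 4 * Real.exp (exponent c L n)⌋₊)) ∧
      AnswersProblem I.encode r := by
    intro d hd
    have := Code.runs_guessHouses (self := separatorAlgorithm.procEval d) (A := I.encode.1)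
      (H := I.encode.2.1) (E := I.encode.2.2.1) (P := I.encode.2.2.2.1) (F := I.encode.2.2.2.2.1)
      (B := I.encode.2.2.2.2.2) (n := n) (M := M)
      (X := ⌊3000 * (M : ℝ) ^ 4 * Real.exp (exponent c L n)⌋₊) (G := I.edge) hM
      List.nodup_range List.nodup_range ?_ ?_ ?_ ?_ ?_ ?_ ?_ ?_ ?_ ?_ ?_ ?_
    · obtain ⟨r, h1, h2⟩ := this
      refine ⟨r, h1.mono ?_, h2⟩
      simp [AnnotatedNetwork.encode]
    · refine List.Nodup.map ?_ (((List.nodup_finRange n).product (List.nodup_finRange m)).filter _)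
      intro p q hpq
      exact Prod.ext (Fin.ext (Prod.ext_iff.1 hpq).1) (Fin.ext (Prod.ext_iff.1 hpq).2)
    · rintro ⟨u, v⟩ hp
      obtain ⟨a, b, -, rfl, rfl⟩ := (mem_encode_feas I).1 hp
      exact List.mem_range.2 b.2
    · intro u v hp
      obtain ⟨a, b, h, rfl, rfl⟩ := (mem_encode_edges I).1 hp
      exact (mem_encode_edges I).2 ⟨b, a, h.symm, rfl, rfl⟩
    · exact fun a ha => List.mem_range.1 ha
    · exact fun u v hp => (mem_encode_edges I).1 hp
    · simpa [AnnotatedNetwork.encode] using hn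
    · simpa [AnnotatedNetwork.encode] using hm
    · refine (length_filter_product_le _ _ _ _).trans ?_
      simpa using hn2
    · refine (length_filter_product_le _ _ _ _).trans ?_
      simpa using hnm
    · refine (length_filter_product_le _ _ _ _).trans ?_
      simpa using hnm
    · refine le_trans ?_ hn
      simp only [AnnotatedNetwork.encode, List.bind_eq_flatMap, List.pure_def, List.length_map,
        List.length_flatMap, List.length_singleton, List.map_const', List.sum_replicate,
        smul_eq_mul, mul_one]
      exact (List.length_filter_le _ _).trans List.length_finRange.le
    · intro H' E' P' F' B' hw
      obtain ⟨r, t, h1, h2, h3⟩ := procEval_spec hc hL hM hsep n _ _ _ _ _ _ hw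
        List.length_range d hd
      exact ⟨r, t, h1, Nat.le_floor h2, h3⟩
  obtain ⟨r, ⟨t, h1, h2⟩, h3⟩ := key (n + 1) (by omega)
  refine ⟨r, t, eventually_atTop.2 ⟨n + 1, fun d hd => ?_⟩, isSolution_of_answersProblem I h3, ?_⟩
  · exact eval_mono (separatorAlgorithm.procEval_mono hd) _ _ h1
  · have hX : (⌊3000 * (M : ℝ) ^ 4 * Real.exp (exponent c L n)⌋₊ : ℝ) ≤
        3000 * (M : ℝ) ^ 4 * Real.exp (exponent c L n) := Nat.floor_le (by positivity)
    have hM1 : (1 : ℝ) ≤ M := by exact_mod_cast hM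
    have he : 1 ≤ Real.exp (exponent c L n) := Real.one_le_exp (exponent_nonneg hc hL n)
    have hM2 : (400 : ℝ) * (M : ℝ) ^ 2 ≤ 400 * (M : ℝ) ^ 4 * Real.exp (exponent c L n) := by
      have : (M : ℝ) ^ 2 ≤ (M : ℝ) ^ 4 := pow_le_pow_right₀ hM1 (by norm_num)
      have : (M : ℝ) ^ 4 ≤ (M : ℝ) ^ 4 * Real.exp (exponent c L n) :=
        le_mul_of_one_le_right (by positivity) he
      linarith
    have ht : (t : ℝ) ≤ 2 ^ m * (400 * (M : ℝ) ^ 2 +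
        (⌊3000 * (M : ℝ) ^ 4 * Real.exp (exponent c L n)⌋₊ : ℝ)) := by exact_mod_cast h2
    have hM8 : ((n + m + 1 : ℕ) : ℝ) ^ 8 = (M : ℝ) ^ 4 := by
      rw [hMdef, Nat.cast_pow, ← pow_mul]
    rw [hM8]
    refine ht.trans (mul_le_mul_of_nonneg_left ?_ (by positivity))
    linarith

end Encoding

/-! ### Balanced separators from tree decompositions -/

/-- Unless all weights together are small enough, elements are collected until the sum reaches a
third of `N`. An element of weight at least `N / 3` suffices alone, as it weighs at most `N / 2`;
otherwise the last element added keeps the sum below `2 N / 3`. -/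
theorem exists_subset_two_thirds {κ : Type*} [DecidableEq κ] (s : Finset κ) (w : κ → ℕ) (N : ℕ)
    (hN : ∑ i ∈ s, w i ≤ N) (hw : ∀ i ∈ s, 2 * w i ≤ N) :
    ∃ J ⊆ s, 3 * ∑ i ∈ J, w i ≤ 2 * N ∧ 3 * ∑ i ∈ s \ J, w i ≤ 2 * N := by
  by_cases h1 : 3 * ∑ i ∈ s, w i ≤ 2 * N
  · exact ⟨s, subset_rfl, h1, by simp⟩
  suffices h : ∃ J ⊆ s, N ≤ 3 * ∑ i ∈ J, w i ∧ 3 * ∑ i ∈ J, w i ≤ 2 * N by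
    obtain ⟨J, hJ, h2, h3⟩ := h
    have := Finset.sum_sdiff (f := w) hJ
    exact ⟨J, hJ, h3, by omega⟩
  have h2 : N ≤ 3 * ∑ i ∈ s, w i := by omega
  clear h1 hN
  induction s using Finset.induction_on with
  | empty => exact ⟨∅, subset_rfl, h2, by simp⟩
  | insert i s hi ih =>
    by_cases h3 : N ≤ 3 * ∑ i ∈ s, w i
    · obtain ⟨J, hJ, h⟩ := ih (fun j hj => hw j (Finset.mem_insert_of_mem hj)) h3
      exact ⟨J, hJ.trans (Finset.subset_insert i s), h⟩
    · have hwi := hw i (Finset.mem_insert_self i s)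
      by_cases h4 : N ≤ 3 * w i
      · refine ⟨{i}, by simp, ?_⟩
        rw [Finset.sum_singleton]
        omega
      · refine ⟨insert i s, subset_rfl, h2, ?_⟩
        rw [Finset.sum_insert hi]
        omega

/-- Take for `j` the node just before the walk first reaches `t`. Deleting the incident edges keeps
`t` as an isolated node, so the node type is unchanged. -/
theorem exists_adj_reachable {ι : Type*} {T : SimpleGraph ι} {i t : ι} (p : T.Walk i t)
    (hit : i ≠ t) : ∃ j, T.Adj t j ∧ (T.deleteIncidenceSet t).Reachable i j := by
  induction p with
  | nil => exact absurd rfl hit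
  | @cons i x t h p ih =>
    by_cases hx : x = t
    · subst hx
      exact ⟨i, h.symm, SimpleGraph.Reachable.refl i⟩
    · obtain ⟨j, h1, h2⟩ := ih hx
      refine ⟨j, h1, SimpleGraph.Reachable.trans (SimpleGraph.Adj.reachable ?_) h2⟩
      exact SimpleGraph.deleteIncidenceSet_adj.2 ⟨h, hit, hx⟩

theorem deleteIncidenceSet_le_deleteEdges {ι : Type*} (T : SimpleGraph ι) {t x y : ι}
    (h : t = x ∨ t = y) : T.deleteIncidenceSet t ≤ T.deleteEdges {s(x, y)} := by
  intro a b hab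
  rw [SimpleGraph.deleteIncidenceSet_adj] at hab
  rw [SimpleGraph.deleteEdges_adj, Set.mem_singleton_iff, Sym2.eq_iff]
  refine ⟨hab.1, ?_⟩
  rintro (⟨rfl, rfl⟩ | ⟨rfl, rfl⟩) <;> rcases h with rfl | rfl
  · exact hab.2.1 rfl
  · exact hab.2.2 rfl
  · exact hab.2.2 rfl
  · exact hab.2.1 rfl

open Classical in
/-- Vertices mapped to the nodes of a tree: removal of some node leaves only components that receive
at most half of the vertices. -/
theorem exists_centroid {ι V : Type*} [Fintype ι] {T : SimpleGraph ι} (hT : T.IsTree)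
    (bag : ι → Finset V) (A : Finset V) (node : V → ι) (hnode : ∀ v, v ∈ bag (node v)) :
    ∃ t, ∀ c, 2 * (A.filter fun v => v ∉ bag t ∧
      (T.deleteIncidenceSet t).connectedComponentMk (node v) = c).card ≤ A.card := by
  -- Otherwise every node `t` has a heavy component, and `f t` is the neighbour of `t` inside it.
  -- The edges from `t` to `f t` turn out to be distinct, giving as many edges as nodes, which is
  -- too many for a tree.
  by_contra! hcon
  choose c hc using hcon
  have hf : ∀ t, ∃ j, T.Adj t j ∧ (T.deleteIncidenceSet t).connectedComponentMk j = c t := by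
    intro t
    have hne : (A.filter fun v => v ∉ bag t ∧
        (T.deleteIncidenceSet t).connectedComponentMk (node v) = c t).Nonempty := by
      rw [← Finset.card_pos]
      have := hc t
      omega
    obtain ⟨v, hv⟩ := hne
    rw [Finset.mem_filter] at hv
    obtain ⟨p⟩ := hT.connected.preconnected (node v) t
    obtain ⟨j, h1, h2⟩ := exists_adj_reachable p fun h => hv.2.1 (h ▸ hnode v)
    exact ⟨j, h1, by rw [← hv.2.2]; exact SimpleGraph.ConnectedComponent.sound h2.symm⟩
  choose f hf1 hf2 using hf
  have hinj : Function.Injective fun t => s(t, f t) := by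
    intro t t' h
    rcases Sym2.eq_iff.1 h with ⟨h, -⟩ | ⟨h1, h2⟩
    · exact h
    · exfalso
      -- Suppose `t` and `t'` choose the same edge. Both heavy sets contain more than half of `A`,
      -- so they share a vertex `v`. Its node is joined to `t'` avoiding `t` and to `t` avoiding
      -- `t'`, which connects the ends of the edge without using it, although edges of a tree are
      -- bridges.
      have hnd : ¬ Disjoint
          (A.filter fun v => v ∉ bag t ∧
            (T.deleteIncidenceSet t).connectedComponentMk (node v) = c t)
          (A.filter fun v => v ∉ bag t' ∧
            (T.deleteIncidenceSet t').connectedComponentMk (node v) = c t') := by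
        intro hd
        have h3 := Finset.card_le_card (Finset.union_subset
          (Finset.filter_subset (fun v => v ∉ bag t ∧
            (T.deleteIncidenceSet t).connectedComponentMk (node v) = c t) A)
          (Finset.filter_subset (fun v => v ∉ bag t' ∧
            (T.deleteIncidenceSet t').connectedComponentMk (node v) = c t') A))
        rw [Finset.card_union_of_disjoint hd] at h3
        have := hc t
        have := hc t'
        omega
      obtain ⟨v, hv, hv'⟩ := Finset.not_disjoint_iff.1 hnd
      rw [Finset.mem_filter, ← hf2] at hv hv'
      have hr := SimpleGraph.ConnectedComponent.exact hv.2.2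
      have hr' := SimpleGraph.ConnectedComponent.exact hv'.2.2
      rw [h2] at hr
      rw [← h1] at hr'
      have hb := SimpleGraph.isAcyclic_iff_forall_isBridge.1 hT.isAcyclic
        ((SimpleGraph.mem_edgeSet _).2 (hf1 t))
      rw [h2, SimpleGraph.isBridge_iff] at hb
      exact hb ((hr'.mono (deleteIncidenceSet_le_deleteEdges T (Or.inr rfl))).symm.trans
        (hr.mono (deleteIncidenceSet_le_deleteEdges T (Or.inl rfl))))
  have hcard := hT.card_edgeFinset
  have hle : Fintype.card ι ≤ T.edgeFinset.card := by
    rw [← Finset.card_univ]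
    refine Finset.card_le_card_of_injOn (fun t => s(t, f t)) (fun t _ => ?_) hinj.injOn
    rw [Finset.mem_coe, SimpleGraph.mem_edgeFinset, SimpleGraph.mem_edgeSet]
    exact hf1 t
  omega

open Classical in
/-- Graphs of treewidth at most `k` have balanced separators of size at most `k + 1`. -/
theorem HasTreewidthAtMost.exists_separator {V : Type} {G : SimpleGraph V} {k : ℕ}
    (h : HasTreewidthAtMost G k) (A : Finset V) : ∃ χ : V → Fin 3,
      3 * (A.filter (χ · = 1)).card ≤ 2 * A.card ∧ 3 * (A.filter (χ · = 2)).card ≤ 2 * A.card ∧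
      (∀ u v, χ u = 1 → χ v = 2 → ¬ G.Adj u v) ∧ (A.filter (χ · = 0)).card ≤ k + 1 := by
  obtain ⟨ι, _, T, bag, hT, hcover, hedge, hconn, hwidth⟩ := h
  choose node hnode using hcover
  obtain ⟨t, ht⟩ := exists_centroid hT bag A node hnode
  -- The nodes whose bags contain `v` are connected and do not include `t`, so they lie in one
  -- component of the rest. Thus adjacent vertices outside `bag t` belong to the same component.
  have hsame : ∀ v i, v ∉ bag t → v ∈ bag i →
      (T.deleteIncidenceSet t).Reachable i (node v) := by
    intro v i hvt hvi
    have hr := (hconn v).preconnected ⟨i, hvi⟩ ⟨node v, hnode v⟩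
    refine hr.map (⟨Subtype.val, fun {a b} hab => ?_⟩ :
      T.induce {i | v ∈ bag i} →g T.deleteIncidenceSet t)
    refine SimpleGraph.deleteIncidenceSet_adj.2 ⟨hab, ?_, ?_⟩
    · rintro rfl; exact hvt a.2
    · rintro rfl; exact hvt b.2
  set comp : V → (T.deleteIncidenceSet t).ConnectedComponent :=
    fun v => (T.deleteIncidenceSet t).connectedComponentMk (node v) with hcomp
  set A' := A.filter fun v => v ∉ bag t with hA'
  have hfib : ∀ J : Finset (T.deleteIncidenceSet t).ConnectedComponent,
      (A'.filter fun v => comp v ∈ J).card =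
        ∑ c ∈ J, (A.filter fun v => v ∉ bag t ∧ comp v = c).card := by
    intro J
    rw [Finset.card_eq_sum_card_fiberwise (f := comp) (t := J)]
    · refine Finset.sum_congr rfl fun c hc => ?_
      congr 1
      ext v
      simp only [hA', Finset.mem_filter]
      constructor
      · rintro ⟨⟨⟨h1, h2⟩, -⟩, h3⟩; exact ⟨h1, h2, h3⟩
      · rintro ⟨h1, h2, h3⟩; exact ⟨⟨⟨h1, h2⟩, h3 ▸ hc⟩, h3⟩
    · intro v hv
      exact (Finset.mem_filter.1 hv).2
  have hfin : Finite (T.deleteIncidenceSet t).ConnectedComponent := Quot.finite _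
  have := Fintype.ofFinite (T.deleteIncidenceSet t).ConnectedComponent
  -- The components are grouped into two sides, each weighted by the number of vertices of `A` that
  -- it receives.
  obtain ⟨J, -, hJ1, hJ2⟩ := exists_subset_two_thirds Finset.univ
    (fun c => (A.filter fun v => v ∉ bag t ∧ comp v = c).card) A.card (by
      rw [← hfib]
      exact Finset.card_le_card ((Finset.filter_subset _ _).trans (Finset.filter_subset _ _)))
    (fun c _ => ht c)
  rw [← hfib] at hJ1 hJ2
  have hχ : ∀ v, (if v ∈ bag t then (0 : Fin 3) else if comp v ∈ J then 1 else 2) = 0 ↔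
      v ∈ bag t := by
    intro v; split_ifs <;> simp_all
  have hχ1 : ∀ v, (if v ∈ bag t then (0 : Fin 3) else if comp v ∈ J then 1 else 2) = 1 ↔
      v ∉ bag t ∧ comp v ∈ J := by
    intro v; split_ifs <;> simp_all
  have hχ2 : ∀ v, (if v ∈ bag t then (0 : Fin 3) else if comp v ∈ J then 1 else 2) = 2 ↔
      v ∉ bag t ∧ comp v ∉ J := by
    intro v; split_ifs <;> simp_all
  refine ⟨fun v => if v ∈ bag t then 0 else if comp v ∈ J then 1 else 2, ?_, ?_, ?_, ?_⟩
  · simp only [hχ1, ← Finset.filter_filter]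
    exact hJ1
  · simp only [hχ2, ← Finset.filter_filter]
    simpa using hJ2
  · intro u v hu hv huv
    rw [hχ1] at hu
    rw [hχ2] at hv
    obtain ⟨i, hui, hvi⟩ := hedge u v huv
    have : comp u = comp v := SimpleGraph.ConnectedComponent.sound
      ((hsame u i hu.1 hui).symm.trans (hsame v i hv.1 hvi))
    exact hv.2 (this ▸ hu.2)
  · simp only [hχ]
    refine le_trans (Finset.card_le_card fun v hv => ?_) (hwidth t)
    exact (Finset.mem_filter.1 hv).2

/-! ### Separators of agent graphs -/

theorem hasSeparators_of_coloring {n m : ℕ} (I : AnnotatedNetwork n m) {c L : ℝ}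
    (h : ∀ A : Finset (Fin n), ∃ χ : Fin n → Fin 3,
      3 * (A.filter (χ · = 1)).card ≤ 2 * A.card ∧ 3 * (A.filter (χ · = 2)).card ≤ 2 * A.card ∧
      (∀ u ∈ A, ∀ v ∈ A, χ u = 1 → χ v = 2 → ¬ I.graph.Adj u v) ∧
      ((A.filter (χ · = 0)).card : ℝ) * Real.log A.card ≤ c * A.card + L) :
    HasSeparators n I.edge c L := by
  intro A hA hlt
  set A' : Finset (Fin n) := Finset.univ.filter fun a => (a : ℕ) ∈ A with hA'
  have hlen : ∀ q : ℕ → Bool, (A.filter q).length = (A'.filter fun a : Fin n => q a = true).card := by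
    intro q
    rw [← List.toFinset_card_of_nodup (hA.filter q)]
    symm
    refine Finset.card_bij (fun a _ => (a : ℕ)) ?_ (fun _ _ _ _ h => Fin.ext h) ?_
    · intro a ha
      simpa [hA'] using ha
    · intro b hb
      simp only [List.mem_toFinset, List.mem_filter] at hb
      exact ⟨⟨b, hlt b hb.1⟩, by simpa [hA'] using hb, rfl⟩
  have hlen' : A.length = A'.card := by
    have := hlen fun _ => true
    simpa using this
  obtain ⟨χ, h1, h2, h3, h4⟩ := h A'
  have hχ : ∀ i, (A.filter fun a => decide ((if h : a < n then χ ⟨a, h⟩ else 0) = i)).length =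
      (A'.filter (χ · = i)).card := by
    intro i
    rw [hlen]
    simp
  refine ⟨fun a => if h : a < n then χ ⟨a, h⟩ else 0, ?_, ?_, ?_, ?_⟩
  · rw [hχ, hlen']; exact h1
  · rw [hχ, hlen']; exact h2
  · rintro u hu v hv hu1 hv2 ⟨a, b, hab, rfl, rfl⟩
    simp only [Fin.is_lt, dif_pos, Fin.eta] at hu1 hv2
    exact h3 a (by simpa [hA'] using hu) b (by simpa [hA'] using hv) hu1 hv2 hab
  · rw [hχ, hlen']; exact h4

/-- The separator size does not grow with the subset, so there is no linear term and the whole bound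
goes into `L`. -/
theorem hasSeparators_of_treewidth {n m tw : ℕ} (I : AnnotatedNetwork n m)
    (h : HasTreewidthAtMost I.graph tw) :
    HasSeparators n I.edge 0 ((tw + 1) * Real.log n) := by
  refine hasSeparators_of_coloring I fun A => ?_
  obtain ⟨χ, h1, h2, h3, h4⟩ := h.exists_separator A
  refine ⟨χ, by convert h1, by convert h2, fun u _ v _ => h3 u v, ?_⟩
  rw [zero_mul, zero_add]
  have h5 : ((A.filter (χ · = 0)).card : ℝ) ≤ tw + 1 := by
    have : (A.filter (χ · = 0)).card ≤ tw + 1 := by convert h4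
    exact_mod_cast this
  rcases Nat.eq_zero_or_pos A.card with h0 | h0
  · rw [h0]
    have := Real.log_natCast_nonneg n
    simp only [Nat.cast_zero, Real.log_zero, mul_zero]
    positivity
  · have h6 : Real.log A.card ≤ Real.log n := by
      refine Real.log_le_log (by exact_mod_cast h0) ?_
      have := A.card_le_univ
      rw [Fintype.card_fin] at this
      exact_mod_cast this
    have := Real.log_natCast_nonneg A.card
    gcongr

open Classical in
-- The class contains the subgraph induced by `A`, so the separator bound may be applied with `|A|`
-- in place of `n`.
theorem hasSeparators_of_class {n m : ℕ} (I : AnnotatedNetwork n m) {𝒢 : GraphClass} {f : ℕ → ℝ}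
    {c : ℝ} (hf : ∀ k s : ℕ, (s : ℝ) ≤ f k → s ≤ k → (s : ℝ) * Real.log k ≤ c * k)
    (h𝒢 : IsBalancedSeparable 𝒢 f) (hI : 𝒢 (Fin n) I.graph) : HasSeparators n I.edge c 0 := by
  refine hasSeparators_of_coloring I fun A => ?_
  have hA := (h𝒢 (Fin n) I.graph hI).1 (A : Set (Fin n))
  obtain ⟨-, S, V₁, V₂, -, -, hd, hcov, hS, hV₁, hV₂, hadj⟩ :=
    h𝒢 (A : Set (Fin n)) (I.graph.induce (A : Set (Fin n))) hA
  have hcard : Fintype.card (A : Set (Fin n)) = A.card := by simp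
  rw [hcard] at hS hV₁ hV₂
  set χ : Fin n → Fin 3 := fun v => if h : v ∈ A then
    (if (⟨v, h⟩ : (A : Set (Fin n))) ∈ V₁ then 1 else
      if (⟨v, h⟩ : (A : Set (Fin n))) ∈ V₂ then 2 else 0) else 0 with hχ
  -- It suffices that each colour class within `A` is contained in the corresponding part of the
  -- partition.
  have hle : ∀ (i : Fin 3) (V : Finset (A : Set (Fin n))),
      (∀ (v : Fin n) (h : v ∈ A), χ v = i → (⟨v, h⟩ : (A : Set (Fin n))) ∈ V) →
      (A.filter (χ · = i)).card ≤ V.card := by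
    intro i V hV
    rw [← Finset.card_map (Function.Embedding.subtype _)]
    refine Finset.card_le_card fun v hv => ?_
    rw [Finset.mem_filter] at hv
    rw [Finset.mem_map]
    exact ⟨⟨v, hv.1⟩, hV v hv.1 hv.2, rfl⟩
  have h1 : ∀ (v : Fin n) (h : v ∈ A), χ v = 1 → (⟨v, h⟩ : (A : Set (Fin n))) ∈ V₁ := by
    intro v h hv
    by_contra hn
    simp only [hχ, h, dif_pos, hn, if_false] at hv
    split_ifs at hv
    · exact absurd hv (by decide)
    · exact absurd hv (by decide)
  have h2 : ∀ (v : Fin n) (h : v ∈ A), χ v = 2 → (⟨v, h⟩ : (A : Set (Fin n))) ∈ V₂ := by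
    intro v h hv
    by_contra hn
    simp only [hχ, h, dif_pos, hn, if_false] at hv
    split_ifs at hv
    · exact absurd hv (by decide)
    · exact absurd hv (by decide)
  have h0 : ∀ (v : Fin n) (h : v ∈ A), χ v = 0 → (⟨v, h⟩ : (A : Set (Fin n))) ∈ S := by
    intro v h hv
    by_contra hn
    simp only [hχ, h, dif_pos] at hv
    split_ifs at hv with hv1 hv2
    · exact absurd hv (by decide)
    · exact absurd hv (by decide)
    · rcases hcov ⟨v, h⟩ with h' | h' | h'
      · exact hn h'
      · exact hv1 h'
      · exact hv2 h'
  have key : ∀ V : Finset (A : Set (Fin n)), (V.card : ℝ) ≤ 2 * (A.card : ℝ) / 3 →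
      3 * V.card ≤ 2 * A.card := by
    intro V hV
    have : (3 : ℝ) * V.card ≤ 2 * A.card := by linarith
    exact_mod_cast this
  have h01 := hle 1 V₁ h1
  have h02 := hle 2 V₂ h2
  refine ⟨χ, ?_, ?_, ?_, ?_⟩
  · have := key V₁ hV₁
    have h : (A.filter (χ · = 1)).card ≤ V₁.card := by convert h01
    omega
  · have := key V₂ hV₂
    have h : (A.filter (χ · = 2)).card ≤ V₂.card := by convert h02
    omega
  · intro u hu v hv hu1 hv2 huv
    exact hadj _ (h1 u hu hu1) _ (h2 v hv hv2) huv
  · rw [add_zero]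
    refine hf _ _ (le_trans ?_ hS) (Finset.card_filter_le _ _)
    have := hle 0 S h0
    exact_mod_cast (by convert this)

/-- The recursion reaches small sets, about which the asymptotic bound says nothing. There `s ≤ k`
is used, with a logarithm bounded by a constant; the maximum with `2` makes `log k` positive in the
other case. -/
theorem mul_log_le_of_isBigO {f : ℕ → ℝ} (hf : f =O[atTop] fun n : ℕ => (n : ℝ) / Real.log n) :
    ∃ c : ℝ, 0 ≤ c ∧ ∀ k s : ℕ, (s : ℝ) ≤ f k → s ≤ k → (s : ℝ) * Real.log k ≤ c * k := by
  obtain ⟨C, hC, hbound⟩ := hf.exists_nonneg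
  obtain ⟨N, hN⟩ := eventually_atTop.1 hbound.bound
  have hlogN : 0 ≤ Real.log ((max N 2 : ℕ) : ℝ) := Real.log_natCast_nonneg _
  refine ⟨C + Real.log ((max N 2 : ℕ) : ℝ), by positivity, fun k s hs hsk => ?_⟩
  have hk0 : (0 : ℝ) ≤ k := by positivity
  have hlogk : 0 ≤ Real.log k := Real.log_natCast_nonneg _
  rcases le_or_gt (max N 2) k with hk | hk
  · have hk2 : 1 < (k : ℝ) := by
      have : 2 ≤ k := (le_max_right N 2).trans hk
      exact_mod_cast this
    have hl := Real.log_pos hk2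
    have h1 := hN k ((le_max_left N 2).trans hk)
    rw [Real.norm_eq_abs, Real.norm_eq_abs, abs_of_nonneg (by positivity : 0 ≤ (k : ℝ) / Real.log k)]
      at h1
    have h2 : (s : ℝ) ≤ C * (k / Real.log k) := hs.trans ((le_abs_self _).trans h1)
    calc (s : ℝ) * Real.log k ≤ C * (k / Real.log k) * Real.log k := by gcongr
      _ = C * k := by field_simp
      _ ≤ _ := by
        have : 0 ≤ Real.log ((max N 2 : ℕ) : ℝ) * k := by positivity
        linarith
  · have h1 : (s : ℝ) ≤ k := by exact_mod_cast hsk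
    rcases Nat.eq_zero_or_pos k with rfl | hk1
    · simp
    have h2 : Real.log k ≤ Real.log ((max N 2 : ℕ) : ℝ) :=
      Real.log_le_log (by exact_mod_cast hk1) (by exact_mod_cast hk.le)
    calc (s : ℝ) * Real.log k ≤ k * Real.log ((max N 2 : ℕ) : ℝ) := by gcongr
      _ ≤ _ := by
        have : 0 ≤ C * k := by positivity
        linarith

/-! ### Running times -/

/-- The factors `2 ^ m`, `3400` and `(n + m + 1) ^ 8` are at most `exp m`, `exp (12 n)` and `exp (8
(n + m + 1))`. As `m ≤ c n` and `n ≥ 1`, their exponents add up to at most `(9 c + 28) n`. Division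
by `log 2` changes the base from `e` to `2`. -/
theorem AnnotatedNetwork.solvedWithin_of_hasSeparators {n m : ℕ} (I : AnnotatedNetwork n m)
    {c b L K Z : ℝ} (hn : 1 ≤ n) (hm : (m : ℝ) ≤ c * n) (hb : 0 ≤ b) (hL : 0 ≤ L)
    (hsep : HasSeparators n I.edge b L) (hK : (9 * c + 28) * n + exponent b L n ≤ K * Z) :
    I.SolvedWithin ((2 : ℝ) ^ (K / Real.log 2 * Z)) := by
  obtain ⟨r, t, h1, h2, h3⟩ := exists_haltsWith I hb hL hsep
  refine ⟨r, t, h1, h2, h3.trans ?_⟩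
  have hn1 : (1 : ℝ) ≤ n := by exact_mod_cast hn
  have he1 : (2 : ℝ) ≤ Real.exp 1 := by
    have := Real.add_one_le_exp (1 : ℝ)
    linarith
  have e1 : (2 : ℝ) ^ m ≤ Real.exp m := by
    rw [← Real.exp_one_pow]
    gcongr
  have e2 : (3400 : ℝ) ≤ Real.exp (12 * n) := by
    calc (3400 : ℝ) ≤ 2 ^ 12 := by norm_num
      _ ≤ Real.exp 1 ^ 12 := by gcongr
      _ = Real.exp 12 := by rw [← Real.exp_nat_mul]; norm_num
      _ ≤ _ := by gcongr; linarith
  have e3 : ((n + m + 1 : ℕ) : ℝ) ^ 8 ≤ Real.exp (8 * (n + m + 1)) := by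
    have h : ((n + m + 1 : ℕ) : ℝ) ≤ Real.exp (n + m + 1) := by
      have := Real.add_one_le_exp ((n : ℝ) + m + 1)
      push_cast
      linarith
    calc ((n + m + 1 : ℕ) : ℝ) ^ 8 ≤ Real.exp (n + m + 1) ^ 8 := by gcongr
      _ = _ := by rw [← Real.exp_nat_mul]; norm_num
  have e4 : (2 : ℝ) ^ (K / Real.log 2 * Z) = Real.exp (K * Z) := by
    have hl : Real.log 2 ≠ 0 := (Real.log_pos (by norm_num)).ne'
    rw [Real.rpow_def_of_pos (by norm_num)]
    congr 1
    field_simp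
  rw [e4]
  calc (2 : ℝ) ^ m * (3400 * ((n + m + 1 : ℕ) : ℝ) ^ 8 * Real.exp (exponent b L n))
      ≤ Real.exp m * (Real.exp (12 * n) * Real.exp (8 * (n + m + 1)) *
        Real.exp (exponent b L n)) := by gcongr
    _ = Real.exp (m + (12 * n + 8 * (n + m + 1) + exponent b L n)) := by
      rw [← Real.exp_add, ← Real.exp_add, ← Real.exp_add]
    _ ≤ _ := by
      gcongr
      linarith

/-- Bags have `tw + 1` elements, which leaves a term `log n ^ 2` even for `tw = 0`; this bound
absorbs it into the linear term. It follows from `log √n ≤ √n`. -/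
theorem log_sq_le {n : ℕ} (hn : 1 ≤ n) : Real.log n ^ 2 ≤ 4 * n := by
  have hn0 : (0 : ℝ) < n := by exact_mod_cast hn
  have h1 : Real.log n = 2 * Real.log (Real.sqrt n) := by
    rw [Real.log_sqrt hn0.le]
    ring
  have h2 : Real.log (Real.sqrt n) ≤ Real.sqrt n := Real.log_le_self (Real.sqrt_nonneg _)
  have h3 : 0 ≤ Real.log (Real.sqrt n) := by
    have := Real.log_natCast_nonneg n
    linarith
  have h4 := Real.sq_sqrt hn0.le
  rw [h1]
  nlinarith

theorem Network.solvedWithin_of_annotate {n m : ℕ} {I : Network n m} {T : ℝ}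
    (h : I.annotate.SolvedWithin T) : I.SolvedWithin T := by
  obtain ⟨r, t, h1, h2, h3⟩ := h
  exact ⟨r, t, h1, isSolution_of_annotate h2, h3⟩

theorem AnnotatedNetwork.solvedWithin_of_treewidth {n m tw : ℕ} (I : AnnotatedNetwork n m) {c : ℝ}
    (hn : 1 ≤ n) (hc : 0 ≤ c) (hm : (m : ℝ) ≤ c * n) (h : HasTreewidthAtMost I.graph tw) :
    I.SolvedWithin ((2 : ℝ) ^
      ((9 * c + 43 + 5 / Real.log (3 / 2)) / Real.log 2 * (tw * Real.log n ^ 2 + n))) := by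
  have hl := log_three_halves_pos
  have hlog := Real.log_natCast_nonneg n
  refine I.solvedWithin_of_hasSeparators hn hm le_rfl (by positivity)
    (hasSeparators_of_treewidth I h) ?_
  have h1 := log_sq_le hn
  have hn0 : (0 : ℝ) ≤ n := by positivity
  have ht : (0 : ℝ) ≤ tw * Real.log n ^ 2 := by positivity
  have h2 : exponent 0 ((tw + 1) * Real.log n) n =
      15 * n + 1 / Real.log (3 / 2) * (tw * Real.log n ^ 2 + Real.log n ^ 2) := by
    unfold exponent
    field_simp
    ring
  -- By `log_sq_le` the extra `log n ^ 2` is at most `4 n`, which explains the constant `5`.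
  have h3 : 1 / Real.log (3 / 2) * (tw * Real.log n ^ 2 + Real.log n ^ 2) ≤
      5 / Real.log (3 / 2) * (tw * Real.log n ^ 2 + n) := by
    rw [div_mul_eq_mul_div, div_mul_eq_mul_div]
    refine div_le_div_of_nonneg_right ?_ hl.le
    linarith
  have h4 : (9 * c + 43) * n ≤ (9 * c + 43) * (tw * Real.log n ^ 2 + n) := by
    gcongr
    linarith
  rw [h2]
  linarith

theorem AnnotatedNetwork.solvedWithin_of_class {n m : ℕ} (I : AnnotatedNetwork n m) {𝒢 : GraphClass}
    {f : ℕ → ℝ} {b c : ℝ} (hn : 1 ≤ n) (hm : (m : ℝ) ≤ c * n) (hb : 0 ≤ b)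
    (hf : ∀ k s : ℕ, (s : ℝ) ≤ f k → s ≤ k → (s : ℝ) * Real.log k ≤ b * k)
    (h𝒢 : IsBalancedSeparable 𝒢 f) (hI : 𝒢 (Fin n) I.graph) :
    I.SolvedWithin ((2 : ℝ) ^ ((9 * c + 3 * b + 43) / Real.log 2 * n)) := by
  refine I.solvedWithin_of_hasSeparators hn hm hb le_rfl (hasSeparators_of_class I hf h𝒢 hI) ?_
  unfold exponent
  rw [zero_div, zero_mul]
  linarith

end HouseAllocation

open HouseAllocation in
theorem mainTheorem10 :
    (∀ c : ℝ, ∃ C : ℝ, ∀ (tw n m : ℕ), 1 ≤ n → (m : ℝ) ≤ c * n →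
      (∀ I : AnnotatedNetwork n m, HasTreewidthAtMost I.graph tw →
        I.SolvedWithin ((2 : ℝ) ^ (C * (tw * Real.log n ^ 2 + n)))) ∧
      (∀ I : Network n m, HasTreewidthAtMost I.graph tw →
        I.SolvedWithin ((2 : ℝ) ^ (C * (tw * Real.log n ^ 2 + n))))) ∧
    (∀ f : ℕ → ℝ, f =O[atTop] (fun n : ℕ => (n : ℝ) / Real.log n) →
      ∀ c : ℝ, ∃ C : ℝ, ∀ 𝒢 : GraphClass, IsBalancedSeparable 𝒢 f →
        ∀ n m : ℕ, 1 ≤ n → (m : ℝ) ≤ c * n →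
          (∀ I : AnnotatedNetwork n m, 𝒢 (Fin n) I.graph →
            I.SolvedWithin ((2 : ℝ) ^ (C * n))) ∧
          (∀ I : Network n m, 𝒢 (Fin n) I.graph →
            I.SolvedWithin ((2 : ℝ) ^ (C * n)))) := by
  -- The given `c` may be negative, while the treewidth bound multiplies an inequality by a constant
  -- built from `c`, which has to be nonnegative.
  have hmax : ∀ {c : ℝ} {n m : ℕ}, (m : ℝ) ≤ c * n → (m : ℝ) ≤ max c 0 * n := fun h =>
    h.trans (mul_le_mul_of_nonneg_right (le_max_left _ _) (Nat.cast_nonneg _))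
  refine ⟨fun c => ⟨(9 * max c 0 + 43 + 5 / Real.log (3 / 2)) / Real.log 2, fun tw n m hn hm => ?_⟩, fun f hf c => ?_⟩
  · exact ⟨fun I hI => I.solvedWithin_of_treewidth hn (le_max_right c 0) (hmax hm) hI,
      fun I hI => Network.solvedWithin_of_annotate
        (I.annotate.solvedWithin_of_treewidth hn (le_max_right c 0) (hmax hm) hI)⟩
  · obtain ⟨b, hb, hfb⟩ := mul_log_le_of_isBigO hf
    refine ⟨(9 * c + 3 * b + 43) / Real.log 2, fun 𝒢 h𝒢 n m hn hm => ?_⟩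
    exact ⟨fun I hI => I.solvedWithin_of_class hn hm hb hfb h𝒢 hI,
      fun I hI => Network.solvedWithin_of_annotate
        (I.annotate.solvedWithin_of_class hn hm hb hfb h𝒢 hI)⟩
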